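/- Let $\mathfrak g$ be the compact real Lie algebra of type $E_8$ (negative definite Killing form $B$, and complexification of type $E_8$), let $G=\mathrm{Aut}(\mathfrak g)$ be the compact simple Lie group $E_8$, let $\mathfrak k\subset\mathfrak g$ be a subalgebra isomorphic to $\mathfrak{su}(5)\oplus\mathfrak{su}(5)$, and let $K\subset G$ be the connected Lie subgroup with Lie algebra $\mathfrak k$ (so that $G/K$ is the space $E_8/\mathrm{SU}(5)\times\mathrm{SU}(5)$). Let $\mathfrak p$ be the $B$-orthogonal complement of $\mathfrak k$, identified with the tangent space of $G/K$ at the base point; $G$-invariant Riemannian metrics on $G/K$ correspond to $\mathrm{Ad}(K)$-invariant inner products on $\mathfrak p$. Let $g_B$ be the standard metric, given by $\langle\cdot,\cdot\rangle=-B|_{\mathfrak p\times\mathfrak p}$. Then: 1. $\mathfrak p=\mathfrak p_1\oplus\mathfrak p_2$ is an orthogonal sum of two inequivalent $\mathrm{Ad}(K)$-irreducible subspaces, each of dimension $100$. With $[ijk]=\sum_{\alpha,\beta,\gamma}\langle[X^i_\alpha,X^j_\beta],X^k_\gamma\rangle^2$, where $\{X^i_\alpha\}$ is an orthonormal basis of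 $\mathfrak p_i$ with respect to $g_B$, one has $[111]=[222]=0$ and $[112]=[122]=20$. 2. $g_B$ is Einstein, $\mathrm{Rc}(g_B)=\rho\, g_B$, with $\rho=\tfrac7{20}$. 3. The smallest eigenvalue $\lambda_{\mathfrak p}$ of the Lichnerowicz Laplacian $\Delta_L$ of $g_B$ on the space $\mathcal{TT}^G$ of $G$-invariant, traceless, divergence-free symmetric $2$-tensors is $\lambda_{\mathfrak p}=\tfrac45>\tfrac7{10}=2\rho$. 4. Hence $g_B$ is $G$-stable, that is, the second variation $\tfrac12\langle(2\rho-\Delta_L)T,T\rangle$ of the total scalar curvature is negative for every nonzero $T\in\mathcal{TT}^G$. 5. Up to scaling, $g_B$ is the unique $G$-invariant Einstein metric on $G/K$. 6. $g_B$ is a global maximum of the scalar curvature on the set of all $G$-invariant metrics on $G/K$ of the same volume as $g_B$. -/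

import Mathlib

open scoped TensorProduct

noncomputable section

namespace HomEinstein

/-! ## Compact Lie algebras, the type `E₈`, and `su(n)` -/

/-- A real Lie algebra is compact semisimple if its Killing form is negative definite. -/
class CompactSemisimple (L : Type*) [LieRing L] [LieAlgebra ℝ L] : Prop where
  neg : ∀ x : L, x ≠ 0 → killingForm ℝ L x x < 0

/-- A finite dimensional complex Lie algebra is of type `E₈` if its Killing form is nondegenerate
and its root system has the Cartan matrix `E₈` in some base. All Cartan subalgebras are conjugate,
so the condition does not depend on the Cartan subalgebra `H`; a Cartan subalgebra always exists. -/
def IsTypeE8 (L : Type*) [LieRing L] [LieAlgebra ℂ L] [FiniteDimensional ℂ L] : Prop :=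
  ∃ _ : LieAlgebra.IsKilling ℂ L, ∀ (H : LieSubalgebra ℂ L) [H.IsCartanSubalgebra],
    ∃ (b : (LieAlgebra.IsKilling.rootSystem H).Base) (e : b.support ≃ Fin 8),
      Matrix.reindex e e b.cartanMatrix = CartanMatrix.E₈

section

attribute [local instance] LieRing.ofAssociativeRing

/-- The real Lie algebra `su(n)` of traceless skew-Hermitian complex matrices. -/
def su (n : ℕ) : LieSubalgebra ℝ (Matrix (Fin n) (Fin n) ℂ) where
  carrier := {A | A.conjTranspose = -A ∧ A.trace = 0}
  add_mem' := by
    rintro A B ⟨hA, hA'⟩ ⟨hB, hB'⟩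
    exact ⟨by rw [Matrix.conjTranspose_add, hA, hB, neg_add], by
      rw [Matrix.trace_add, hA', hB', add_zero]⟩
  zero_mem' := by simp
  smul_mem' := by
    rintro c A ⟨hA, hA'⟩
    exact ⟨by rw [Matrix.conjTranspose_smul, hA]; simp, by rw [Matrix.trace_smul, hA', smul_zero]⟩
  lie_mem' := by
    rintro A B ⟨hA, -⟩ ⟨hB, -⟩
    refine ⟨?_, by simp [Ring.lie_def, Matrix.trace_sub, Matrix.trace_mul_comm A B]⟩
    rw [Ring.lie_def, Matrix.conjTranspose_sub, Matrix.conjTranspose_mul,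
      Matrix.conjTranspose_mul, hA, hB]
    simp

end

/-! ## Inner products and orthonormal bases -/

/-- A (positive definite) inner product on a real vector space. -/
structure InnerProd (V : Type*) [AddCommGroup V] [Module ℝ V] where
  form : LinearMap.BilinForm ℝ V
  symm : ∀ x y, form x y = form y x
  pos : ∀ x, x ≠ 0 → 0 < form x x

section InnerProd

variable {V : Type*} [AddCommGroup V] [Module ℝ V]

/-- The restriction of an inner product to a subspace. -/
def InnerProd.restrict (g : InnerProd V) (W : Submodule ℝ V) : InnerProd W where
  form := g.form.domRestrict₁₂ W W
  symm x y := g.symm x y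
  pos x hx := g.pos x (fun h => hx (Subtype.ext h))

theorem InnerProd.exists_orthonormal [FiniteDimensional ℝ V] (g : InnerProd V) :
    ∃ b : Module.Basis (Fin (Module.finrank ℝ V)) ℝ V,
      ∀ i j, g.form (b i) (b j) = if i = j then 1 else 0 := by
  let core : InnerProductSpace.Core ℝ V :=
    { inner := fun x y => g.form x y
      conj_inner_symm := fun x y => by simpa using g.symm y x
      re_inner_nonneg := fun x => by
        by_cases hx : x = 0
        · simp [hx]
        · simpa using (g.pos x hx).le
      add_left := fun x y z => by simp
      smul_left := fun x y r => by simp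
      definite := fun x hx => by
        by_contra h
        exact (g.pos x h).ne' hx }
  let _ : NormedAddCommGroup V := core.toNormedAddCommGroup
  let _ : InnerProductSpace ℝ V := InnerProductSpace.ofCore core.toCore
  refine ⟨(stdOrthonormalBasis ℝ V).toBasis, fun i j => ?_⟩
  have h := (orthonormal_iff_ite.1 (stdOrthonormalBasis ℝ V).orthonormal) i j
  rw [OrthonormalBasis.coe_toBasis]
  exact h

variable [FiniteDimensional ℝ V]

/-- A chosen orthonormal basis of an inner product. The quantities defined below by means of it do
not depend on the choice. -/
def InnerProd.basis (g : InnerProd V) : Module.Basis (Fin (Module.finrank ℝ V)) ℝ V :=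
  g.exists_orthonormal.choose

theorem InnerProd.basis_orthonormal (g : InnerProd V) (i j : Fin (Module.finrank ℝ V)) :
    g.form (g.basis i) (g.basis j) = if i = j then 1 else 0 :=
  g.exists_orthonormal.choose_spec i j

end InnerProd

/-! ## The homogeneous space -/

section Homogeneous

variable {L : Type*} [LieRing L] [LieAlgebra ℝ L]

/-- The group `G = Aut L` of automorphisms of the Lie algebra `L`. If `L` is compact of
type `E₈`, this is the compact simple Lie group `E₈`, acting on its Lie algebra `L` by `Ad`. -/
def autGroup (L : Type*) [LieRing L] [LieAlgebra ℝ L] : Subgroup (L ≃ₗ[ℝ] L) where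
  carrier := {φ | ∀ x y, φ ⁅x, y⁆ = ⁅φ x, φ y⁆}
  one_mem' _ _ := rfl
  mul_mem' {a b} ha hb x y := (congrArg a (hb x y)).trans (ha (b x) (b y))
  inv_mem' {a} ha x y := by
    apply a.injective
    rw [ha]
    simp [← LinearEquiv.mul_apply]

/-- `IsExpAd Z φ` says `φ = exp (ad Z)`. The convergence of the exponential series is tested on
linear functionals, which for finite dimensional `L` is convergence in the usual topology. -/
def IsExpAd (Z : L) (φ : autGroup L) : Prop :=
  ∀ (f : Module.Dual ℝ L) (x : L),
    HasSum (fun n : ℕ => (n.factorial : ℝ)⁻¹ * f ((LieAlgebra.ad ℝ L Z)^[n] x)) (f (φ.1 x))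

/-- The connected Lie subgroup `K` of `G` with Lie algebra `k`: the subgroup generated by all
`exp (ad Z)`, `Z ∈ k`. -/
def groupK (k : LieSubalgebra ℝ L) : Subgroup (autGroup L) :=
  Subgroup.closure {φ | ∃ Z ∈ k, IsExpAd Z φ}

theorem killingForm_autGroup (φ : autGroup L) (x y : L) :
    killingForm ℝ L (φ.1 x) (φ.1 y) = killingForm ℝ L x y :=
  LieAlgebra.killingForm_of_equiv_apply (R := ℝ)
    ({ φ.1 with map_lie' := fun {x y} => φ.2 x y } : L ≃ₗ⁅ℝ⁆ L) x y

/-- The Killing-orthogonal complement `p` of `k`, which is the tangent space of `G/K` at the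
base point. -/
def tangent (k : LieSubalgebra ℝ L) : Submodule ℝ L :=
  (killingForm ℝ L).orthogonal k.toSubmodule

theorem mem_tangent {k : LieSubalgebra ℝ L} {x : L} :
    x ∈ tangent k ↔ ∀ z ∈ k, killingForm ℝ L z x = 0 := Iff.rfl

variable [FiniteDimensional ℝ L]

theorem isExpAd_mem {k : LieSubalgebra ℝ L} {Z : L} (hZ : Z ∈ k) {φ : autGroup L}
    (h : IsExpAd Z φ) {x : L} (hx : x ∈ k) : φ.1 x ∈ k := by
  by_contra hn
  obtain ⟨f, hf, hfk⟩ := Submodule.exists_le_ker_of_notMem (p := k.toSubmodule) (v := φ.1 x) hn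
  have hpow : ∀ n : ℕ, (LieAlgebra.ad ℝ L Z)^[n] x ∈ k := by
    intro n
    induction n with
    | zero => exact hx
    | succ n ih =>
      rw [Function.iterate_succ_apply']
      exact k.lie_mem hZ ih
  have h0 : (fun n : ℕ => (n.factorial : ℝ)⁻¹ * f ((LieAlgebra.ad ℝ L Z)^[n] x)) =
      fun _ => 0 := by
    funext n
    rw [show f ((LieAlgebra.ad ℝ L Z)^[n] x) = 0 from hfk (hpow n), mul_zero]
  have h1 := h f x
  rw [h0] at h1
  exact hf (h1.unique hasSum_zero)

theorem groupK_map_mem {k : LieSubalgebra ℝ L} {φ : autGroup L} (hφ : φ ∈ groupK k) :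
    ∀ x, φ.1 x ∈ k ↔ x ∈ k := by
  induction hφ using Subgroup.closure_induction with
  | mem φ h =>
    obtain ⟨Z, hZ, h⟩ := h
    have hle : k.toSubmodule.map φ.1.toLinearMap ≤ k.toSubmodule := by
      rintro _ ⟨x, hx, rfl⟩
      exact isExpAd_mem hZ h hx
    have heq : k.toSubmodule.map φ.1.toLinearMap = k.toSubmodule :=
      Submodule.eq_of_le_of_finrank_eq hle (LinearEquiv.finrank_map_eq φ.1 _)
    intro x
    refine ⟨fun hx => ?_, fun hx => isExpAd_mem hZ h hx⟩
    have : φ.1 x ∈ k.toSubmodule.map φ.1.toLinearMap := by rw [heq]; exact hx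
    obtain ⟨y, hy, hyx⟩ := this
    rwa [← φ.1.injective hyx]
  | one => intro x; exact Iff.rfl
  | mul a b _ _ ha hb => intro x; exact (ha (b.1 x)).trans (hb x)
  | inv a _ ha =>
    intro x
    rw [← ha (a⁻¹.1 x)]
    exact iff_of_eq (congrArg (· ∈ k) (a.1.apply_symm_apply x))

theorem groupK_tangent {k : LieSubalgebra ℝ L} {φ : autGroup L} (hφ : φ ∈ groupK k) {x : L}
    (hx : x ∈ tangent k) : φ.1 x ∈ tangent k := by
  intro z hz
  have h1 : φ.1 (φ.1.symm z) = z := φ.1.apply_symm_apply z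
  have h2 : φ.1.symm z ∈ k := by
    rw [← groupK_map_mem hφ, h1]; exact hz
  have h3 := killingForm_autGroup φ (φ.1.symm z) x
  rw [h1] at h3
  change killingForm ℝ L z (φ.1 x) = 0
  rw [h3]
  exact hx _ h2

/-- The isotropy representation `Ad : K → GL(p)`. -/
def isotropy (k : LieSubalgebra ℝ L) (φ : groupK k) : tangent k →ₗ[ℝ] tangent k :=
  φ.1.1.toLinearMap.restrict fun _ hx => groupK_tangent φ.2 hx

variable [CompactSemisimple L]

theorem isCompl_tangent (k : LieSubalgebra ℝ L) : IsCompl k.toSubmodule (tangent k) := by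
  have hr : (killingForm ℝ L).IsRefl := (LieModule.traceForm_isSymm ℝ L L).isRefl
  refine (LinearMap.BilinForm.isCompl_orthogonal_iff_disjoint hr).2 ?_
  rw [Submodule.disjoint_def]
  intro x hx hx'
  by_contra h
  exact (CompactSemisimple.neg x h).ne (hx' x hx)

/-- The projection of `L = k ⊕ p` onto `p`. -/
def projP (k : LieSubalgebra ℝ L) : L →ₗ[ℝ] tangent k :=
  Submodule.projectionOnto _ _ (isCompl_tangent k).symm

/-- The component in `p` of the Lie bracket of two elements of `p`. -/
def bracketP {k : LieSubalgebra ℝ L} (x y : tangent k) : tangent k := projP k ⁅(x : L), (y : L)⁆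

/-- The component in `k` of the Lie bracket of two elements of `p`. -/
def bracketK {k : LieSubalgebra ℝ L} (x y : tangent k) : L :=
  ⁅(x : L), (y : L)⁆ - (bracketP x y : L)

/-! ## Invariant metrics and their curvature -/

/-- A `G`-invariant Riemannian metric on `G/K`, that is, an `Ad(K)`-invariant inner product on
the tangent space `p` at the base point. -/
structure InvMetric (k : LieSubalgebra ℝ L) extends InnerProd (tangent k) where
  invariant : ∀ (φ : groupK k) (x y : tangent k),
    form (isotropy k φ x) (isotropy k φ y) = form x y

/-- The standard metric: minus the Killing form of `L`, restricted to `p`. -/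
def standardMetric (k : LieSubalgebra ℝ L) : InvMetric k where
  form := -((killingForm ℝ L).domRestrict₁₂ (tangent k) (tangent k))
  symm x y := congrArg Neg.neg (LieModule.traceForm_comm ℝ L L (x : L) (y : L))
  pos x hx := neg_pos.2 (CompactSemisimple.neg (x : L) (fun h => hx (Subtype.ext h)))
  invariant φ x y := congrArg Neg.neg
    (killingForm_autGroup φ.1 (x : L) (y : L))

namespace InvMetric

variable {k : LieSubalgebra ℝ L} (g : InvMetric k)

/-- The Levi-Civita connection of `g` at the base point (Nomizu operators):
`Λ(x) y = ½ [x, y]_p + U(x, y)` with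
`2 g(U(x, y), z) = g([z, x]_p, y) + g(x, [z, y]_p)` for all `z`. -/
def nomizu (x y : tangent k) : tangent k :=
  (1 / 2 : ℝ) • bracketP x y + ∑ i, ((1 / 2 : ℝ) *
    (g.form (bracketP (g.basis i) x) y + g.form x (bracketP (g.basis i) y))) • g.basis i

/-- The curvature tensor at the base point,
`R(x, y) z = Λ(x) Λ(y) z - Λ(y) Λ(x) z - Λ([x, y]_p) z - [[x, y]_k, z]`. -/
def curvature (x y z : tangent k) : tangent k :=
  g.nomizu x (g.nomizu y z) - g.nomizu y (g.nomizu x z) - g.nomizu (bracketP x y) z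
    - projP k ⁅bracketK x y, (z : L)⁆

/-- The Ricci tensor `Rc(y, z) = tr (x ↦ R(x, y) z)`. -/
def ricci (y z : tangent k) : ℝ :=
  ∑ i, g.form (g.curvature (g.basis i) y z) (g.basis i)

/-- The scalar curvature. -/
def scal : ℝ := ∑ i, g.ricci (g.basis i) (g.basis i)

/-- `g` is an Einstein metric with Einstein constant `ρ`, i.e. `Rc(g) = ρ g`. -/
def IsEinsteinWith (ρ : ℝ) : Prop := ∀ x y, g.ricci x y = ρ * g.form x y

/-- The volume of `(G/K, g)` divided by the volume of the standard metric. -/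
def relVolume : ℝ :=
  √(Matrix.det (Matrix.of fun i j =>
    g.form ((standardMetric k).basis i) ((standardMetric k).basis j)))

/-- The set of all `G`-invariant metrics of the same volume as `g`. -/
def sameVolume : Set (InvMetric k) := {h | h.relVolume = g.relVolume}

/-- `g` is a global maximum of the scalar curvature on the set of all `G`-invariant metrics of
its volume. -/
def IsGlobalMax : Prop := IsMaxOn scal g.sameVolume g

/-! ## Invariant symmetric 2-tensors and stability

A `G`-invariant symmetric `2`-tensor `T` is written as `T = g(A ·, ·)`, where the operator `A` on
`p` is `g`-self-adjoint and commutes with `Ad(K)`. -/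

/-- The operators `A` on `p` that represent `G`-invariant symmetric `2`-tensors. -/
def symK : Submodule ℝ (Module.End ℝ (tangent k)) where
  carrier := {A | (∀ x y, g.form (A x) y = g.form x (A y)) ∧
    ∀ (φ : groupK k) (x : tangent k), A (isotropy k φ x) = isotropy k φ (A x)}
  add_mem' := by
    rintro A B ⟨hA, hA'⟩ ⟨hB, hB'⟩
    exact ⟨fun x y => by simp [hA, hB], fun φ x => by simp [hA', hB']⟩
  zero_mem' := ⟨fun x y => by simp, fun φ x => by simp⟩
  smul_mem' := by
    rintro c A ⟨hA, hA'⟩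
    exact ⟨fun x y => by simp [hA], fun φ x => by simp [hA']⟩

/-- The covariant derivative at the base point of the invariant tensor given by `A`:
`(∇_x A) y = Λ(x) A y - A Λ(x) y`. -/
def covDeriv (A : Module.End ℝ (tangent k)) (x y : tangent k) : tangent k :=
  g.nomizu x (A y) - A (g.nomizu x y)

/-- The second covariant derivative
`(∇²_{x,y} A) z = Λ(x) (∇_y A) z - (∇_y A) Λ(x) z - (∇_{Λ(x) y} A) z`. -/
def covDeriv₂ (A : Module.End ℝ (tangent k)) (x y z : tangent k) : tangent k :=
  g.nomizu x (g.covDeriv A y z) - g.covDeriv A y (g.nomizu x z) - g.covDeriv A (g.nomizu x y) z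

/-- The divergence `∑ (∇_{e_i} A) e_i`. -/
def divergence (A : Module.End ℝ (tangent k)) : tangent k :=
  ∑ i, g.covDeriv A (g.basis i) (g.basis i)

/-- `A` represents a `G`-invariant TT-tensor: symmetric, traceless and divergence-free. -/
def IsTT (A : Module.End ℝ (tangent k)) : Prop :=
  A ∈ g.symK ∧ LinearMap.trace ℝ _ A = 0 ∧ g.divergence A = 0

/-- The Lichnerowicz Laplacian of `T = g(A ·, ·)` as a `2`-tensor:
`(Δ_L T)(x, y) = (∇*∇ T)(x, y) + T(Rc x, y) + T(x, Rc y) - 2 ∑ T(R(e_i, x) y, e_i)`,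
where `T(Rc x, y) = ∑ Rc(x, e_i) T(e_i, y)`. -/
def lichnerowicz (A : Module.End ℝ (tangent k)) (x y : tangent k) : ℝ :=
  -(∑ i, g.form (g.covDeriv₂ A (g.basis i) (g.basis i) x) y)
    + ∑ i, g.ricci x (g.basis i) * g.form (A (g.basis i)) y
    + ∑ i, g.ricci y (g.basis i) * g.form (A x) (g.basis i)
    - 2 * ∑ i, g.form (A (g.curvature (g.basis i) x y)) (g.basis i)

/-- The eigenvalues of the Lichnerowicz Laplacian on the space of `G`-invariant TT-tensors. -/
def lichnerowiczSpectrum : Set ℝ :=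
  {lam | ∃ A, g.IsTT A ∧ A ≠ 0 ∧ ∀ x y, g.lichnerowicz A x y = lam * g.form (A x) y}

/-- The second variation `Sc''(T, T) = ½ ⟨2ρT - Δ_L T, T⟩` of the total scalar curvature at an
Einstein metric with constant `ρ`, on a `G`-invariant TT-tensor `T = g(A ·, ·)`. -/
def secondVariation (ρ : ℝ) (A : Module.End ℝ (tangent k)) : ℝ :=
  (1 / 2 : ℝ) * ∑ i, (2 * ρ * g.form (A (g.basis i)) (A (g.basis i))
    - g.lichnerowicz A (g.basis i) (A (g.basis i)))

/-- `g` is `G`-stable: it is Einstein and the second variation of the total scalar curvature is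
negative definite on the `G`-invariant TT-tensors. -/
def IsGStable : Prop :=
  ∃ ρ, g.IsEinsteinWith ρ ∧ ∀ A, g.IsTT A → A ≠ 0 → g.secondVariation ρ A < 0

end InvMetric

/-! ## Isotropy summands and structural constants -/

/-- `q ⊆ p` is an `Ad(K)`-invariant subspace. -/
def IsAdInvariant {k : LieSubalgebra ℝ L} (q : Submodule ℝ (tangent k)) : Prop :=
  ∀ φ : groupK k, ∀ x ∈ q, isotropy k φ x ∈ q

/-- `q ⊆ p` is an `Ad(K)`-irreducible subspace. -/
def IsAdIrreducible {k : LieSubalgebra ℝ L} (q : Submodule ℝ (tangent k)) : Prop :=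
  IsAdInvariant q ∧ q ≠ ⊥ ∧ ∀ q' ≤ q, IsAdInvariant q' → q' = ⊥ ∨ q' = q

/-- Two `Ad(K)`-invariant subspaces of `p` are equivalent representations of `K`. -/
def AdEquivalent {k : LieSubalgebra ℝ L} (q₁ q₂ : Submodule ℝ (tangent k)) : Prop :=
  ∃ e : q₁ ≃ₗ[ℝ] q₂, ∀ (φ : groupK k) (x x' : q₁),
    (x' : tangent k) = isotropy k φ x → (e x' : tangent k) = isotropy k φ (e x)

/-- The structural constant `[ijk]` of subspaces `q₁, q₂, q₃` of `p` with respect to the standard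
metric: the sum of `⟨[X_α, Y_β], Z_γ⟩²` over orthonormal bases of `q₁, q₂, q₃`. -/
def structConst {k : LieSubalgebra ℝ L} (q₁ q₂ q₃ : Submodule ℝ (tangent k)) : ℝ :=
  ∑ a, ∑ b, ∑ c, (standardMetric k).form
    (bracketP (((standardMetric k).toInnerProd.restrict q₁).basis a : tangent k)
      (((standardMetric k).toInnerProd.restrict q₂).basis b : tangent k))
    (((standardMetric k).toInnerProd.restrict q₃).basis c : tangent k) ^ 2

end Homogeneous

end HomEinstein

end

set_option linter.unusedSectionVars false
set_option linter.unusedSimpArgs false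

open scoped TensorProduct

noncomputable section

namespace HomEinstein

section

open LieAlgebra LieAlgebra.IsKilling LieModule Module

/-! ## Root systems of type `E₈` -/

/-! Complexify and work with roots. The diagonal matrices of the two copies of `su 5` span a
commuting family of rank 4 + 4 = 8, the rank of `E₈`. Hence after complexification they fill a
Cartan subalgebra, and the off-diagonal matrix units are root vectors of a subsystem A₄ + A₄. Every
root becomes a pair of vectors in ℤ⁵, each taken modulo constants. In a simply laced system two
roots that are neither equal nor opposite pair to -1, 0 or 1, so the coordinates of a root outside
A₄ + A₄ differ by at most one within each block: such a root is a pair of proper subsets of `Fin 5`,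
of sizes (k, l). Squared length two reads k(5 - k) + l(5 - l) = 10. Integrality of the pairings and
closure under addition then force l ≡ ck mod 5 for a single c in {2, 3} (`exists_multiplier`), and
both values of c lead to the same conclusions.

So k mod 5 defines a ℤ/5-grading (`deg`) whose degree zero part is 𝔨. Degrees ±1 give 𝔭₁ and degrees
±2 give 𝔭₂, each with 2·5·10 = 100 roots. Three facts follow. The bracket of 𝔭ᵢ with itself has no
component in 𝔭ᵢ, because neither ±1±1±1 nor ±2±2±2 vanishes mod 5 (`killingForm_lie_subP`). There
are 240 roots in rank 8, which fixes the Killing form on coroots through 2·240/8 = 60, and the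
Casimir operator of 𝔨 acts on 𝔭 as 12/60 = 1/5 (`sum_lie_E_lie_E`, `trace_ad_ad_proj`). An invariant
operator is scalar on every root space. Commuting with the matrix units makes the scalar constant
along the orbits of S₅ × S₅, and symmetry with respect to the Killing form identifies the scalars of
α and -α, so a symmetric invariant operator is a scalar on each 𝔭ᵢ (`exists_scalar_subP`).

These facts are collected in `IsotropySplitting`, and the geometry uses nothing else. The trace of
ad y ad z over 𝔭 is the Killing form minus two Casimir terms, that is, -3/5 of the standard metric.
Together with Schur's lemma, the symmetry [112] = [211] and the equality of dimensions, this
determines tr(D ad u D' ad v) for all invariant symmetric D, D' (`traceForm₂_values`,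
`trace_diag_adP`), and in particular the structural constants. Every curvature quantity needed is a
combination of such traces. For the metric with eigenvalues p, q one gets an explicit Ricci tensor
(`ricci_eq`). The Einstein equation factors as (p - q)(3p² - 5pq + 3q²) = 0 up to the factor pq, and
the second factor is positive. At pq = 1 the scalar curvature is a cubic in p + q ≥ 2 with maximum
at 2. The invariant TT-tensors form the line of operators with eigenvalues a, -a, on which the
Lichnerowicz Laplacian is multiplication by 4/5. -/

theorem cartanE8_connected (p : Fin 8 → Prop) (i₀ : Fin 8) (h₀ : p i₀)
    (h : ∀ i j, p i → CartanMatrix.E₈ i j ≠ 0 → p j) (j : Fin 8) : p j := by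
  have e (i j : Fin 8) (hij : CartanMatrix.E₈ i j ≠ 0 := by decide)
      (hji : CartanMatrix.E₈ j i ≠ 0 := by decide) : p i ↔ p j :=
    ⟨fun hi => h i j hi hij, fun hj => h j i hj hji⟩
  -- The seven edges of the Dynkin diagram form a tree on the eight nodes, so the property spreads
  -- from any node to all.
  have h02 := e 0 2
  have h23 := e 2 3
  have h13 := e 1 3
  have h34 := e 3 4
  have h45 := e 4 5
  have h56 := e 5 6
  have h67 := e 6 7
  have : p 0 := by fin_cases i₀ <;> simp_all
  fin_cases j <;> simp_all

section Killing

variable {g : Type*} [LieRing g] [LieAlgebra ℂ g] [FiniteDimensional ℂ g] [IsKilling ℂ g]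
  {H : LieSubalgebra ℂ g} [H.IsCartanSubalgebra]

/-- The Cartan subalgebra `H` has a base of roots with Cartan matrix `E₈`. -/
def HasE8Base (H : LieSubalgebra ℂ g) [H.IsCartanSubalgebra] : Prop :=
  ∃ (b : (rootSystem H).Base) (e : b.support ≃ Fin 8),
      Matrix.reindex e e b.cartanMatrix = CartanMatrix.E₈

theorem HasE8Base.finrank (h : HasE8Base H) : finrank ℂ H = 8 := by
  obtain ⟨b, e, -⟩ := h
  rw [finrank_eq_card_basis b.toCoweightBasis, Fintype.card_congr e, Fintype.card_fin]

/-- The coroot is a multiple, by 2/(α, α), of the Killing dual of the root. A priori κ depends on α.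
-/
theorem exists_killingForm_coroot (α : H.root) :
    ∃ κ : ℂ, ∀ h : H, killingForm ℂ g (coroot α.1) h = κ * α.1 h := by
  refine ⟨2 * (α.1 ((cartanEquivDual H).symm α.1))⁻¹, fun h => ?_⟩
  exact (traceForm_coroot α.1 h).trans (by rw [two_nsmul, smul_eq_mul]; ring)

/-- Simply-lacedness: all roots have the same length. For adjacent simple roots the symmetry of the
Killing form compares κ α and κ β through Cartan entries that are equal and nonzero, the diagram is
connected, and reflections carry the simple roots to all roots. -/
theorem HasE8Base.exists_kappa (h : HasE8Base H) :
    ∃ κ : ℂ, ∀ (α : H.root) (h : H), killingForm ℂ g (coroot α.1) h = κ * α.1 h := by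
  obtain ⟨b, e, he⟩ := h
  choose κ hκ using fun α : H.root => exists_killingForm_coroot α
  have hself (α : H.root) : killingForm ℂ g (coroot α.1) (coroot α.1) = 2 * κ α := by
    rw [hκ, root_apply_coroot (LieSubalgebra.isNonZero_coe_root α)]; ring
  have hsymm (α β : H.root) : κ α * α.1 (coroot β.1) = κ β * β.1 (coroot α.1) := by
    rw [← hκ, ← hκ, LieModule.traceForm_comm]
  have hpair (i j : b.support) : ((CartanMatrix.E₈ (e i) (e j) : ℤ) : ℂ) =
      i.1.1 (coroot j.1.1) := by
    have h1 : CartanMatrix.E₈ (e i) (e j) = b.cartanMatrix i j := by rw [← he]; simp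
    rw [h1]
    exact b.algebraMap_cartanMatrixIn_apply ℤ i j
  have hsimple (i j : b.support) : κ i.1 = κ j.1 := by
    have := cartanE8_connected (fun l => κ (e.symm l).1 = κ j.1) (e j) (by simp)
      (fun l m hl hlm => by
        have h1 := hpair (e.symm l) (e.symm m)
        have h2 := hpair (e.symm m) (e.symm l)
        have h3 := hsymm (e.symm l).1 (e.symm m).1
        simp only [Equiv.apply_symm_apply] at h1 h2
        rw [← h1, ← h2, ← Matrix.transpose_apply CartanMatrix.E₈ l m,
          CartanMatrix.E₈_transpose] at h3
        rw [← hl]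
        exact (mul_right_cancel₀ (by exact_mod_cast hlm) h3).symm) (e i)
    simpa using this
  -- Reflections are isometries: expand the Killing norm, 2κ, of the reflected coroot.
  have hrefl (α β : H.root) : κ ((rootSystem H).reflectionPerm β α) = κ α := by
    have h1 : coroot ((rootSystem H).reflectionPerm β α).1 =
        coroot α.1 - β.1 (coroot α.1) • coroot β.1 :=
      (rootSystem H).coroot_reflectionPerm β α
    have h2 := hself ((rootSystem H).reflectionPerm β α)
    rw [h1] at h2
    rw [AddSubgroupClass.coe_sub, SetLike.val_smul] at h2
    simp only [map_sub, map_smul,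
      LinearMap.sub_apply, LinearMap.smul_apply, hself, smul_eq_mul] at h2
    rw [hκ β (coroot α.1), LieModule.traceForm_comm ℂ g g (coroot α.1 : g), hκ] at h2
    linear_combination -h2 / 2
  have hall (α β : H.root) : κ α = κ β := by
    obtain ⟨i₀⟩ : Nonempty b.support := ⟨e.symm 0⟩
    have key (α : H.root) : κ α = κ i₀.1 :=
      b.induction_reflect α (p := fun α => κ α = κ i₀.1) (fun i hi => by rw [hrefl, hi])
        (fun i hi => hsimple ⟨i, hi⟩ i₀) (fun i j hi _ => by rw [hrefl, hi])
    rw [key α, key β]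
  obtain ⟨i₀⟩ : Nonempty b.support := ⟨e.symm 0⟩
  exact ⟨κ i₀.1, fun α h => by rw [hκ, hall α i₀.1]⟩

theorem kappa_ne_zero {κ : ℂ}
    (hκ : ∀ (α : H.root) (h : H), killingForm ℂ g (coroot α.1) h = κ * α.1 h) (α : H.root) :
    κ ≠ 0 := by
  rintro rfl
  have h0 : (coroot α.1 : g) = 0 := by
    have hn := LieAlgebra.IsKilling.traceForm_cartan_nondegenerate ℂ g H
    have := hn.1 (coroot α.1) (fun h => by simpa using! hκ α h)
    rw [this]; rfl
  have h1 := root_apply_coroot (LieSubalgebra.isNonZero_coe_root α)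
  rw [show coroot α.1 = 0 from Subtype.ext h0] at h1
  simp at h1

/-- The pairings of an `E₈` root system are symmetric. -/
theorem HasE8Base.pairing_symm (h : HasE8Base H) (α β : H.root) :
    α.1 (coroot β.1) = β.1 (coroot α.1) := by
  obtain ⟨κ, hκ⟩ := h.exists_kappa
  refine mul_left_cancel₀ (kappa_ne_zero hκ α) ?_
  rw [← hκ, ← hκ, LieModule.traceForm_comm]

/-- In the finite list of pairs of pairings allowed in a reduced crystallographic system, only the
symmetric ones survive, and the extremes ±2 occur only for equal or opposite roots. -/
theorem HasE8Base.pairing_mem (h : HasE8Base H) (α β : H.root) (h1 : α ≠ β)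
    (h2 : (α.1 : H → ℂ) ≠ -β.1) :
    ∃ n : ℤ, (n = -1 ∨ n = 0 ∨ n = 1) ∧ α.1 (coroot β.1) = n := by
  have hc (α β : H.root) : (((rootSystem H).pairingIn ℤ α β : ℤ) : ℂ) = α.1 (coroot β.1) :=
    (rootSystem H).algebraMap_pairingIn ℤ α β
  refine ⟨(rootSystem H).pairingIn ℤ α β, ?_, (hc α β).symm⟩
  have hs : (rootSystem H).pairingIn ℤ α β = (rootSystem H).pairingIn ℤ β α := by
    have := h.pairing_symm α β
    rw [← hc, ← hc] at this
    exact_mod_cast this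
  have hm := (rootSystem H).pairingIn_pairingIn_mem_set_of_isCrystal_of_isRed' α β
    (fun hh => h1 ((rootSystem H).root.injective hh))
    (fun hh => h2 (by
      funext x
      exact LinearMap.congr_fun hh x))
  rw [← hs] at hm
  simp only [Set.mem_insert_iff, Set.mem_singleton_iff, Prod.mk.injEq] at hm
  omega

theorem pairing_int (α β : H.root) : ∃ n : ℤ, α.1 (coroot β.1) = n :=
  ⟨(rootSystem H).pairingIn ℤ α β, ((rootSystem H).algebraMap_pairingIn ℤ α β).symm⟩

theorem root_add_of_pairing_neg_one (α β : H.root) (h1 : α.1 (coroot β.1) = -1)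
    : ∃ γ : H.root, ∀ h, γ.1 h = α.1 h + β.1 h := by
  have hs : (reflectRoot β.1 α.1).IsNonZero := reflectRoot_isNonZero _ _ (LieSubalgebra.isNonZero_coe_root α)
  refine ⟨⟨reflectRoot β.1 α.1, by simpa using hs⟩, fun h => ?_⟩
  change α.1 h - (α.1 (coroot β.1) • (β.1 : H → ℂ)) h = _
  rw [h1]
  simp

end Killing

end

/-! ### Matrix units and the coordinates of roots -/

section

open LieAlgebra LieAlgebra.IsKilling LieModule Module

section

variable {g : Type*} [LieRing g] [LieAlgebra ℂ g] [FiniteDimensional ℂ g] [IsKilling ℂ g]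
  {H : LieSubalgebra ℂ g} [H.IsCartanSubalgebra]

/-- Matrix units of two commuting copies of `gl₅` modulo scalars in `g`, whose diagonal matrices
span `H`. -/
structure MatrixUnits (H : LieSubalgebra ℂ g) where
  E : Fin 2 → Fin 5 → Fin 5 → g
  lie_same : ∀ s i j k l, ⁅E s i j, E s k l⁆ =
    (if j = k then E s i l else 0) - (if l = i then E s k j else 0)
  lie_diff : ∀ s t i j k l, s ≠ t → ⁅E s i j, E t k l⁆ = 0
  sum_diag : ∀ s, ∑ i, E s i i = 0
  ne_zero : ∀ s i j, i ≠ j → E s i j ≠ 0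
  mem : ∀ s i, E s i i ∈ H
  span : ∀ h ∈ H, ∃ x : Fin 2 → Fin 5 → ℂ, h = ∑ s, ∑ i, x s i • E s i i

/-- A root as a linear functional. -/
def rootFun (α : H.root) : H →ₗ[ℂ] ℂ := Weight.toLinear ℂ H g α.1

/-- The negative of a root. -/
def negRoot (α : H.root) : H.root := ⟨-α.1, by
  have := LieSubalgebra.isNonZero_coe_root α
  simpa using this⟩

@[simp] theorem negRoot_apply (α : H.root) (h : H) : (negRoot α).1 h = -α.1 h := rfl

/-- The reflection of a root. -/
def reflRoot (β α : H.root) : H.root :=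
  ⟨reflectRoot β.1 α.1, by
    simpa using reflectRoot_isNonZero β.1 α.1 (LieSubalgebra.isNonZero_coe_root α)⟩

theorem reflRoot_apply (β α : H.root) (h : H) :
    (reflRoot β α).1 h = α.1 h - α.1 (coroot β.1) * β.1 h := rfl

namespace MatrixUnits

variable (A : MatrixUnits H)

/-- The diagonal matrix units as elements of `H`. -/
def D (s : Fin 2) (i : Fin 5) : H := ⟨A.E s i i, A.mem s i⟩

theorem sum_D (s : Fin 2) : ∑ i, A.D s i = 0 := by
  apply Subtype.ext
  have := A.sum_diag s
  simpa [D] using this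

theorem span_D (h : H) : ∃ x : Fin 2 → Fin 5 → ℂ, h = ∑ s, ∑ i, x s i • A.D s i := by
  obtain ⟨x, hx⟩ := A.span h h.2
  exact ⟨x, Subtype.ext (by simpa [D] using hx)⟩

theorem D_lie (t : Fin 2) (k : Fin 5) (s : Fin 2) (i j : Fin 5) :
    ⁅A.E t k k, A.E s i j⁆ =
      ((if t = s then (if k = i then 1 else 0) - (if k = j then 1 else 0) else 0 : ℤ) : ℂ) •
        A.E s i j := by
  by_cases hts : t = s
  · subst hts
    rw [A.lie_same]
    by_cases h1 : k = i <;> by_cases h2 : k = j <;> simp [h1, h2, eq_comm]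
    all_goals subst_vars
    all_goals simp_all [eq_comm]
  · rw [A.lie_diff _ _ _ _ _ _ hts]; simp [hts]

/-- The coordinates of the root of `E s i j`. -/
def psiVec (s : Fin 2) (i j : Fin 5) (t : Fin 2) (k : Fin 5) : ℤ :=
  if t = s then (if k = i then 1 else 0) - (if k = j then 1 else 0) else 0

/-- A matrix unit is an eigenvector of each diagonal unit, and these span `H`, so its eigenvalue
function is a weight. The weight is nonzero because its value at the diagonal unit `i` of the block
is 1. -/
theorem exists_psi (s : Fin 2) {i j : Fin 5} (hij : i ≠ j) :
    ∃ β : H.root, A.E s i j ∈ rootSpace H β.1 ∧ ∀ t k, β.1 (A.D t k) = psiVec s i j t k := by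
  have h1 (h : H) : ∃ c : ℂ, ⁅(h : g), A.E s i j⁆ = c • A.E s i j := by
    obtain ⟨x, hx⟩ := A.span h h.2
    refine ⟨∑ t, ∑ k, x t k * ((psiVec s i j t k : ℤ) : ℂ), ?_⟩
    rw [hx, Finset.sum_smul, sum_lie]
    refine Finset.sum_congr rfl fun t _ => ?_
    rw [Finset.sum_smul, sum_lie]
    refine Finset.sum_congr rfl fun k _ => ?_
    rw [smul_lie, A.D_lie, smul_smul]
    rfl
  choose χ hχ using h1
  have hmem : A.E s i j ∈ weightSpace g χ := by
    rw [mem_weightSpace]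
    intro h
    exact hχ h
  have hne : genWeightSpace g χ ≠ ⊥ := by
    intro hb
    have := weightSpace_le_genWeightSpace g χ hmem
    rw [hb] at this
    exact A.ne_zero s i j hij (by simpa using this)
  have hval (t k) : χ (A.D t k) = psiVec s i j t k := by
    have h2 := hχ (A.D t k)
    change ⁅A.E t k k, _⁆ = _ at h2
    rw [A.D_lie] at h2
    exact (smul_left_injective ℂ (A.ne_zero s i j hij) h2).symm
  refine ⟨⟨⟨χ, hne⟩, ?_⟩, weightSpace_le_genWeightSpace g χ hmem, hval⟩
  simp only [Finset.mem_filter, Finset.mem_univ, true_and]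
  intro h0
  have h2 := hval s i
  rw [show χ = 0 from h0] at h2
  simp [psiVec, hij] at h2

/-- The chosen root of `E s i j`. -/
def psi (s : Fin 2) {i j : Fin 5} (hij : i ≠ j) : H.root := (A.exists_psi s hij).choose

theorem E_mem (s : Fin 2) {i j : Fin 5} (hij : i ≠ j) : A.E s i j ∈ rootSpace H (A.psi s hij).1 :=
  (A.exists_psi s hij).choose_spec.1

theorem psi_D (s : Fin 2) {i j : Fin 5} (hij : i ≠ j) (t : Fin 2) (k : Fin 5) :
    (A.psi s hij).1 (A.D t k) = psiVec s i j t k := (A.exists_psi s hij).choose_spec.2 t k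

/-- A linear functional on `H` is determined by its values on the diagonal matrix units. -/
theorem root_ext {α β : H.root} (h : ∀ s i, α.1 (A.D s i) = β.1 (A.D s i)) : α = β := by
  apply Subtype.ext
  ext x
  obtain ⟨c, rfl⟩ := A.span_D x
  change (rootFun α) _ = (rootFun β) _
  simp only [map_sum, map_smul]
  refine Finset.sum_congr rfl fun s _ => Finset.sum_congr rfl fun i _ => ?_
  congr 1
  exact h s i

theorem root_apply_sum (α : H.root) (x : Fin 2 → Fin 5 → ℂ) :
    α.1 (∑ s, ∑ i, x s i • A.D s i) = ∑ s, ∑ i, x s i * α.1 (A.D s i) := by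
  change (rootFun α) _ = _
  simp only [map_sum, map_smul]
  rfl

theorem sum_root_D (α : H.root) (s : Fin 2) : ∑ i, α.1 (A.D s i) = 0 := by
  have h : (rootFun α) (∑ i, A.D s i) = 0 := by rw [A.sum_D, map_zero]
  rw [map_sum] at h
  exact h

/-- The matrix units at (i, j) and (j, i) complete the difference of diagonal units to an
sl₂-triple, whose middle element must be the coroot. -/
theorem coroot_psi (s : Fin 2) {i j : Fin 5} (hij : i ≠ j) :
    coroot (A.psi s hij).1 = A.D s i - A.D s j := by
  have ht : IsSl2Triple (A.E s i i - A.E s j j) (A.E s i j) (A.E s j i) :=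
    { h_ne_zero := by
        intro h0
        have h1 : ⁅A.E s i i - A.E s j j, A.E s i j⁆ = 0 := by rw [h0, zero_lie]
        rw [sub_lie, A.lie_same, A.lie_same] at h1
        simp only [if_true, hij.symm, if_false, sub_zero, zero_sub, sub_neg_eq_add] at h1
        rw [← two_smul ℂ] at h1
        exact A.ne_zero s i j hij ((smul_eq_zero.1 h1).resolve_left two_ne_zero)
      lie_e_f := by rw [A.lie_same]; simp
      lie_h_e_nsmul := by
        rw [sub_lie, A.lie_same, A.lie_same]
        simp [hij, hij.symm, two_smul]
      lie_h_f_nsmul := by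
        rw [sub_lie, A.lie_same, A.lie_same]
        simp [hij, hij.symm, two_smul]
        abel }
  have hf : A.E s j i ∈ rootSpace H (-(A.psi s hij).1) := by
    have h1 := A.E_mem s hij.symm
    have h2 : A.psi s hij.symm = negRoot (A.psi s hij) := A.root_ext fun t k => by
      rw [negRoot_apply, psi_D, psi_D]
      simp only [psiVec]
      split_ifs <;> simp
    rw [h2] at h1
    exact h1
  have := ht.h_eq_coroot (LieSubalgebra.isNonZero_coe_root _) (A.E_mem s hij) hf
  exact Subtype.ext this.symm

/-- The root `α` has the integral coordinates `a`, up to adding constants. -/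
def Rep (α : H.root) (a : Fin 2 → Fin 5 → ℤ) : Prop :=
  ∀ s i, α.1 (A.D s i) = a s i - (∑ j, (a s j : ℂ)) / 5

variable {A}

theorem Rep.sub {α : H.root} {a : Fin 2 → Fin 5 → ℤ} (h : A.Rep α a) (s : Fin 2) (i j : Fin 5) :
    α.1 (A.D s i) - α.1 (A.D s j) = a s i - a s j := by
  rw [h, h]; ring

/-- The diagonal units of a block add up to zero, so the values of a root on them have mean zero and
are determined by their differences. -/
theorem rep_iff {α : H.root} {a : Fin 2 → Fin 5 → ℤ} :
    A.Rep α a ↔ ∀ s i j, α.1 (A.D s i) - α.1 (A.D s j) = a s i - a s j := by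
  refine ⟨Rep.sub, fun h s i => ?_⟩
  have h1 : ∑ j, (α.1 (A.D s i) - α.1 (A.D s j)) = ∑ j, ((a s i : ℂ) - a s j) :=
    Finset.sum_congr rfl fun j _ => h s i j
  simp only [Finset.sum_sub_distrib, A.sum_root_D, Finset.sum_const, Finset.card_univ,
    Fintype.card_fin, nsmul_eq_mul] at h1
  push_cast at h1
  linear_combination h1 / 5

theorem Rep.congr {α : H.root} {a b : Fin 2 → Fin 5 → ℤ} (h : A.Rep α a)
    (hab : ∀ s i j, a s i - a s j = b s i - b s j) : A.Rep α b :=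
  rep_iff.2 fun s i j => by rw [h.sub]; exact_mod_cast hab s i j

theorem Rep.unique {α β : H.root} {a : Fin 2 → Fin 5 → ℤ} (h : A.Rep α a) (h' : A.Rep β a) :
    α = β := A.root_ext fun s i => by rw [h, h']

theorem Rep.diff_eq {α : H.root} {a b : Fin 2 → Fin 5 → ℤ} (h : A.Rep α a) (h' : A.Rep α b)
    (s : Fin 2) (i j : Fin 5) : a s i - a s j = b s i - b s j := by
  have := (h.sub s i j).symm.trans (h'.sub s i j)
  exact_mod_cast this

theorem rep_psi (s : Fin 2) {i j : Fin 5} (hij : i ≠ j) : A.Rep (A.psi s hij) (psiVec s i j) :=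
  rep_iff.2 fun t k l => by rw [psi_D, psi_D]

theorem Rep.neg {α : H.root} {a : Fin 2 → Fin 5 → ℤ} (h : A.Rep α a) :
    A.Rep (negRoot α) (fun s i => -a s i) :=
  rep_iff.2 fun s i j => by
    rw [negRoot_apply, negRoot_apply]
    push_cast
    linear_combination -(h.sub s i j)

theorem root_apply_coroot_psi (α : H.root) (s : Fin 2) {i j : Fin 5} (hij : i ≠ j) :
    α.1 (coroot (A.psi s hij).1) = α.1 (A.D s i) - α.1 (A.D s j) := by
  rw [coroot_psi]
  exact (rootFun α).map_sub _ _

/-- Differences of values on diagonal units are pairings with coroots of A₄ + A₄, hence integers.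
The representative is normalised to vanish at index 0. -/
theorem exists_rep (α : H.root) : ∃ a, A.Rep α a := by
  have h (s : Fin 2) (i : Fin 5) : ∃ n : ℤ, α.1 (A.D s i) - α.1 (A.D s 0) = n := by
    by_cases hi : i = 0
    · exact ⟨0, by rw [hi]; simp⟩
    · obtain ⟨n, hn⟩ := pairing_int α (A.psi s hi)
      exact ⟨n, by rw [← hn, root_apply_coroot_psi]⟩
  choose a ha using h
  exact ⟨a, rep_iff.2 fun s i j => by rw [← ha, ← ha]; ring⟩

/-- By symmetry of the pairings a root and its coroot have the same coordinates, up to a constant in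
each block, and constants contribute nothing because each block of diagonal units sums to zero. -/
theorem Rep.coroot_eq (hE : HasE8Base H) {α : H.root} {a : Fin 2 → Fin 5 → ℤ} (h : A.Rep α a) :
    coroot α.1 = ∑ s, ∑ i, (a s i : ℂ) • A.D s i := by
  obtain ⟨x, hx⟩ := A.span_D (coroot α.1)
  have h1 (s i j) (hij : i ≠ j) : x s i - x s j = a s i - a s j := by
    rw [← h.sub s i j, ← root_apply_coroot_psi α s hij, hE.pairing_symm, hx, root_apply_sum]
    simp only [psi_D]
    simp [psiVec, mul_sub, Finset.sum_sub_distrib]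
  have h2 (s) : ∑ i, x s i • A.D s i = ∑ i, (a s i : ℂ) • A.D s i := by
    rw [← sub_eq_zero, ← Finset.sum_sub_distrib]
    have h3 (i) : x s i • A.D s i - (a s i : ℂ) • A.D s i = (x s 0 - a s 0) • A.D s i := by
      rw [← sub_smul]
      congr 1
      by_cases hi : i = 0
      · rw [hi]
      · linear_combination h1 s i 0 hi
    rw [Finset.sum_congr rfl fun i _ => h3 i, ← Finset.smul_sum, A.sum_D, smul_zero]
  rw [hx]
  exact Finset.sum_congr rfl fun s _ => h2 s

theorem Rep.pairing (hE : HasE8Base H) {α γ : H.root} {a c : Fin 2 → Fin 5 → ℤ} (h : A.Rep α a)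
    (h' : A.Rep γ c) : γ.1 (coroot α.1) =
      ∑ s, ((∑ i, (a s i : ℂ) * c s i) - (∑ i, (a s i : ℂ)) * (∑ i, (c s i : ℂ)) / 5) := by
  rw [h.coroot_eq hE, root_apply_sum]
  refine Finset.sum_congr rfl fun s _ => ?_
  simp only [h' s, mul_sub, Finset.sum_sub_distrib, ← Finset.sum_mul]
  ring

/-- The Weyl group of A₄ + A₄ acts by permuting coordinates inside each block. -/
theorem Rep.swap {α : H.root} {a : Fin 2 → Fin 5 → ℤ} (h : A.Rep α a) (s : Fin 2) {i j : Fin 5}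
    (hij : i ≠ j) : A.Rep (reflRoot (A.psi s hij) α)
      (fun t k => if t = s then a t (Equiv.swap i j k) else a t k) := by
  refine rep_iff.2 fun t k l => ?_
  rw [reflRoot_apply, reflRoot_apply, root_apply_coroot_psi, h.sub, psi_D, psi_D]
  have h1 := h.sub t k l
  by_cases hts : t = s
  · subst hts
    have key (m : Fin 5) : (a t (Equiv.swap i j m) : ℂ) =
        a t m - (a t i - a t j) * psiVec t i j t m := by
      by_cases hmi : m = i
      · subst hmi; simp [psiVec, hij]
      · by_cases hmj : m = j
        · subst hmj; simp [psiVec, hmi]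
        · rw [Equiv.swap_apply_of_ne_of_ne hmi hmj]; simp [psiVec, hmi, hmj]
    simp only [if_true, key]
    linear_combination h1
  · simp only [psiVec, hts, if_false]
    push_cast
    linear_combination h1

end MatrixUnits
end

end

/-! ### Roots outside A₄ + A₄ as pairs of subsets -/

section

open LieAlgebra LieAlgebra.IsKilling LieModule Module

section

variable {g : Type*} [LieRing g] [LieAlgebra ℂ g] [FiniteDimensional ℂ g] [IsKilling ℂ g]
  {H : LieSubalgebra ℂ g} [H.IsCartanSubalgebra]

/-- Subtract the minimum: the result takes only the values 0 and 1. Excluding the full set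
normalises the choice, since the full and the empty set agree modulo constants. -/
theorem exists_finset_of_sub_le_one (a : Fin 5 → ℤ) (h : ∀ i j, a i - a j ≤ 1) :
    ∃ S : Finset (Fin 5), S ≠ Finset.univ ∧
      ∀ i j, a i - a j = (if i ∈ S then 1 else 0) - (if j ∈ S then 1 else 0) := by
  obtain ⟨m, hm⟩ := Finite.exists_min a
  refine ⟨Finset.univ.filter fun i => a i ≠ a m, fun hu => ?_, fun i j => ?_⟩
  · have := Finset.mem_univ m
    rw [← hu] at this
    simp at this
  · have hi := hm i
    have hj := hm j
    have hi' := h i m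
    have hj' := h j m
    simp only [Finset.mem_filter, Finset.mem_univ, true_and]
    split_ifs <;> omega

/-- The indicator coordinates of a pair of subsets of `Fin 5`. -/
def ind (S : Fin 2 → Finset (Fin 5)) (s : Fin 2) (i : Fin 5) : ℤ := if i ∈ S s then 1 else 0

theorem sum_ind (S : Fin 2 → Finset (Fin 5)) (s : Fin 2) : ∑ i, ind S s i = (S s).card := by
  simp [ind]

theorem sum_ind_mul_ind (S T : Fin 2 → Finset (Fin 5)) (s : Fin 2) :
    ∑ i, ind S s i * ind T s i = (S s ∩ T s).card := by
  have h (i : Fin 5) : ind S s i * ind T s i = if i ∈ S s ∩ T s then 1 else 0 := by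
    simp only [ind, Finset.mem_inter]
    split_ifs <;> simp_all
  simp [h, -Finset.mem_inter]

namespace MatrixUnits

variable (A : MatrixUnits H)

/-- The roots of the subalgebra spanned by the matrix units. -/
def IsPsi (α : H.root) : Prop := ∃ (s : Fin 2) (i j : Fin 5) (hij : i ≠ j), α = A.psi s hij

variable {A}

theorem negRoot_psi (s : Fin 2) {i j : Fin 5} (hij : i ≠ j) :
    negRoot (A.psi s hij) = A.psi s hij.symm :=
  A.root_ext fun t k => by
    rw [negRoot_apply, psi_D, psi_D]
    simp only [psiVec]
    split_ifs <;> simp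

theorem Rep.sub_le_one (hE : HasE8Base H) {α : H.root} {a : Fin 2 → Fin 5 → ℤ} (h : A.Rep α a)
    (hα : ¬ A.IsPsi α) (s : Fin 2) (i j : Fin 5) : a s i - a s j ≤ 1 := by
  by_cases hij : i = j
  · subst hij; simp
  obtain ⟨n, hn, hn'⟩ := hE.pairing_mem α (A.psi s hij) (fun h0 => hα ⟨s, i, j, hij, h0⟩)
    (fun h0 => hα ⟨s, j, i, Ne.symm hij, by
      rw [← negRoot_psi (hij := hij)]
      exact Subtype.ext (DFunLike.coe_injective h0)⟩)
  rw [root_apply_coroot_psi, h.sub] at hn'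
  have : a s i - a s j = n := by exact_mod_cast hn'
  omega

theorem exists_rep_ind (hE : HasE8Base H) {α : H.root} (hα : ¬ A.IsPsi α) :
    ∃ S : Fin 2 → Finset (Fin 5), (∀ s, S s ≠ Finset.univ) ∧ A.Rep α (ind S) := by
  obtain ⟨a, ha⟩ := A.exists_rep α
  choose S hS hS' using fun s => exists_finset_of_sub_le_one (a s) (ha.sub_le_one hE hα s)
  exact ⟨S, hS, ha.congr hS'⟩

/-- If all roots were in A₄ + A₄, connectedness of the `E₈` diagram would put all simple roots in
one block. They span the dual of `H` but would all vanish on the diagonal units of the other block,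
on which there are nevertheless nonzero roots. -/
theorem exists_not_isPsi (hE : HasE8Base H) : ∃ α, ¬ A.IsPsi α := by
  by_contra! hall
  obtain ⟨b, e, he⟩ := hE
  choose s i j hij hs using hall
  have hpair (l m : b.support) (hlm : s l.1 ≠ s m.1) : CartanMatrix.E₈ (e l) (e m) = 0 := by
    have h1 : CartanMatrix.E₈ (e l) (e m) = b.cartanMatrix l m := by rw [← he]; simp
    rw [h1]
    have h2 : ((b.cartanMatrix l m : ℤ) : ℂ) = l.1.1 (coroot m.1.1) :=
      b.algebraMap_cartanMatrixIn_apply ℤ l m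
    rw [hs m.1, root_apply_coroot_psi, hs l.1, psi_D, psi_D] at h2
    simp only [psiVec, hlm.symm, if_false] at h2
    exact_mod_cast h2
  have hconst (l : Fin 8) : s (e.symm l).1 = s (e.symm 0).1 :=
    cartanE8_connected (fun l => s (e.symm l).1 = s (e.symm 0).1) 0 rfl (fun l m hl hlm => by
      by_contra h0
      apply hlm
      have := hpair (e.symm l) (e.symm m) (fun h1 => h0 (h1.symm.trans hl))
      simpa using this) l
  obtain ⟨t, ht⟩ : ∃ t, t ≠ s (e.symm 0).1 := exists_ne _
  have hzero (f : Dual ℂ H) : f (A.D t 0) = 0 := by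
    have hb := b.toWeightBasis.sum_repr f
    rw [← hb, LinearMap.sum_apply]
    refine Finset.sum_eq_zero fun l _ => ?_
    rw [LinearMap.smul_apply, b.toWeightBasis_apply]
    have h1 := hconst (e l)
    rw [Equiv.symm_apply_apply] at h1
    have h2 : (rootSystem H).root l.1 (A.D t 0) = l.1.1 (A.D t 0) := rfl
    rw [h2, hs l.1, psi_D, h1]
    simp [psiVec, ht]
  have h3 : A.D t 0 = 0 := (forall_dual_apply_eq_zero_iff ℂ _).1 hzero
  have h4 := A.psi_D t (i := 0) (j := 1) (by decide) t 0
  rw [h3] at h4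
  have h5 : (rootFun (A.psi t (i := 0) (j := 1) (by decide))) 0 = 0 := map_zero _
  have h6 := h5.symm.trans h4
  simp [psiVec] at h6

theorem Rep.pairing_int_eq (hE : HasE8Base H) {α γ : H.root} {a c : Fin 2 → Fin 5 → ℤ}
    (h : A.Rep α a) (h' : A.Rep γ c) : 5 * γ.1 (coroot α.1) =
      ((∑ s, (5 * (∑ i, a s i * c s i) - (∑ i, a s i) * (∑ i, c s i)) : ℤ) : ℂ) := by
  rw [h.pairing hE h', Finset.mul_sum]
  push_cast
  refine Finset.sum_congr rfl fun s _ => ?_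
  ring

/-- This is the pairing of the root with its own coroot, which is 2, multiplied by 5. -/
theorem Rep.ind_card (hE : HasE8Base H) {α : H.root} {S : Fin 2 → Finset (Fin 5)}
    (h : A.Rep α (ind S)) : ∑ s, (5 * ((S s).card : ℤ) - (S s).card * (S s).card) = 10 := by
  have h1 := h.pairing_int_eq hE h
  rw [root_apply_coroot (LieSubalgebra.isNonZero_coe_root α)] at h1
  simp only [sum_ind, sum_ind_mul_ind, Finset.inter_self] at h1
  have h2 : (10 : ℂ) = ((10 : ℤ) : ℂ) := by norm_num
  rw [show (5 : ℂ) * 2 = 10 by norm_num, h2] at h1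
  exact_mod_cast h1.symm

/-- In five times the integral pairing the sizes of the intersections enter with factor 5, so only
the products of sizes matter mod 5. -/
theorem Rep.ind_dvd (hE : HasE8Base H) {α γ : H.root} {S T : Fin 2 → Finset (Fin 5)}
    (h : A.Rep α (ind S)) (h' : A.Rep γ (ind T)) :
    (5 : ℤ) ∣ ∑ s, ((S s).card : ℤ) * (T s).card := by
  have h1 := h.pairing_int_eq hE h'
  obtain ⟨n, hn⟩ := pairing_int γ α
  rw [hn] at h1
  simp only [sum_ind, sum_ind_mul_ind] at h1
  have h2 : 5 * n = ∑ s, (5 * ((S s ∩ T s).card : ℤ) - (S s).card * (T s).card) := by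
    exact_mod_cast h1
  rw [Finset.sum_sub_distrib, ← Finset.mul_sum] at h2
  exact ⟨(∑ s, ((S s ∩ T s).card : ℤ)) - n, by linarith⟩

theorem Rep.add (hE : HasE8Base H) {α γ : H.root} {a c d : Fin 2 → Fin 5 → ℤ}
    (h : A.Rep α a) (h' : A.Rep γ c)
    (hp : ∑ s, (5 * (∑ i, a s i * c s i) - (∑ i, a s i) * (∑ i, c s i)) = -5)
    (hd : ∀ s i j, a s i + c s i - (a s j + c s j) = d s i - d s j) :
    ∃ δ, A.Rep δ d := by
  have h1 := h.pairing_int_eq hE h'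
  rw [hp] at h1
  obtain ⟨δ, hδ⟩ := root_add_of_pairing_neg_one γ α (by push_cast at h1; linear_combination h1 / 5)
  refine ⟨δ, rep_iff.2 fun s i j => ?_⟩
  have h2 : ((a s i + c s i - (a s j + c s j) : ℤ) : ℂ) = ((d s i - d s j : ℤ) : ℂ) := by
    rw [hd]
  push_cast at h2
  rw [hδ, hδ]
  linear_combination h2 + h.sub s i j + h'.sub s i j

/-- Permutations of the coordinates preserve the roots, and any function on the roots that is
invariant under the reflections of the subalgebra. -/
theorem Rep.perm {X : Type*} (f : H.root → X)
    (hf : ∀ (s : Fin 2) (i j : Fin 5) (hij : i ≠ j) (α : H.root),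
      f (reflRoot (A.psi s hij) α) = f α)
    {α : H.root} {a : Fin 2 → Fin 5 → ℤ} (h : A.Rep α a) (σ : Fin 2 → Equiv.Perm (Fin 5)) :
    ∃ γ, A.Rep γ (fun s i => a s (σ s i)) ∧ f γ = f α := by
  have key (s : Fin 2) (τ : Equiv.Perm (Fin 5)) : ∀ {α : H.root} {a : Fin 2 → Fin 5 → ℤ},
      A.Rep α a → ∃ γ, A.Rep γ (fun t i => if t = s then a t (τ i) else a t i) ∧ f γ = f α := by
    induction τ using Equiv.Perm.swap_induction_on with
    | one => intro α a h; exact ⟨α, by simpa using h, rfl⟩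
    | swap_mul τ i j hij ih =>
      intro α a h
      obtain ⟨γ, hγ, hγ'⟩ := ih (h.swap s hij)
      refine ⟨γ, ?_, hγ'.trans (hf _ _ _ _ _)⟩
      convert hγ using 3 with t k
      split_ifs <;> rfl
  obtain ⟨γ, hγ, hγ'⟩ := key 0 (σ 0) h
  obtain ⟨δ, hδ, hδ'⟩ := key 1 (σ 1) hγ
  refine ⟨δ, ?_, hδ'.trans hγ'⟩
  convert hδ using 3 with s i
  fin_cases s <;> simp

theorem exists_perm_of_card_eq {S T : Finset (Fin 5)} (h : S.card = T.card) :
    ∃ σ : Equiv.Perm (Fin 5), ∀ i, σ i ∈ S ↔ i ∈ T := by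
  obtain ⟨σ, hσ⟩ : ∃ σ : Equiv.Perm (Fin 5), T.map σ.toEmbedding = S := by
    have e : {x // x ∈ T} ≃ {x // x ∈ S} := Finset.equivOfCardEq h.symm
    refine ⟨e.extendSubtype, ?_⟩
    ext x
    simp only [Finset.mem_map, Equiv.coe_toEmbedding]
    constructor
    · rintro ⟨y, hy, rfl⟩
      exact e.extendSubtype_mem y hy
    · intro hx
      refine ⟨e.symm ⟨x, hx⟩, (e.symm ⟨x, hx⟩).2, ?_⟩
      rw [e.extendSubtype_apply_of_mem _ (e.symm ⟨x, hx⟩).2]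
      simp
  refine ⟨σ, fun i => ?_⟩
  rw [← hσ]
  simp

theorem Rep.ind_of_card {X : Type*} (f : H.root → X)
    (hf : ∀ (s : Fin 2) (i j : Fin 5) (hij : i ≠ j) (α : H.root),
      f (reflRoot (A.psi s hij) α) = f α)
    {α : H.root} {S T : Fin 2 → Finset (Fin 5)} (h : A.Rep α (ind S))
    (hST : ∀ s, (S s).card = (T s).card) : ∃ γ, A.Rep γ (ind T) ∧ f γ = f α := by
  choose σ hσ using fun s => exists_perm_of_card_eq (hST s)
  obtain ⟨γ, hγ, hγ'⟩ := h.perm f hf σ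
  refine ⟨γ, ?_, hγ'⟩
  convert hγ using 3 with s i
  simp [ind, hσ]

theorem Rep.ind_compl {α : H.root} {S : Fin 2 → Finset (Fin 5)} (h : A.Rep α (ind S)) :
    A.Rep (negRoot α) (ind fun s => (S s)ᶜ) :=
  h.neg.congr fun s i j => by simp only [ind, Finset.mem_compl]; split_ifs <;> simp

/-- There is a root whose coordinates are the indicators of sets of cardinality `k` and `l`. -/
def HasCard (A : MatrixUnits H) (k l : ℕ) : Prop :=
  ∀ S : Fin 2 → Finset (Fin 5), (S 0).card = k → (S 1).card = l → ∃ γ, A.Rep γ (ind S)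

theorem Rep.hasCard {α : H.root} {S : Fin 2 → Finset (Fin 5)} (h : A.Rep α (ind S)) :
    A.HasCard (S 0).card (S 1).card := fun T h0 h1 =>
  (h.ind_of_card (fun _ => ()) (fun _ _ _ _ _ => rfl) (T := T) fun s => by
    fin_cases s <;> simp [h0, h1]).imp fun _ h => h.1

theorem HasCard.compl {k l : ℕ} (h : A.HasCard k l) (hk : k ≤ 5) (hl : l ≤ 5) :
    A.HasCard (5 - k) (5 - l) := by
  intro S h0 h1
  obtain ⟨γ, hγ⟩ := h (fun s => (S s)ᶜ) (by rw [Finset.card_compl, h0]; simp; omega)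
    (by rw [Finset.card_compl, h1]; simp; omega)
  have := hγ.ind_compl
  simp only [compl_compl] at this
  exact ⟨_, this⟩

theorem HasCard.add (hE : HasE8Base H) {k l : ℕ} (h : A.HasCard k l)
    (S T U : Fin 2 → Finset (Fin 5))
    (hS : (S 0).card = k ∧ (S 1).card = l) (hT : (T 0).card = k ∧ (T 1).card = l)
    (hp : ∑ s, (5 * (∑ i, ind S s i * ind T s i) - (∑ i, ind S s i) * (∑ i, ind T s i)) = -5)
    (hd : ∀ s i j, ind S s i + ind T s i - (ind S s j + ind T s j) = ind U s i - ind U s j) :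
    A.HasCard (U 0).card (U 1).card := by
  obtain ⟨α, hα⟩ := h S hS.1 hS.2
  obtain ⟨β, hβ⟩ := h T hT.1 hT.2
  obtain ⟨γ, hγ⟩ := hα.add hE hβ hp hd
  exact hγ.hasCard

/-- Two roots of the same size type with pairing -1 add up to a root whose sizes are doubled mod 5.
Coordinates equal to 2 cause no trouble: after removing the constant 1 the sum is again an
indicator. -/
theorem HasCard.double (hE : HasE8Base H) : 
    (A.HasCard 1 2 → A.HasCard 2 4) ∧ (A.HasCard 1 3 → A.HasCard 2 1) ∧
    (A.HasCard 2 1 → A.HasCard 4 2) ∧ (A.HasCard 2 4 → A.HasCard 4 3) :=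
  ⟨fun h => h.add hE ![{0}, {0, 1}] ![{1}, {2, 3}] ![{0, 1}, {0, 1, 2, 3}] (by decide) (by decide)
      (by decide) (by decide),
    fun h => h.add hE ![{0}, {0, 1, 2}] ![{1}, {2, 3, 4}] ![{0, 1}, {2}] (by decide) (by decide)
      (by decide) (by decide),
    fun h => h.add hE ![{0, 1}, {0}] ![{2, 3}, {1}] ![{0, 1, 2, 3}, {0, 1}] (by decide) (by decide)
      (by decide) (by decide),
    fun h => h.add hE ![{0, 1}, {0, 1, 2, 3}] ![{2, 3}, {1, 2, 3, 4}] ![{0, 1, 2, 3}, {1, 2, 3}]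
      (by decide) (by decide) (by decide) (by decide)⟩

end MatrixUnits
end

end

/-! ### The ℤ/5-grading of the roots -/

section

open LieAlgebra LieAlgebra.IsKilling LieModule Module

section

variable {g : Type*} [LieRing g] [LieAlgebra ℂ g] [FiniteDimensional ℂ g] [IsKilling ℂ g]
  {H : LieSubalgebra ℂ g} [H.IsCartanSubalgebra]

theorem card_pairs_of_finsets (c : ℕ) (hc : c = 2 ∨ c = 3) (k : ℕ) (hk : k = 1 ∨ k = 2) :
    Fintype.card {S : Finset (Fin 5) × Finset (Fin 5) //
      (S.1.card = k ∨ S.1.card = 5 - k) ∧ S.2.card = (c * S.1.card) % 5} = 100 := by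
  rcases hc with rfl | rfl <;> rcases hk with rfl | rfl <;> decide +kernel

theorem ind_injective {S T : Fin 2 → Finset (Fin 5)} (hS : ∀ s, S s ≠ Finset.univ)
    (hT : ∀ s, T s ≠ Finset.univ)
    (h : ∀ s i j, ind S s i - ind S s j = ind T s i - ind T s j) : S = T := by
  funext s
  obtain ⟨m, hm⟩ : ∃ m, m ∉ S s := by
    by_contra! h0
    exact hS s (Finset.eq_univ_iff_forall.2 h0)
  obtain ⟨n, hn⟩ : ∃ n, n ∉ T s := by
    by_contra! h0
    exact hT s (Finset.eq_univ_iff_forall.2 h0)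
  have hmT : m ∉ T s := fun h0 => by
    have := h s m n
    simp only [ind, hm, hn, h0, if_true, if_false] at this
    split_ifs at this
    all_goals omega
  ext i
  have := h s i m
  simp only [ind, hm, hmT, if_false] at this
  by_cases h1 : i ∈ S s <;> by_cases h2 : i ∈ T s <;> simp_all

namespace MatrixUnits

variable {A : MatrixUnits H}

/-- The length condition leaves eight size pairs, which lie on the two lines l = 2k and l = 3k mod
5. One of them is occupied. Doubling and negation then produce that entire line, and integrality of
pairings excludes the other. -/
theorem exists_multiplier (hE : HasE8Base H) (A : MatrixUnits H) :
    ∃ c, (c = 2 ∨ c = 3) ∧ (∀ k, k = 1 ∨ k = 2 ∨ k = 3 ∨ k = 4 → A.HasCard k (c * k % 5)) ∧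
      ∀ (α : H.root) (S : Fin 2 → Finset (Fin 5)), (∀ s, S s ≠ Finset.univ) → A.Rep α (ind S) →
        ((S 0).card = 1 ∨ (S 0).card = 2 ∨ (S 0).card = 3 ∨ (S 0).card = 4) ∧
        (S 1).card = c * (S 0).card % 5 := by
  have hle (S : Fin 2 → Finset (Fin 5)) (hS : ∀ s, S s ≠ Finset.univ) (s : Fin 2) :
      (S s).card ≤ 4 := by
    have := (Finset.card_lt_iff_ne_univ (S s)).2 (hS s)
    simp at this
    omega
  have htypes (α : H.root) (S : Fin 2 → Finset (Fin 5)) (hS : ∀ s, S s ≠ Finset.univ)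
      (h : A.Rep α (ind S)) : ((S 0).card, (S 1).card) ∈
        [(1, 2), (1, 3), (2, 1), (2, 4), (3, 1), (3, 4), (4, 2), (4, 3)] := by
    have h0 := hle S hS 0
    have h1 := hle S hS 1
    have h2 := h.ind_card hE
    rw [Fin.sum_univ_two] at h2
    generalize (S 0).card = k at *
    generalize (S 1).card = l at *
    interval_cases k <;> interval_cases l <;> first | decide | omega
  have hclosed : (∀ k, k = 1 ∨ k = 2 ∨ k = 3 ∨ k = 4 → A.HasCard k (2 * k % 5)) ∨
      (∀ k, k = 1 ∨ k = 2 ∨ k = 3 ∨ k = 4 → A.HasCard k (3 * k % 5)) := by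
    obtain ⟨α, hα⟩ := A.exists_not_isPsi hE
    obtain ⟨S, hS, h⟩ := exists_rep_ind hE hα
    have h1 := htypes α S hS h
    have h2 := h.hasCard
    obtain ⟨d1, d2, d3, d4⟩ := HasCard.double (A := A) hE
    have c12 : A.HasCard 1 2 → A.HasCard 4 3 := fun h => h.compl (by simp) (by simp)
    have c43 : A.HasCard 4 3 → A.HasCard 1 2 := fun h => h.compl (by simp) (by simp)
    have c13 : A.HasCard 1 3 → A.HasCard 4 2 := fun h => h.compl (by simp) (by simp)
    have c42 : A.HasCard 4 2 → A.HasCard 1 3 := fun h => h.compl (by simp) (by simp)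
    have c21 : A.HasCard 2 1 → A.HasCard 3 4 := fun h => h.compl (by simp) (by simp)
    have c34 : A.HasCard 3 4 → A.HasCard 2 1 := fun h => h.compl (by simp) (by simp)
    have c24 : A.HasCard 2 4 → A.HasCard 3 1 := fun h => h.compl (by simp) (by simp)
    have c31 : A.HasCard 3 1 → A.HasCard 2 4 := fun h => h.compl (by simp) (by simp)
    have : (A.HasCard 1 2 ∧ A.HasCard 2 4 ∧ A.HasCard 3 1 ∧ A.HasCard 4 3) ∨
        (A.HasCard 1 3 ∧ A.HasCard 2 1 ∧ A.HasCard 3 4 ∧ A.HasCard 4 2) := by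
      generalize (S 0).card = k at *
      generalize (S 1).card = l at *
      simp only [List.mem_cons, Prod.mk.injEq, List.not_mem_nil, or_false] at h1
      rcases h1 with ⟨rfl, rfl⟩ | ⟨rfl, rfl⟩ | ⟨rfl, rfl⟩ | ⟨rfl, rfl⟩ | ⟨rfl, rfl⟩ | ⟨rfl, rfl⟩ |
        ⟨rfl, rfl⟩ | ⟨rfl, rfl⟩
      · exact Or.inl ⟨h2, d1 h2, c24 (d1 h2), c12 h2⟩
      · exact Or.inr ⟨h2, d2 h2, c21 (d2 h2), c13 h2⟩
      · exact Or.inr ⟨c42 (d3 h2), h2, c21 h2, d3 h2⟩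
      · exact Or.inl ⟨c43 (d4 h2), h2, c24 h2, d4 h2⟩
      · exact Or.inl ⟨c43 (d4 (c31 h2)), c31 h2, h2, d4 (c31 h2)⟩
      · exact Or.inr ⟨c42 (d3 (c34 h2)), c34 h2, h2, d3 (c34 h2)⟩
      · exact Or.inr ⟨c42 h2, d2 (c42 h2), c21 (d2 (c42 h2)), h2⟩
      · exact Or.inl ⟨c43 h2, d1 (c43 h2), c24 (d1 (c43 h2)), h2⟩
    refine this.imp ?_ ?_
    · rintro ⟨h1, h2, h3, h4⟩ k (rfl | rfl | rfl | rfl) <;> assumption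
    · rintro ⟨h1, h2, h3, h4⟩ k (rfl | rfl | rfl | rfl) <;> assumption
  have hres (c : ℕ) (hc : c = 2 ∨ c = 3)
      (hcc : ∀ k, k = 1 ∨ k = 2 ∨ k = 3 ∨ k = 4 → A.HasCard k (c * k % 5)) (α : H.root)
      (S : Fin 2 → Finset (Fin 5)) (hS : ∀ s, S s ≠ Finset.univ) (h : A.Rep α (ind S)) :
        ((S 0).card = 1 ∨ (S 0).card = 2 ∨ (S 0).card = 3 ∨ (S 0).card = 4) ∧
        (S 1).card = c * (S 0).card % 5 := by
    have h1 := htypes α S hS h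
    -- Pair with a root of sizes (1, c). Since c² ≡ -1 mod 5, the divisibility of k + lc by 5 says l
    -- ≡ ck.
    have key : ∀ T : Fin 2 → Finset (Fin 5), (T 0).card = 1 → (T 1).card = c →
        (5 : ℤ) ∣ (S 0).card + (S 1).card * c := fun T h0 h1 => by
      obtain ⟨γ, hγ⟩ := hcc 1 (by simp) T h0 (by rw [h1]; rcases hc with rfl | rfl <;> rfl)
      have := h.ind_dvd hE hγ
      rw [Fin.sum_univ_two, h0, h1] at this
      simpa using this
    have h2 : (5 : ℤ) ∣ (S 0).card + (S 1).card * c := by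
      rcases hc with rfl | rfl
      · exact key ![{0}, {0, 1}] rfl rfl
      · exact key ![{0}, {0, 1, 2}] rfl rfl
    generalize (S 0).card = k at *
    generalize (S 1).card = l at *
    simp only [List.mem_cons, Prod.mk.injEq, List.not_mem_nil, or_false] at h1
    rcases hc with rfl | rfl <;> push_cast at h2 <;> omega
  rcases hclosed with h | h
  · exact ⟨2, Or.inl rfl, h, hres 2 (Or.inl rfl) h⟩
  · exact ⟨3, Or.inr rfl, h, hres 3 (Or.inr rfl) h⟩

/-- The degree of a root in the `ℤ/5`-grading whose degree zero part is the subalgebra of the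
matrix units. -/
def deg (A : MatrixUnits H) (α : H.root) : ZMod 5 :=
  ∑ i, (((A.exists_rep α).choose 0 i : ℤ) : ZMod 5)

/-- This makes `deg` independent of the representative: a constant added to five coordinates
disappears mod 5. -/
theorem sum_zmod_eq_zero_of_const (d : Fin 5 → ℤ) (h : ∀ i j, d i = d j) :
    ∑ i, (d i : ZMod 5) = 0 := by
  rw [Finset.sum_congr rfl fun i _ => by rw [h i 0]]
  rw [Finset.sum_const]
  simp only [Finset.card_univ, Fintype.card_fin, nsmul_eq_mul]
  rw [show ((5 : ℕ) : ZMod 5) = 0 from ZMod.natCast_self 5, zero_mul]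

theorem Rep.deg_eq {α : H.root} {a : Fin 2 → Fin 5 → ℤ} (h : A.Rep α a) :
    A.deg α = ∑ i, (a 0 i : ZMod 5) := by
  have h1 := (A.exists_rep α).choose_spec.diff_eq h
  rw [← sub_eq_zero, deg, ← Finset.sum_sub_distrib]
  simp only [← Int.cast_sub]
  exact sum_zmod_eq_zero_of_const _ fun i j => by have := h1 0 i j; omega

theorem Rep.deg_ind {α : H.root} {S : Fin 2 → Finset (Fin 5)} (h : A.Rep α (ind S)) :
    A.deg α = (S 0).card := by
  rw [h.deg_eq, ← Int.cast_sum, sum_ind]; simp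

theorem deg_add_add {α β γ : H.root} (h : ∀ x, α.1 x + β.1 x + γ.1 x = 0) :
    A.deg α + A.deg β + A.deg γ = 0 := by
  obtain ⟨a, ha⟩ := A.exists_rep α
  obtain ⟨b, hb⟩ := A.exists_rep β
  obtain ⟨c, hc⟩ := A.exists_rep γ
  rw [ha.deg_eq, hb.deg_eq, hc.deg_eq, ← Finset.sum_add_distrib, ← Finset.sum_add_distrib]
  simp only [← Int.cast_add]
  refine sum_zmod_eq_zero_of_const _ fun i j => ?_
  have : ((a 0 i + b 0 i + c 0 i : ℤ) : ℂ) = ((a 0 j + b 0 j + c 0 j : ℤ) : ℂ) := by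
    push_cast
    linear_combination h (A.D 0 i) - h (A.D 0 j) - ha.sub 0 i j - hb.sub 0 i j - hc.sub 0 i j
  exact_mod_cast this

theorem deg_neg (α : H.root) : A.deg (negRoot α) = -A.deg α := by
  obtain ⟨a, ha⟩ := A.exists_rep α
  rw [ha.deg_eq, ha.neg.deg_eq]
  simp

theorem deg_psi (s : Fin 2) {i j : Fin 5} (hij : i ≠ j) : A.deg (A.psi s hij) = 0 := by
  rw [(A.rep_psi s hij).deg_eq]
  fin_cases s <;> simp [psiVec]

theorem deg_reflRoot_psi (s : Fin 2) {i j : Fin 5} (hij : i ≠ j) (α : H.root) :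
    A.deg (reflRoot (A.psi s hij) α) = A.deg α := by
  obtain ⟨a, ha⟩ := A.exists_rep α
  rw [ha.deg_eq, (ha.swap s hij).deg_eq]
  by_cases h : 0 = s
  · simp only [h, if_true]
    exact Equiv.sum_comp (Equiv.swap i j) (fun k => (a s k : ZMod 5))
  · simp [h]

/-- The roots of degree `±k`. -/
def IsClass (A : MatrixUnits H) (k : ℕ) (α : H.root) : Prop := A.deg α = k ∨ A.deg α = -(k : ZMod 5)

/-- A root outside A₄ + A₄ has a first subset of size 1, 2, 3 or 4, and this size is its degree. -/
theorem isClass_or (hE : HasE8Base H) (α : H.root) :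
    (A.IsPsi α ∧ A.deg α = 0) ∨ (¬ A.IsPsi α ∧ (A.IsClass 1 α ∨ A.IsClass 2 α)) := by
  by_cases h : A.IsPsi α
  · obtain ⟨s, i, j, hij, rfl⟩ := h
    exact Or.inl ⟨⟨s, i, j, hij, rfl⟩, deg_psi s hij⟩
  · refine Or.inr ⟨h, ?_⟩
    obtain ⟨S, hS, hSα⟩ := exists_rep_ind hE h
    obtain ⟨c, -, -, hc⟩ := exists_multiplier hE A
    have h1 := (hc α S hS hSα).1
    simp only [IsClass, hSα.deg_ind]
    rcases h1 with h1 | h1 | h1 | h1 <;> rw [h1] <;> decide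

theorem isPsi_iff_deg (hE : HasE8Base H) (α : H.root) : A.IsPsi α ↔ A.deg α = 0 := by
  rcases isClass_or (A := A) hE α with ⟨h1, h2⟩ | ⟨h1, h2⟩
  · simp [h1, h2]
  · simp only [h1, false_iff]
    rcases h2 with (h | h) | (h | h) <;> rw [h] <;> decide

theorem exists_rep_of_isClass (hE : HasE8Base H) {k : ℕ} (hk : k = 1 ∨ k = 2) {α : H.root}
    (h : A.IsClass k α) : ∃ S : Fin 2 → Finset (Fin 5), (∀ s, S s ≠ Finset.univ) ∧
      A.Rep α (ind S) ∧ ((S 0).card = k ∨ (S 0).card = 5 - k) := by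
  have hα : ¬ A.IsPsi α := by
    rw [isPsi_iff_deg hE]
    intro h0
    rw [IsClass, h0] at h
    rcases hk with rfl | rfl <;> revert h <;> decide
  obtain ⟨S, hS, hSα⟩ := exists_rep_ind hE hα
  refine ⟨S, hS, hSα, ?_⟩
  obtain ⟨c, -, -, hc⟩ := exists_multiplier hE A
  have h1 := (hc α S hS hSα).1
  simp only [IsClass, hSα.deg_ind] at h
  rcases hk with rfl | rfl <;> rcases h1 with h1 | h1 | h1 | h1 <;> rw [h1] at h ⊢ <;>
    revert h <;> decide

/-- A function on the roots that is invariant under negation and under the reflections of the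
subalgebra is constant on each class. -/
theorem eq_of_isClass (hE : HasE8Base H) {X : Type*} (f : H.root → X)
    (hf : ∀ (s : Fin 2) (i j : Fin 5) (hij : i ≠ j) (α : H.root),
      f (reflRoot (A.psi s hij) α) = f α) (hf' : ∀ α, f (negRoot α) = f α)
    {k : ℕ} (hk : k = 1 ∨ k = 2) {α β : H.root} (hα : A.IsClass k α) (hβ : A.IsClass k β) :
    f α = f β := by
  obtain ⟨S, hS, hSα, hSk⟩ := exists_rep_of_isClass hE hk hα
  obtain ⟨T, hT, hTβ, hTk⟩ := exists_rep_of_isClass hE hk hβ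
  obtain ⟨c, hc2, -, hc⟩ := exists_multiplier hE A
  have hS1 := (hc α S hS hSα).2
  have hT1 := (hc β T hT hTβ).2
  have key {α' : H.root} {S' : Fin 2 → Finset (Fin 5)} (h : A.Rep α' (ind S'))
      (h1 : (S' 0).card = (T 0).card) (h2 : (S' 1).card = (T 1).card) : f α' = f β := by
    obtain ⟨γ, hγ, hγ'⟩ := h.ind_of_card f hf (T := T) (fun s => by fin_cases s <;> assumption)
    rw [← hγ', hγ.unique hTβ]
  by_cases h0 : (S 0).card = (T 0).card
  · exact key hSα h0 (by rw [hS1, hT1, h0])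
  -- The sizes are complementary, so pass from α to -α, which is described by the complements. These
  -- are proper subsets because neither part of `S` can be empty.
  · have h1 : (T 0).card = 5 - (S 0).card := by omega
    have hn : ∀ s, (fun s => (S s)ᶜ) s ≠ Finset.univ := fun s hs => by
      have hs' : S s = ∅ := by simpa using hs
      have := hc α S hS hSα
      fin_cases s
      · simp at hs'
        rw [hs'] at this
        simp at this
      · simp at hs'
        rw [hs'] at this
        simp at this
        rcases hc2 with rfl | rfl <;> omega
    have hS2 := (hc _ _ hn hSα.ind_compl).2
    rw [← hf']
    refine key hSα.ind_compl (by rw [Finset.card_compl, h1]; simp) ?_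
    rw [hS2, hT1, Finset.card_compl, h1]; simp

end MatrixUnits
end

end

/-! ### Counting roots and normalising the Killing form -/

section

open LieAlgebra LieAlgebra.IsKilling LieModule Module

section

variable {g : Type*} [LieRing g] [LieAlgebra ℂ g] [FiniteDimensional ℂ g] [IsKilling ℂ g]
  {H : LieSubalgebra ℂ g} [H.IsCartanSubalgebra]

namespace MatrixUnits

variable {A : MatrixUnits H}

/-- The roots of the class correspond bijectively to pairs of subsets with first size k or 5 - k and
second size prescribed by the multiplier: 2·5·10 of them. -/
theorem card_isClass (hE : HasE8Base H) {k : ℕ} (hk : k = 1 ∨ k = 2) :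
    Nat.card {α : H.root // A.IsClass k α} = 100 := by
  obtain ⟨c, hc2, hc, hc'⟩ := exists_multiplier hE A
  rw [← card_pairs_of_finsets c hc2 k hk, ← Nat.card_eq_fintype_card]
  symm
  have hex (S : {S : Finset (Fin 5) × Finset (Fin 5) //
      (S.1.card = k ∨ S.1.card = 5 - k) ∧ S.2.card = (c * S.1.card) % 5}) :
      ∃ γ, A.Rep γ (ind ![S.1.1, S.1.2]) := by
    obtain ⟨S, h1, h2⟩ := S
    exact hc S.1.card (by omega) _ rfl h2
  choose f hf using hex
  have hne (S : {S : Finset (Fin 5) × Finset (Fin 5) //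
      (S.1.card = k ∨ S.1.card = 5 - k) ∧ S.2.card = (c * S.1.card) % 5}) (s : Fin 2) :
      ![S.1.1, S.1.2] s ≠ Finset.univ := by
    obtain ⟨S, h1, h2⟩ := S
    intro h0
    fin_cases s
    · simp at h0
      rw [h0] at h1
      simp at h1
      omega
    · simp at h0
      rw [h0] at h2
      simp at h2
      omega
  have hcl (S) : A.IsClass k (f S) := by
    have h1 := S.2.1
    rw [IsClass, (hf S).deg_ind]
    simp only [Matrix.cons_val_zero]
    rcases hk with rfl | rfl <;> rcases h1 with h1 | h1 <;> rw [h1] <;> decide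
  refine Nat.card_eq_of_bijective (fun S => ⟨f S, hcl S⟩) ⟨fun S T hST => ?_, fun α => ?_⟩
  · have h0 : f S = f T := congrArg Subtype.val hST
    have h1 := ind_injective (hne S) (hne T) (fun s i j => (hf S).diff_eq (h0 ▸ hf T) s i j)
    have h2 := congrFun h1 0
    have h3 := congrFun h1 1
    exact Subtype.ext (Prod.ext h2 h3)
  · obtain ⟨S, hS, hSα, hSk⟩ := exists_rep_of_isClass hE hk α.2
    refine ⟨⟨(S 0, S 1), hSk, (hc' _ S hS hSα).2⟩, Subtype.ext ((hf _).unique ?_)⟩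
    convert hSα using 2
    funext s
    fin_cases s <;> rfl

theorem card_isPsi : Nat.card {α : H.root // A.IsPsi α} = 40 := by
  have h40 : Nat.card {p : Fin 2 × Fin 5 × Fin 5 // p.2.1 ≠ p.2.2} = 40 := by
    rw [Nat.card_eq_fintype_card]; decide +kernel
  rw [← h40]
  symm
  refine Nat.card_eq_of_bijective (fun p => ⟨A.psi p.1.1 p.2, _, _, _, p.2, rfl⟩)
    ⟨fun p q hpq => ?_, fun α => ?_⟩
  · have h0 : A.psi p.1.1 p.2 = A.psi q.1.1 q.2 := congrArg Subtype.val hpq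
    obtain ⟨⟨s, i, j⟩, hij⟩ := p
    obtain ⟨⟨t, k, l⟩, hkl⟩ := q
    have key (u m) : psiVec s i j u m = psiVec t k l u m := by
      have h1 := A.psi_D s hij u m
      have h2 := A.psi_D t hkl u m
      rw [h0] at h1
      exact_mod_cast h1.symm.trans h2
    change i ≠ j at hij
    change k ≠ l at hkl
    have h1 := key s i
    have h2 := key s j
    simp only [psiVec, if_true, hij, hij.symm, if_false] at h1 h2
    by_cases hst : s = t
    · simp only [hst, if_true] at h1 h2
      have h3 : i = k := by by_contra h; simp only [h, if_false] at h1; split_ifs at h1 <;> omega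
      have h4 : j = l := by by_contra h; simp only [h, if_false] at h2; split_ifs at h2 <;> omega
      subst hst h3 h4
      rfl
    · simp [hst] at h1
  · obtain ⟨α, s, i, j, hij, rfl⟩ := α
    exact ⟨⟨(s, i, j), hij⟩, rfl⟩

theorem card_root (hE : HasE8Base H) (A : MatrixUnits H) : Nat.card H.root = 240 := by
  classical
  have h1 : Nat.card H.root = Nat.card {α : H.root // A.IsPsi α} +
      Nat.card {α : H.root // ¬ A.IsPsi α} := by
    rw [← Nat.card_sum]
    exact Nat.card_congr (Equiv.sumCompl _).symm
  have h2 : Nat.card {α : H.root // ¬ A.IsPsi α} = Nat.card {α : H.root // A.IsClass 1 α} +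
      Nat.card {α : H.root // A.IsClass 2 α} := by
    rw [← Nat.card_sum]
    refine Nat.card_congr (((Equiv.subtypeEquivRight fun α => ?_)).trans (subtypeOrEquiv _ _ ?_))
    · rcases isClass_or (A := A) hE α with h | h
      · refine iff_of_false (not_not.2 h.1) ?_
        rw [IsClass, IsClass, h.2]
        decide
      · exact iff_of_true h.1 h.2
    · rw [Pi.disjoint_iff]
      intro α
      rw [Prop.disjoint_iff]
      rintro ⟨h1 | h1, h2 | h2⟩ <;> rw [h1] at h2 <;> revert h2 <;> decide
  rw [h1, h2, card_isPsi, card_isClass hE (Or.inl rfl), card_isClass hE (Or.inr rfl)]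

/-- The Killing form on `H` is the sum of the squares of the roots, so the sum of root ⊗ coroot is κ
times the identity of `H`. -/
theorem killingForm_coroot (hE : HasE8Base H) (A : MatrixUnits H) (α : H.root) (h : H) :
    killingForm ℂ g (coroot α.1) h = 60 * α.1 h := by
  obtain ⟨κ, hκ⟩ := hE.exists_kappa
  suffices κ = 60 by rw [hκ, this]
  let Q : H →ₗ[ℂ] H := ∑ γ : H.root, (rootFun γ).smulRight (coroot γ.1)
  have hQ : Q = κ • LinearMap.id := by
    ext x
    have hn := LieAlgebra.IsKilling.traceForm_cartan_nondegenerate ℂ g H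
    have : Q x - κ • x = 0 := hn.1 _ fun y => by
      have h1 : ((killingForm ℂ g).restrict H) x y = ∑ γ : H.root, γ.1 x * γ.1 y := by
        rw [restrict_killingForm_eq_sum, ← Finset.sum_coe_sort (s := H.root)]
        simp
        rfl
      have h2 : traceForm ℂ H g (Q x) y = ∑ γ : H.root, γ.1 x * (κ * γ.1 y) := by
        simp only [Q, LinearMap.sum_apply, map_sum, LinearMap.smulRight_apply, map_smul,
          LinearMap.smul_apply, smul_eq_mul]
        exact Finset.sum_congr rfl fun γ _ => by rw [← hκ]; rfl
      rw [map_sub, map_smul, LinearMap.sub_apply, LinearMap.smul_apply, h2]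
      change _ - κ • ((killingForm ℂ g).restrict H) x y = 0
      rw [h1, smul_eq_mul, Finset.mul_sum, ← Finset.sum_sub_distrib]
      exact Finset.sum_eq_zero fun γ _ => by ring
    exact congrArg Subtype.val (sub_eq_zero.1 this)
  -- Each of the 240 roots contributes 2 to the trace and `H` has dimension 8, so 8κ = 480.
  have htr := congrArg (LinearMap.trace ℂ H) hQ
  simp only [Q, map_sum, LinearMap.trace_smulRight, map_smul, LinearMap.trace_id] at htr
  have h2 (γ : H.root) : rootFun γ (coroot γ.1) = 2 :=
    root_apply_coroot (LieSubalgebra.isNonZero_coe_root γ)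
  simp only [h2, Finset.sum_const, Finset.card_univ, ← Nat.card_eq_fintype_card,
    card_root hE A, hE.finrank] at htr
  norm_num at htr
  linear_combination -htr / 8

/-! ## The decomposition of `g` -/

/-- The subalgebra spanned by the matrix units. -/
def subK (A : MatrixUnits H) : Submodule ℂ g := Submodule.span ℂ (Set.range fun p : Fin 2 × Fin 5 × Fin 5 => A.E p.1 p.2.1 p.2.2)

/-- The sum of the root spaces of degree `±k`. -/
def subP (A : MatrixUnits H) (k : ℕ) : Submodule ℂ g :=
  ⨆ α : {α : H.root // A.IsClass k α}, (rootSpace H α.1.1).toSubmodule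

theorem E_mem_subK (s : Fin 2) (i j : Fin 5) : A.E s i j ∈ A.subK :=
  Submodule.subset_span ⟨(s, i, j), rfl⟩

theorem mem_subP {k : ℕ} {α : H.root} (hα : A.IsClass k α) {x : g} (hx : x ∈ rootSpace H α.1) :
    x ∈ A.subP k :=
  Submodule.mem_iSup_of_mem (⟨α, hα⟩ : {α : H.root // A.IsClass k α}) hx

theorem subP_induction {k : ℕ} {p : g → Prop} (h0 : p 0) (hadd : ∀ x y, p x → p y → p (x + y))
    (h : ∀ α : H.root, A.IsClass k α → ∀ x ∈ rootSpace H α.1, p x) {x : g} (hx : x ∈ A.subP k) :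
    p x :=
  Submodule.iSup_induction _ (motive := p) hx (fun α y hy => h α.1 α.2 y hy) h0 hadd

theorem subK_induction {p : g → Prop} (h0 : p 0) (hadd : ∀ x y, p x → p y → p (x + y))
    (hsmul : ∀ (c : ℂ) x, p x → p (c • x)) (h : ∀ s i j, p (A.E s i j)) {x : g}
    (hx : x ∈ A.subK) : p x :=
  Submodule.span_induction (p := fun x _ => p x) (by rintro _ ⟨q, rfl⟩; exact h _ _ _) h0
    (fun x y _ _ => hadd x y) (fun c x _ => hsmul c x) hx

theorem rootSpace_psi (s : Fin 2) {i j : Fin 5} (hij : i ≠ j) {x : g}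
    (hx : x ∈ rootSpace H (A.psi s hij).1) : ∃ c : ℂ, c • A.E s i j = x := by
  have h1 := finrank_rootSpace_eq_one (A.psi s hij).1 (LieSubalgebra.isNonZero_coe_root _)
  have h2 := (finrank_eq_one_iff_of_nonzero'
    (⟨A.E s i j, A.E_mem s hij⟩ : rootSpace H (A.psi s hij).1)
    (fun h => A.ne_zero s i j hij (congrArg Subtype.val h))).1 h1 ⟨x, hx⟩
  obtain ⟨c, hc⟩ := h2
  exact ⟨c, congrArg Subtype.val hc⟩

/-- In the root space decomposition, weight zero and the roots of A₄ + A₄ fall into the subalgebra,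
and every other root has degree ±1 or ±2. -/
theorem subK_sup_subP (hE : HasE8Base H) (A : MatrixUnits H) :
    A.subK ⊔ A.subP 1 ⊔ A.subP 2 = ⊤ := by
  have h := iSup_genWeightSpace_eq_top' ℂ H g
  rw [← LieSubmodule.toSubmodule_inj, LieSubmodule.iSup_toSubmodule,
    LieSubmodule.top_toSubmodule] at h
  rw [eq_top_iff, ← h]
  refine iSup_le fun χ => ?_
  by_cases hχ : χ.IsZero
  · intro x hx
    have h1 : x ∈ H := by
      rw [show (χ : H → ℂ) = 0 from hχ] at hx
      exact (rootSpace_zero_eq ℂ g H).le hx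
    obtain ⟨c, rfl⟩ := A.span x h1
    refine Submodule.mem_sup_left (Submodule.mem_sup_left ?_)
    exact Submodule.sum_mem _ fun s _ => Submodule.sum_mem _ fun i _ =>
      Submodule.smul_mem _ _ (E_mem_subK s i i)
  · let α : H.root := ⟨χ, by simpa using hχ⟩
    rcases isClass_or (A := A) hE α with ⟨⟨s, i, j, hij, hα⟩, -⟩ | ⟨-, h1 | h1⟩
    · intro x hx
      change x ∈ rootSpace H α.1 at hx
      rw [hα] at hx
      obtain ⟨c, rfl⟩ := A.rootSpace_psi s hij hx
      exact Submodule.mem_sup_left (Submodule.mem_sup_left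
        (Submodule.smul_mem _ _ (E_mem_subK s i j)))
    · exact fun x hx => Submodule.mem_sup_left (Submodule.mem_sup_right (mem_subP h1 hx))
    · exact fun x hx => Submodule.mem_sup_right (mem_subP h1 hx)

theorem finrank_subP (hE : HasE8Base H) (A : MatrixUnits H) {k : ℕ} (hk : k = 1 ∨ k = 2) :
    finrank ℂ (A.subP k) = 100 := by
  classical
  have hne (α : H.root) : ∃ x ∈ rootSpace H α.1, x ≠ 0 := by
    by_contra! h
    exact α.1.genWeightSpace_ne_bot' ((LieSubmodule.eq_bot_iff _).2 h)
  choose x hx hx0 using hne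
  have hind : iSupIndep fun α : {α : H.root // A.IsClass k α} =>
      (rootSpace H α.1.1).toSubmodule := by
    have h1 := (LieSubmodule.iSupIndep_toSubmodule.2 (iSupIndep_genWeightSpace' ℂ H g))
    exact h1.comp (f := fun α : {α : H.root // A.IsClass k α} => α.1.1)
      (fun α β h => Subtype.ext (Subtype.ext h))
  have hli : LinearIndependent ℂ fun α : {α : H.root // A.IsClass k α} => x α.1 :=
    hind.linearIndependent _ (fun α => hx α.1) (fun α => hx0 α.1)
  have hspan : A.subP k = Submodule.span ℂ (Set.range fun α : {α : H.root // A.IsClass k α} =>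
      x α.1) := by
    refine le_antisymm (iSup_le fun α y hy => ?_) (Submodule.span_le.2 ?_)
    · have h1 := finrank_rootSpace_eq_one α.1.1 (LieSubalgebra.isNonZero_coe_root _)
      obtain ⟨c, hc⟩ := (finrank_eq_one_iff_of_nonzero'
        (⟨x α.1, hx α.1⟩ : rootSpace H α.1.1)
        (fun h => hx0 α.1 (congrArg Subtype.val h))).1 h1 ⟨y, hy⟩
      have hc' : c • x α.1 = y := congrArg Subtype.val hc
      rw [← hc']
      exact Submodule.smul_mem _ _ (Submodule.subset_span ⟨α, rfl⟩)
    · rintro _ ⟨α, rfl⟩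
      exact mem_subP α.2 (hx α.1)
  rw [hspan, finrank_span_eq_card hli, ← Nat.card_eq_fintype_card, card_isClass hE hk]

end MatrixUnits
end

end

/-! ### Brackets, the Casimir operator and Schur's lemma over ℂ -/

section

open LieAlgebra LieAlgebra.IsKilling LieModule Module

section

variable {g : Type*} [LieRing g] [LieAlgebra ℂ g] [FiniteDimensional ℂ g] [IsKilling ℂ g]
  {H : LieSubalgebra ℂ g} [H.IsCartanSubalgebra]

namespace MatrixUnits

variable {A : MatrixUnits H}

theorem D_lie_of_mem {α : H.root} {x : g} (hx : x ∈ rootSpace H α.1) (s : Fin 2) (i : Fin 5) :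
    ⁅A.E s i i, x⁆ = α.1 (A.D s i) • x :=
  lie_eq_smul_of_mem_rootSpace hx (A.D s i)

theorem killingForm_rootSpace_eq_zero {α β : H.root} (h : β ≠ negRoot α) {x y : g}
    (hx : x ∈ rootSpace H α.1) (hy : y ∈ rootSpace H β.1) : killingForm ℂ g x y = 0 := by
  refine killingForm_apply_eq_zero_of_mem_rootSpace_of_add_ne_zero ℂ g H hx hy fun h0 => h ?_
  apply Subtype.ext
  apply DFunLike.coe_injective
  funext z
  have := congrFun h0 z
  change β.1 z = -α.1 z
  simp only [Pi.add_apply, Pi.zero_apply] at this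
  linear_combination this

theorem killingForm_E_subP {k : ℕ} (hk : k = 1 ∨ k = 2) (s : Fin 2)
    (i j : Fin 5) {x : g} (hx : x ∈ A.subP k) : killingForm ℂ g (A.E s i j) x = 0 := by
  refine subP_induction (p := fun x => killingForm ℂ g (A.E s i j) x = 0) (map_zero _)
    (fun x y hx hy => by rw [map_add, hx, hy, add_zero]) (fun α hα x hx => ?_) hx
  by_cases hij : i = j
  · subst hij
    refine killingForm_apply_eq_zero_of_mem_rootSpace_of_add_ne_zero ℂ g H
      (α := 0) ((rootSpace_zero_eq ℂ g H).ge (A.mem s i)) hx fun h0 => ?_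
    exact LieSubalgebra.isNonZero_coe_root α (by rwa [zero_add] at h0)
  · refine killingForm_rootSpace_eq_zero (fun h0 => ?_) (A.E_mem s hij) hx
    have h1 : A.deg α = 0 := by rw [h0, deg_neg, deg_psi, neg_zero]
    rw [IsClass, h1] at hα
    rcases hk with rfl | rfl <;> revert hα <;> decide

theorem killingForm_subP_subP {x y : g} (hx : x ∈ A.subP 1) (hy : y ∈ A.subP 2) :
    killingForm ℂ g x y = 0 := by
  refine subP_induction (p := fun x => killingForm ℂ g x y = 0) (by simp)
    (fun x z hx hz => by rw [map_add, LinearMap.add_apply, hx, hz, add_zero])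
    (fun α hα x hx => ?_) hx
  refine subP_induction (p := fun y => killingForm ℂ g x y = 0) (by simp)
    (fun x z hx hz => by rw [map_add, hx, hz, add_zero])
    (fun β hβ y hy => ?_) hy
  refine killingForm_rootSpace_eq_zero (fun h0 => ?_) hx hy
  rw [IsClass, h0, deg_neg] at hβ
  rcases hα with h1 | h1 <;> rw [h1] at hβ <;> revert hβ <;> decide

/-- The form can be nonzero only on three roots adding to zero, whose degrees then add to zero mod
5. No choice of signs makes ±1±1±1 or ±2±2±2 vanish mod 5. -/
theorem killingForm_lie_subP {k : ℕ} (hk : k = 1 ∨ k = 2) {x y z : g} (hx : x ∈ A.subP k)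
    (hy : y ∈ A.subP k) (hz : z ∈ A.subP k) : killingForm ℂ g ⁅x, y⁆ z = 0 := by
  refine subP_induction (p := fun x => killingForm ℂ g ⁅x, y⁆ z = 0) (by simp)
    (fun x z hx hz => by rw [add_lie, map_add, LinearMap.add_apply, hx, hz, add_zero])
    (fun α hα x hx => ?_) hx
  refine subP_induction (p := fun y => killingForm ℂ g ⁅x, y⁆ z = 0) (by simp)
    (fun x z hx hz => by rw [lie_add, map_add, LinearMap.add_apply, hx, hz, add_zero])
    (fun β hβ y hy => ?_) hy
  refine subP_induction (p := fun z => killingForm ℂ g ⁅x, y⁆ z = 0) (by simp)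
    (fun x z hx hz => by rw [map_add, hx, hz, add_zero])
    (fun γ hγ z hz => ?_) hz
  have h1 : ⁅x, y⁆ ∈ rootSpace H (α.1 + β.1 : H → ℂ) := lie_mem_genWeightSpace_of_mem_genWeightSpace hx hy
  refine killingForm_apply_eq_zero_of_mem_rootSpace_of_add_ne_zero ℂ g H h1 hz fun h0 => ?_
  have h2 := deg_add_add (A := A) (α := α) (β := β) (γ := γ) (fun x => congrFun h0 x)
  rcases hk with rfl | rfl <;> rcases hα with h3 | h3 <;> rcases hβ with h4 | h4 <;>
    rcases hγ with h5 | h5 <;> rw [h3, h4, h5] at h2 <;> revert h2 <;> decide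

/-- Raising by a root of the subalgebra kills root vectors with nonnegative pairing. -/
theorem lie_E_eq_zero (hE : HasE8Base H) {α : H.root} (hα : ¬ A.IsPsi α) {a : Fin 2 → Fin 5 → ℤ}
    (ha : A.Rep α a) (s : Fin 2) {i j : Fin 5} (hij : i ≠ j) (h : 0 ≤ a s i - a s j) {x : g}
    (hx : x ∈ rootSpace H α.1) : ⁅A.E s i j, x⁆ = 0 := by
  by_contra h0
  have h1 : ⁅A.E s i j, x⁆ ∈ rootSpace H ((A.psi s hij).1 + α.1 : H → ℂ) :=
    lie_mem_genWeightSpace_of_mem_genWeightSpace (A.E_mem s hij) hx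
  have hne : genWeightSpace g ((A.psi s hij).1 + α.1 : H → ℂ) ≠ ⊥ := fun hb => by
    rw [rootSpace, hb] at h1
    exact h0 (by simpa using h1)
  have hnz : (⟨_, hne⟩ : Weight ℂ H g).IsNonZero := fun hz => by
    refine hα ⟨s, j, i, hij.symm, ?_⟩
    rw [← negRoot_psi (hij := hij)]
    apply Subtype.ext
    apply DFunLike.coe_injective
    funext z
    have := congrFun (show (A.psi s hij).1 + α.1 = (0 : H → ℂ) from hz) z
    simp only [Pi.add_apply, Pi.zero_apply] at this
    change α.1 z = -(A.psi s hij).1 z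
    linear_combination this
  let δ : H.root := ⟨⟨_, hne⟩, by simpa using hnz⟩
  have hδ (z : H) : δ.1 z = (A.psi s hij).1 z + α.1 z := rfl
  have hp : δ.1 (coroot (A.psi s hij).1) = ((2 + (a s i - a s j) : ℤ) : ℂ) := by
    rw [hδ, root_apply_coroot (LieSubalgebra.isNonZero_coe_root _), root_apply_coroot_psi, ha.sub]
    push_cast; ring
  have hδ1 : δ ≠ A.psi s hij := fun hd => by
    refine LieSubalgebra.isNonZero_coe_root α (funext fun z => ?_)
    have := hδ z
    rw [hd] at this
    change α.1 z = 0
    linear_combination -this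
  have hδ2 : (δ.1 : H → ℂ) ≠ -(A.psi s hij).1 := fun hd => by
    have h2 := congrFun hd (coroot (A.psi s hij).1)
    rw [hp, Pi.neg_apply, root_apply_coroot (LieSubalgebra.isNonZero_coe_root _)] at h2
    have h3 : 2 + (a s i - a s j) = -2 := by exact_mod_cast h2
    omega
  obtain ⟨n, hn, hn'⟩ := hE.pairing_mem δ (A.psi s hij) hδ1 hδ2
  rw [hp] at hn'
  have h3 : 2 + (a s i - a s j) = n := by exact_mod_cast hn'
  omega

/-- Each root outside A₄ + A₄ lies in a string of length at most two for every root of the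
subalgebra. The coordinate difference m is -1, 0 or 1, and (m² - m)/2 is 1 for m = -1, when the root
can be raised, and 0 otherwise. -/
theorem lie_E_lie_E (hE : HasE8Base H) {α : H.root} (hα : ¬ A.IsPsi α) {a : Fin 2 → Fin 5 → ℤ}
    (ha : A.Rep α a) (s : Fin 2) {i j : Fin 5} (hij : i ≠ j) {x : g}
    (hx : x ∈ rootSpace H α.1) : ⁅A.E s j i, ⁅A.E s i j, x⁆⁆ =
      (((a s i - a s j : ℂ) ^ 2 - (a s i - a s j)) / 2) • x := by
  by_cases h : 0 ≤ a s i - a s j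
  · rw [lie_E_eq_zero hE hα ha s hij h hx, lie_zero]
    have h1 := ha.sub_le_one hE hα s i j
    have h2 : a s i - a s j = 0 ∨ a s i - a s j = 1 := by omega
    have h3 : (a s i : ℂ) - a s j = 0 ∨ (a s i : ℂ) - a s j = 1 := by exact_mod_cast h2
    rcases h3 with h3 | h3 <;> rw [h3] <;> norm_num
  · have h1 := ha.sub_le_one hE hα s j i
    have h2 : a s i - a s j = -1 := by omega
    have h3 : (a s i : ℂ) - a s j = -1 := by exact_mod_cast h2
    rw [leibniz_lie, lie_E_eq_zero hE hα ha s hij.symm (by omega) hx, lie_zero, add_zero,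
      A.lie_same]
    simp only [if_true, sub_lie, D_lie_of_mem hx]
    rw [← sub_smul, ha.sub, h3, show (a s j : ℂ) - a s i = 1 by linear_combination -h3]
    norm_num

/-- This is the Casimir operator of the subalgebra before division by 60. In a block whose subset
has size n, the off-diagonal units contribute n(5 - n) and the diagonal ones n(5 - n)/5. The length
condition says that the n(5 - n) add up to 10, and 10·6/5 = 12. -/
theorem sum_lie_E_lie_E (hE : HasE8Base H) {k : ℕ} (hk : k = 1 ∨ k = 2) {x : g}
    (hx : x ∈ A.subP k) : ∑ s, ∑ i, ∑ j, ⁅A.E s j i, ⁅A.E s i j, x⁆⁆ = (12 : ℂ) • x := by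
  refine subP_induction (p := fun x => ∑ s, ∑ i, ∑ j, ⁅A.E s j i, ⁅A.E s i j, x⁆⁆ = (12 : ℂ) • x)
    (by simp) (fun x y hx hy => by
      rw [smul_add, ← hx, ← hy]
      simp only [lie_add, Finset.sum_add_distrib]) (fun α hα x hx => ?_) hx
  have hpsi : ¬ A.IsPsi α := fun h0 => by
    rw [isPsi_iff_deg hE] at h0
    rw [IsClass, h0] at hα
    rcases hk with rfl | rfl <;> revert hα <;> decide
  obtain ⟨S, hS, ha, -⟩ := exists_rep_of_isClass hE hk hα
  have h1 (s i j) : ⁅A.E s j i, ⁅A.E s i j, x⁆⁆ =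
      ((((ind S s i : ℂ) - ind S s j) ^ 2 - ((ind S s i : ℂ) - ind S s j)) / 2 +
        if i = j then α.1 (A.D s i) ^ 2 else 0) • x := by
    by_cases hij : i = j
    · subst hij
      rw [D_lie_of_mem hx, lie_smul, D_lie_of_mem hx, smul_smul]
      simp [sq]
    · rw [lie_E_lie_E hE hpsi ha s hij hx]; simp [hij]
  simp only [h1, ← Finset.sum_smul]
  congr 1
  have hsq (s i) : (ind S s i : ℂ) ^ 2 = ind S s i := by
    simp only [ind]; split_ifs <;> simp
  have hsum (s) : ∑ i, (ind S s i : ℂ) = (S s).card := by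
    rw [← Int.cast_sum, sum_ind]; simp
  have h2 (s : Fin 2) : ∑ i, ∑ j, ((((ind S s i : ℂ) - ind S s j) ^ 2 -
      ((ind S s i : ℂ) - ind S s j)) / 2 + if i = j then α.1 (A.D s i) ^ 2 else 0) =
      6 / 5 * (5 * ((S s).card : ℂ) - ((S s).card : ℂ) * ((S s).card : ℂ)) := by
    have h3 (i j) : (((ind S s i : ℂ) - ind S s j) ^ 2 -
        ((ind S s i : ℂ) - ind S s j)) / 2 = ind S s j - ind S s i * ind S s j := by
      linear_combination hsq s i / 2 + hsq s j / 2
    have h4 (i) : α.1 (A.D s i) ^ 2 = ind S s i * (1 - 2 / 5 * (S s).card) +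
        ((S s).card) ^ 2 / 25 := by
      rw [ha, hsum]; linear_combination hsq s i
    simp only [h3, h4, Finset.sum_add_distrib, Finset.sum_sub_distrib, Finset.sum_ite_eq,
      Finset.mem_univ, if_true, ← Finset.mul_sum, ← Finset.sum_mul, hsum, Finset.sum_const,
      Finset.card_univ, Fintype.card_fin, nsmul_eq_mul]
    push_cast
    ring
  rw [Finset.sum_congr rfl fun s _ => h2 s, ← Finset.mul_sum]
  have h5 : (((∑ s, (5 * ((S s).card : ℤ) - (S s).card * (S s).card) : ℤ)) : ℂ) = ((10 : ℤ) : ℂ) :=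
    congrArg _ (ha.ind_card hE)
  push_cast at h5
  rw [h5]
  norm_num

/-- The coroot normalisation gives the values on differences of diagonal units. Averaging over the
second unit recovers a single one, because the block sums to zero. -/
theorem killingForm_D (hE : HasE8Base H) (s t : Fin 2) (i j : Fin 5) :
    killingForm ℂ g (A.E s i i) (A.E t j j) =
      60 * (if s = t then (if i = j then 1 else 0) - 1 / 5 else 0) := by
  have h1 (l : Fin 5) : killingForm ℂ g (A.E s i i - A.E s l l) (A.E t j j) =
      60 * (psiVec s i l t j : ℤ) := by
    by_cases hil : i = l
    · subst hil; simp [psiVec]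
    · have := killingForm_coroot hE A (A.psi s hil) (A.D t j)
      rw [coroot_psi, psi_D] at this
      exact this
  have h2 : ∑ l, killingForm ℂ g (A.E s i i - A.E s l l) (A.E t j j) =
      5 * killingForm ℂ g (A.E s i i) (A.E t j j) := by
    simp only [map_sub, LinearMap.sub_apply, Finset.sum_sub_distrib, Finset.sum_const,
      Finset.card_univ, Fintype.card_fin, nsmul_eq_mul]
    rw [← LinearMap.sum_apply, ← map_sum, A.sum_diag]
    simp
  rw [Finset.sum_congr rfl fun l _ => h1 l] at h2
  have h3 : killingForm ℂ g (A.E s i i) (A.E t j j) =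
      (∑ l, 60 * ((psiVec s i l t j : ℤ) : ℂ)) / 5 := by rw [h2]; ring
  rw [h3]
  by_cases hst : s = t
  · subst hst
    by_cases hij : i = j
    · subst hij
      simp [psiVec, ← Finset.mul_sum]
      ring
    · simp [psiVec, hij, Ne.symm hij, ← Finset.mul_sum]
      ring
  · simp [psiVec, hst, Ne.symm hst]

theorem killingForm_diag_E (hE : HasE8Base H) (s t : Fin 2) (i k l : Fin 5) :
    killingForm ℂ g (A.E s i i) (A.E t k l) =
      60 * (if s = t ∧ k = l then (if i = k then 1 else 0) - 1 / 5 else 0) := by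
  by_cases hkl : k = l
  · subst hkl
    rw [killingForm_D hE]
    simp
  · have h1 : killingForm ℂ g (A.E s i i) (A.E t k l) = 0 :=
      killingForm_apply_eq_zero_of_mem_rootSpace_of_add_ne_zero ℂ g H
        (α := 0) ((rootSpace_zero_eq ℂ g H).ge (A.mem s i)) (A.E_mem t hkl) fun h0 =>
          LieSubalgebra.isNonZero_coe_root (A.psi t hkl) (by rwa [zero_add] at h0)
    rw [h1]
    simp [hkl]

/-- Write the off-diagonal unit as its bracket with a diagonal one and move the bracket across by
invariance, which reduces to the diagonal case. -/
theorem killingForm_E_E (hE : HasE8Base H) (s t : Fin 2) {i j : Fin 5} (hij : i ≠ j)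
    (k l : Fin 5) : killingForm ℂ g (A.E s i j) (A.E t k l) =
      if s = t ∧ i = l ∧ j = k then 60 else 0 := by
  have hsub : ⁅A.E s i i, A.E s i j⁆ = A.E s i j := by
    rw [A.lie_same]; simp [Ne.symm hij]
  rw [← hsub]
  refine (LieModule.traceForm_apply_lie_apply ℂ g g _ _ _).trans ?_
  change killingForm ℂ g _ _ = _
  by_cases hst : s = t
  · subst hst
    rw [A.lie_same, map_sub]
    have h1 (p : Prop) [Decidable p] (y : g) : killingForm ℂ g (A.E s i i) (if p then y else 0) =
        if p then killingForm ℂ g (A.E s i i) y else 0 := by split_ifs <;> simp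
    rw [h1, h1, killingForm_diag_E hE, killingForm_diag_E hE]
    by_cases hjk : j = k <;> by_cases hil : i = l <;> simp [hjk, hil, eq_comm]
    all_goals subst_vars
    all_goals have hji := Ne.symm hij
    all_goals simp_all
    all_goals norm_num
  · rw [A.lie_diff _ _ _ _ _ _ hst]
    simp [hst]

/-- The orthogonal projection onto the subalgebra of the matrix units. -/
theorem sum_killingForm_smul_E (hE : HasE8Base H) {x : g} (hx : x ∈ A.subK) :
    ∑ s, ∑ i, ∑ j, killingForm ℂ g x (A.E s j i) • A.E s i j = (60 : ℂ) • x := by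
  refine subK_induction (p := fun x => ∑ s, ∑ i, ∑ j, killingForm ℂ g x (A.E s j i) • A.E s i j =
    (60 : ℂ) • x) (by simp) (fun x y hx hy => by
      rw [smul_add, ← hx, ← hy]
      simp only [map_add, LinearMap.add_apply, add_smul, Finset.sum_add_distrib])
    (fun c x hx => by
      rw [smul_comm, ← hx]
      simp only [map_smul, LinearMap.smul_apply, smul_assoc, Finset.smul_sum])
    (fun t k l => ?_) hx
  by_cases hkl : k = l
  · subst hkl
    simp only [killingForm_diag_E hE]
    rw [Finset.sum_eq_single t]
    · have h1 (i j) : ((60 : ℂ) * if t = t ∧ j = i then (if k = j then 1 else 0) - 1 / 5 else 0) •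
          A.E t i j = if j = i then (if k = i then (60 : ℂ) • A.E t i i else 0) -
            (12 : ℂ) • A.E t i i else 0 := by
        by_cases hji : j = i
        · subst hji
          by_cases hkj : k = j
          · simp [hkj, ← sub_smul]; norm_num
          · simp [hkj, ← neg_smul]; norm_num
        · simp [hji]
      rw [Finset.sum_congr rfl fun i _ => Finset.sum_congr rfl fun j _ => h1 i j]
      simp only [Finset.sum_ite_eq', Finset.mem_univ, if_true, Finset.sum_sub_distrib,
        Finset.sum_ite_eq, ← Finset.smul_sum, A.sum_diag, smul_zero, sub_zero]
    · intro s _ hs; simp [Ne.symm hs]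
    · simp
  · simp only [killingForm_E_E hE _ _ hkl]
    rw [Finset.sum_eq_single t, Finset.sum_eq_single k, Finset.sum_eq_single l]
    · simp
    · intro j _ hj; simp [Ne.symm hj]
    · simp
    · intro i _ hi; simp [Ne.symm hi]
    · simp
    · intro s _ hs; simp [Ne.symm hs]
    · simp

/-- An off-diagonal unit either kills a root vector or moves it to the reflected root, which has the
same degree. -/
theorem lie_E_subP (s : Fin 2) (i j : Fin 5) {k : ℕ} {x : g} (hx : x ∈ A.subP k)
    (hE : HasE8Base H) (hk : k = 1 ∨ k = 2) : ⁅A.E s i j, x⁆ ∈ A.subP k := by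
  refine subP_induction (p := fun x => ⁅A.E s i j, x⁆ ∈ A.subP k)
    (by rw [lie_zero]; exact Submodule.zero_mem _)
    (fun x y hx hy => by rw [lie_add]; exact Submodule.add_mem _ hx hy) (fun α hα x hx => ?_) hx
  by_cases hij : i = j
  · subst hij
    rw [D_lie_of_mem hx]
    exact Submodule.smul_mem _ _ (mem_subP hα hx)
  · have hpsi : ¬ A.IsPsi α := fun h0 => by
      rw [isPsi_iff_deg hE] at h0
      rw [IsClass, h0] at hα
      rcases hk with rfl | rfl <;> revert hα <;> decide
    obtain ⟨a, ha⟩ := A.exists_rep α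
    by_cases h : 0 ≤ a s i - a s j
    · rw [lie_E_eq_zero hE hpsi ha s hij h hx]
      exact Submodule.zero_mem _
    · have h1 := ha.sub_le_one hE hpsi s j i
      have h2 : a s i - a s j = -1 := by omega
      have h3 : (a s i : ℂ) - a s j = -1 := by exact_mod_cast h2
      refine mem_subP (α := reflRoot (A.psi s hij) α)
        (by rw [IsClass, deg_reflRoot_psi]; exact hα) ?_
      have h4 : ((reflRoot (A.psi s hij) α).1 : H → ℂ) = (A.psi s hij).1 + α.1 := by
        funext z
        rw [reflRoot_apply, root_apply_coroot_psi, ha.sub, h3, Pi.add_apply]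
        ring
      rw [h4]
      exact lie_mem_genWeightSpace_of_mem_genWeightSpace (A.E_mem s hij) hx

/-- Schur's lemma: an operator that is symmetric with respect to the Killing form and commutes
with the matrix units is a scalar on each of the two classes. -/
theorem exists_scalar_subP (hE : HasE8Base H) (T : Module.End ℂ g)
    (hT : ∀ s i j x, T ⁅A.E s i j, x⁆ = ⁅A.E s i j, T x⁆)
    (hsymm : ∀ x y, killingForm ℂ g (T x) y = killingForm ℂ g x (T y)) {k : ℕ}
    (hk : k = 1 ∨ k = 2) : ∃ c : ℂ, ∀ x ∈ A.subP k, T x = c • x := by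
  have hH (h : H) (x : g) : T ⁅h, x⁆ = ⁅h, T x⁆ := by
    obtain ⟨c, hc⟩ := A.span h h.2
    change T ⁅(h : g), x⁆ = ⁅(h : g), T x⁆
    rw [hc]
    simp only [sum_lie, map_sum, smul_lie, map_smul, hT]
  have hmem (α : H.root) {x : g} (hx : x ∈ rootSpace H α.1) : T x ∈ rootSpace H α.1 := by
    refine weightSpace_le_genWeightSpace g _ ?_
    rw [mem_weightSpace]
    intro h
    rw [← hH, lie_eq_smul_of_mem_rootSpace hx, map_smul]
  have hscal (α : H.root) : ∃ c : ℂ, ∀ x ∈ rootSpace H α.1, T x = c • x := by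
    have h1 := finrank_rootSpace_eq_one α.1 (LieSubalgebra.isNonZero_coe_root _)
    obtain ⟨v, hv0, hv⟩ := finrank_eq_one_iff'.1 h1
    obtain ⟨c, hc⟩ := hv ⟨T v, hmem α v.2⟩
    refine ⟨c, fun x hx => ?_⟩
    obtain ⟨d, hd⟩ := hv ⟨x, hx⟩
    have hc' : c • (v : g) = T v := congrArg Subtype.val hc
    have hd' : d • (v : g) = x := congrArg Subtype.val hd
    rw [← hd', map_smul, ← hc', smul_comm]
  choose f hf using hscal
  -- Symmetry of `T` is essential here. The root spaces of α and -α are paired nontrivially by the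
  -- Killing form, which forces equal eigenvalues; without symmetry, degrees k and -k could carry
  -- different scalars.
  have hneg (α : H.root) : f (negRoot α) = f α := by
    obtain ⟨h, e, f', ht, he, hf'⟩ := exists_isSl2Triple_of_weight_isNonZero (α := α.1)
      (LieSubalgebra.isNonZero_coe_root α)
    have h1 := hsymm e f'
    rw [hf α e he, hf (negRoot α) f' hf', map_smul, map_smul, LinearMap.smul_apply, smul_eq_mul,
      smul_eq_mul] at h1
    have h2 : killingForm ℂ g e f' ≠ 0 := fun h0 => by
      have h3 := lie_eq_killingForm_smul_of_mem_rootSpace_of_mem_rootSpace_neg he hf'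
      rw [h0, zero_smul, ht.lie_e_f] at h3
      exact ht.h_ne_zero h3
    exact (mul_right_cancel₀ h2 h1).symm
  -- When the coordinate difference is -1, the matrix unit carries the root space isomorphically to
  -- that of the reflected root and commutes with `T`.
  have hstep (s : Fin 2) (i j : Fin 5) (hij : i ≠ j) (α : H.root) (a : Fin 2 → Fin 5 → ℤ)
      (ha : A.Rep α a) (hpsi : ¬ A.IsPsi α) (h2 : a s i - a s j = -1) :
      f (reflRoot (A.psi s hij) α) = f α := by
    obtain ⟨v, hv0, -⟩ := finrank_eq_one_iff'.1
      (finrank_rootSpace_eq_one α.1 (LieSubalgebra.isNonZero_coe_root _))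
    have h3 : (a s i : ℂ) - a s j = -1 := by exact_mod_cast h2
    have h4 : ((reflRoot (A.psi s hij) α).1 : H → ℂ) = (A.psi s hij).1 + α.1 := by
      funext z
      rw [reflRoot_apply, root_apply_coroot_psi, ha.sub, h3, Pi.add_apply]
      ring
    have h5 : ⁅A.E s i j, (v : g)⁆ ∈ rootSpace H (reflRoot (A.psi s hij) α).1 := by
      rw [h4]
      exact lie_mem_genWeightSpace_of_mem_genWeightSpace (A.E_mem s hij) v.2
    have h6 : ⁅A.E s i j, (v : g)⁆ ≠ 0 := fun h0 => by
      have := lie_E_lie_E hE hpsi ha s hij v.2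
      rw [h0, lie_zero, h3] at this
      norm_num at this
      exact hv0 (Subtype.ext this.symm)
    have h7 := hT s i j v
    rw [hf _ _ h5, hf _ _ v.2, lie_smul] at h7
    exact smul_left_injective ℂ h6 h7
  have hrefl (s : Fin 2) (i j : Fin 5) (hij : i ≠ j) (α : H.root) :
      f (reflRoot (A.psi s hij) α) = f α ∨ A.IsPsi α := by
    by_cases hpsi : A.IsPsi α
    · exact Or.inr hpsi
    left
    obtain ⟨a, ha⟩ := A.exists_rep α
    have h1 := ha.sub_le_one hE hpsi s i j
    have h2 := ha.sub_le_one hE hpsi s j i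
    have h3 : a s i - a s j = -1 ∨ a s i - a s j = 0 ∨ a s j - a s i = -1 := by omega
    rcases h3 with h3 | h3 | h3
    · exact hstep s i j hij α a ha hpsi h3
    · congr 1
      refine A.root_ext fun t m => ?_
      have h4 : (a s i : ℂ) - a s j = 0 := by exact_mod_cast h3
      rw [reflRoot_apply, root_apply_coroot_psi, ha.sub, h4, zero_mul, sub_zero]
    · rw [← hstep s j i hij.symm α a ha hpsi h3]
      congr 1
      refine A.root_ext fun t m => ?_
      rw [reflRoot_apply, reflRoot_apply, root_apply_coroot_psi, root_apply_coroot_psi,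
        ← negRoot_psi (hij := hij), negRoot_apply]
      ring
  classical
  -- Invariance of the eigenvalue under reflections is known only outside A₄ + A₄. Replacing it by 0
  -- on the subsystem gives a function invariant on all roots, as `eq_of_isClass` demands.
  let F : H.root → ℂ := fun α => if A.IsPsi α then 0 else f α
  have hdeg (α β : H.root) (h : A.deg α = A.deg β ∨ A.deg α = -A.deg β) :
      A.IsPsi α ↔ A.IsPsi β := by
    rw [isPsi_iff_deg hE, isPsi_iff_deg hE]
    rcases h with h | h <;> rw [h] <;> simp
  have hF1 (s : Fin 2) (i j : Fin 5) (hij : i ≠ j) (α : H.root) :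
      F (reflRoot (A.psi s hij) α) = F α := by
    have h1 := hdeg (reflRoot (A.psi s hij) α) α (Or.inl (deg_reflRoot_psi s hij α))
    by_cases hpsi : A.IsPsi α
    · simp only [F, h1, hpsi, if_true]
    · simp only [F, h1, hpsi, if_false]
      exact (hrefl s i j hij α).resolve_right hpsi
  have hF2 (α : H.root) : F (negRoot α) = F α := by
    have h1 := hdeg (negRoot α) α (Or.inr (deg_neg α))
    simp only [F, h1, hneg]
  have hFf (α : H.root) (hα : A.IsClass k α) : F α = f α := by
    have hpsi : ¬ A.IsPsi α := fun h0 => by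
      rw [isPsi_iff_deg hE] at h0
      rw [IsClass, h0] at hα
      rcases hk with rfl | rfl <;> revert hα <;> decide
    simp only [F, hpsi, if_false]
  by_cases hne : ∃ α₀, A.IsClass k α₀
  · obtain ⟨α₀, hα₀⟩ := hne
    refine ⟨f α₀, fun x hx => ?_⟩
    refine subP_induction (p := fun x => T x = f α₀ • x) (by simp)
      (fun x y hx hy => by rw [map_add, hx, hy, smul_add]) (fun α hα x hx => ?_) hx
    rw [hf α x hx, ← hFf α hα, ← hFf α₀ hα₀, eq_of_isClass hE F hF1 hF2 hk hα hα₀]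
  · refine ⟨0, fun x hx => ?_⟩
    refine subP_induction (p := fun x => T x = (0 : ℂ) • x) (by simp)
      (fun x y hx hy => by rw [map_add, hx, hy, smul_add])
      (fun α hα x hx => absurd ⟨α, hα⟩ hne) hx

end MatrixUnits
end

end

/-! ### Complexification and passage to the real form -/

section

open LieAlgebra LieAlgebra.IsKilling LieModule Module

section Complexification

variable {L : Type*} [LieRing L] [LieAlgebra ℝ L]

/-- The real part of an element of the complexification. -/
def cre : ℂ ⊗[ℝ] L →ₗ[ℝ] L := (TensorProduct.lid ℝ L).toLinearMap ∘ₗ Complex.reLm.rTensor L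

/-- The imaginary part of an element of the complexification. -/
def cim : ℂ ⊗[ℝ] L →ₗ[ℝ] L := (TensorProduct.lid ℝ L).toLinearMap ∘ₗ Complex.imLm.rTensor L

@[simp] theorem cre_tmul (z : ℂ) (x : L) : cre (z ⊗ₜ[ℝ] x) = z.re • x := by simp [cre]

@[simp] theorem cim_tmul (z : ℂ) (x : L) : cim (z ⊗ₜ[ℝ] x) = z.im • x := by simp [cim]

theorem I_smul_tmul (x : L) : Complex.I • ((1 : ℂ) ⊗ₜ[ℝ] x) = Complex.I ⊗ₜ[ℝ] x := by
  rw [TensorProduct.smul_tmul', smul_eq_mul, mul_one]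

theorem eq_cre_add_cim (u : ℂ ⊗[ℝ] L) :
    u = (1 : ℂ) ⊗ₜ[ℝ] cre u + Complex.I • ((1 : ℂ) ⊗ₜ[ℝ] cim u) := by
  induction u with
  | zero => simp
  | add u v hu hv =>
    conv_lhs => rw [hu, hv]
    rw [map_add, map_add, TensorProduct.tmul_add, TensorProduct.tmul_add, smul_add]
    abel
  | tmul z x =>
    rw [I_smul_tmul, cre_tmul, cim_tmul, TensorProduct.tmul_smul, TensorProduct.tmul_smul,
      TensorProduct.smul_tmul', TensorProduct.smul_tmul', ← TensorProduct.add_tmul]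
    congr 1
    apply Complex.ext <;> simp

theorem cre_smul (c : ℂ) (u : ℂ ⊗[ℝ] L) : cre (c • u) = c.re • cre u - c.im • cim u := by
  induction u with
  | zero => simp
  | add u v hu hv => rw [smul_add, map_add, hu, hv]; simp only [map_add, smul_add]; abel
  | tmul z x => rw [TensorProduct.smul_tmul']; simp [sub_smul, smul_smul]

theorem cim_smul (c : ℂ) (u : ℂ ⊗[ℝ] L) : cim (c • u) = c.re • cim u + c.im • cre u := by
  induction u with
  | zero => simp
  | add u v hu hv => rw [smul_add, map_add, hu, hv]; simp only [map_add, smul_add]; abel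
  | tmul z x => rw [TensorProduct.smul_tmul']; simp [add_smul, smul_smul]

theorem cext {u v : ℂ ⊗[ℝ] L} (h1 : cre u = cre v) (h2 : cim u = cim v) : u = v := by
  rw [eq_cre_add_cim u, eq_cre_add_cim v, h1, h2]

theorem lie_one_tmul (x y : L) : ⁅(1 : ℂ) ⊗ₜ[ℝ] x, (1 : ℂ) ⊗ₜ[ℝ] y⁆ = (1 : ℂ) ⊗ₜ[ℝ] ⁅x, y⁆ := by
  rw [LieAlgebra.ExtendScalars.bracket_tmul, one_mul]

theorem csmul_lie (c : ℂ) (u v : ℂ ⊗[ℝ] L) : ⁅c • u, v⁆ = c • ⁅u, v⁆ := smul_lie c u v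

theorem clie_smul (c : ℂ) (u v : ℂ ⊗[ℝ] L) : ⁅u, c • v⁆ = c • ⁅u, v⁆ := LieAlgebra.lie_smul c u v

theorem clie_neg (u v : ℂ ⊗[ℝ] L) : ⁅u, -v⁆ = -⁅u, v⁆ := lie_neg u v

theorem clie_add (u v w : ℂ ⊗[ℝ] L) : ⁅u, v + w⁆ = ⁅u, v⁆ + ⁅u, w⁆ := lie_add u v w

theorem cadd_lie (u v w : ℂ ⊗[ℝ] L) : ⁅u + v, w⁆ = ⁅u, w⁆ + ⁅v, w⁆ := add_lie u v w

theorem clie_sum {ι : Type*} (t : Finset ι) (f : ι → ℂ ⊗[ℝ] L) (u : ℂ ⊗[ℝ] L) :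
    ⁅u, ∑ i ∈ t, f i⁆ = ∑ i ∈ t, ⁅u, f i⁆ := by
  classical
  induction t using Finset.induction_on with
  | empty =>
    rw [Finset.sum_empty, Finset.sum_empty]
    exact lie_zero (M := ℂ ⊗[ℝ] L) u
  | insert a t ha ih =>
    rw [Finset.sum_insert ha, Finset.sum_insert ha, ← ih]
    exact clie_add _ _ _

/-- Complex conjugation. -/
def conjC (u : ℂ ⊗[ℝ] L) : ℂ ⊗[ℝ] L := (1 : ℂ) ⊗ₜ[ℝ] cre u - Complex.I • ((1 : ℂ) ⊗ₜ[ℝ] cim u)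

@[simp] theorem cre_conjC (u : ℂ ⊗[ℝ] L) : cre (conjC u) = cre u := by
  simp [conjC, cre_smul]

@[simp] theorem cim_conjC (u : ℂ ⊗[ℝ] L) : cim (conjC u) = -cim u := by
  simp [conjC, cim_smul]

theorem conjC_add (u v : ℂ ⊗[ℝ] L) : conjC (u + v) = conjC u + conjC v := by
  apply cext <;> simp; abel

theorem conjC_zero : conjC (0 : ℂ ⊗[ℝ] L) = 0 := by simp [conjC]

theorem conjC_smul (c : ℂ) (u : ℂ ⊗[ℝ] L) : conjC (c • u) = (starRingEnd ℂ c) • conjC u := by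
  apply cext
  · simp [cre_smul]
  · simp [cim_smul]; abel

theorem cre_lie (u v : ℂ ⊗[ℝ] L) : cre ⁅u, v⁆ = ⁅cre u, cre v⁆ - ⁅cim u, cim v⁆ := by
  conv_lhs => rw [eq_cre_add_cim u, eq_cre_add_cim v]
  simp [csmul_lie, clie_smul, clie_add, cadd_lie, cre_smul, cim_smul, lie_one_tmul, sub_eq_add_neg]

theorem cim_lie (u v : ℂ ⊗[ℝ] L) : cim ⁅u, v⁆ = ⁅cre u, cim v⁆ + ⁅cim u, cre v⁆ := by
  conv_lhs => rw [eq_cre_add_cim u, eq_cre_add_cim v]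
  simp [csmul_lie, clie_smul, clie_add, cadd_lie, cre_smul, cim_smul, lie_one_tmul]

theorem conjC_lie (u v : ℂ ⊗[ℝ] L) : conjC ⁅u, v⁆ = ⁅conjC u, conjC v⁆ := by
  apply cext
  · simp [cre_lie]
  · simp [cim_lie]; abel

theorem cre_mem_of_conjC {P : Submodule ℂ (ℂ ⊗[ℝ] L)} {u : ℂ ⊗[ℝ] L} (h : u ∈ P)
    (h' : conjC u ∈ P) : (1 : ℂ) ⊗ₜ[ℝ] cre u ∈ P := by
  have : (1 : ℂ) ⊗ₜ[ℝ] cre u = (1 / 2 : ℂ) • (u + conjC u) := by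
    conv_rhs => rw [eq_cre_add_cim u]
    apply cext <;> simp [cre_smul, cim_smul, ← add_smul]
    norm_num
  rw [this]
  exact P.smul_mem _ (P.add_mem h h')

theorem cim_mem_of_conjC {P : Submodule ℂ (ℂ ⊗[ℝ] L)} {u : ℂ ⊗[ℝ] L} (h : u ∈ P)
    (h' : conjC u ∈ P) : (1 : ℂ) ⊗ₜ[ℝ] cim u ∈ P := by
  have : (1 : ℂ) ⊗ₜ[ℝ] cim u = (-Complex.I) • (u - (1 : ℂ) ⊗ₜ[ℝ] cre u) := by
    conv_rhs => rw [eq_cre_add_cim u]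
    apply cext <;> simp [cre_smul, cim_smul]
  rw [this]
  exact P.smul_mem _ (P.sub_mem h (cre_mem_of_conjC h h'))

/-- The real points of a complex subspace. -/
def realPoints (P : Submodule ℂ (ℂ ⊗[ℝ] L)) : Submodule ℝ L where
  carrier := {x | (1 : ℂ) ⊗ₜ[ℝ] x ∈ P}
  add_mem' {x y} hx hy := by
    change (1 : ℂ) ⊗ₜ[ℝ] (x + y) ∈ P
    rw [TensorProduct.tmul_add]
    exact P.add_mem hx hy
  zero_mem' := by
    change (1 : ℂ) ⊗ₜ[ℝ] (0 : L) ∈ P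
    rw [TensorProduct.tmul_zero]
    exact P.zero_mem
  smul_mem' c x hx := by
    change (1 : ℂ) ⊗ₜ[ℝ] (c • x) ∈ P
    have : (1 : ℂ) ⊗ₜ[ℝ] (c • x) = (c : ℂ) • ((1 : ℂ) ⊗ₜ[ℝ] x) := by
      apply cext
      · rw [cre_smul, cre_tmul, cre_tmul, cim_tmul]; simp
      · rw [cim_smul, cim_tmul, cre_tmul, cim_tmul]; simp
    rw [this]
    exact P.smul_mem _ hx

theorem mem_realPoints {P : Submodule ℂ (ℂ ⊗[ℝ] L)} {x : L} :
    x ∈ realPoints P ↔ (1 : ℂ) ⊗ₜ[ℝ] x ∈ P := Iff.rfl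

/-- A subspace stable under conjugation is the direct sum of its real points and i times them, so
its real dimension is twice that of the real points. -/
theorem finrank_realPoints [FiniteDimensional ℝ L] (P : Submodule ℂ (ℂ ⊗[ℝ] L))
    (hP : ∀ u ∈ P, conjC u ∈ P) : finrank ℝ (realPoints P) = finrank ℂ P := by
  let e : P ≃ₗ[ℝ] (realPoints P) × (realPoints P) :=
    { toFun := fun u => (⟨cre u, cre_mem_of_conjC u.2 (hP u u.2)⟩,
        ⟨cim u, cim_mem_of_conjC u.2 (hP u u.2)⟩)
      map_add' := fun u v => by ext <;> simp
      map_smul' := fun c u => by ext <;> simp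
      invFun := fun x => ⟨(1 : ℂ) ⊗ₜ[ℝ] x.1.1 + Complex.I • ((1 : ℂ) ⊗ₜ[ℝ] x.2.1),
        P.add_mem x.1.2 (P.smul_mem _ x.2.2)⟩
      left_inv := fun u => Subtype.ext (eq_cre_add_cim u.1).symm
      right_inv := fun x => by ext <;> simp [cre_smul, cim_smul] }
  have h1 := e.finrank_eq
  have h2 : finrank ℝ P = 2 * finrank ℂ P := finrank_real_of_complex P
  rw [Module.finrank_prod] at h1
  omega

variable [FiniteDimensional ℝ L]

theorem killingForm_one_tmul (x y : L) :
    killingForm ℂ (ℂ ⊗[ℝ] L) ((1 : ℂ) ⊗ₜ[ℝ] x) ((1 : ℂ) ⊗ₜ[ℝ] y) = killingForm ℝ L x y := by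
  change LieModule.traceForm ℂ (ℂ ⊗[ℝ] L) (ℂ ⊗[ℝ] L) _ _ = _
  rw [LieModule.traceForm_baseChange]
  simp [killingForm]

theorem clinear_ext {M : Type*} [AddCommGroup M] [Module ℂ M] {S T : ℂ ⊗[ℝ] L →ₗ[ℂ] M}
    (h : ∀ x : L, S ((1 : ℂ) ⊗ₜ[ℝ] x) = T ((1 : ℂ) ⊗ₜ[ℝ] x)) : S = T := by
  ext x
  exact h x

theorem killingForm_baseChange_symm (T : Module.End ℝ L)
    (h : ∀ x y, killingForm ℝ L (T x) y = killingForm ℝ L x (T y)) (u v : ℂ ⊗[ℝ] L) :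
    killingForm ℂ (ℂ ⊗[ℝ] L) (T.baseChange ℂ u) v =
      killingForm ℂ (ℂ ⊗[ℝ] L) u (T.baseChange ℂ v) := by
  rw [eq_cre_add_cim u, eq_cre_add_cim v]
  simp only [map_add, map_smul, LinearMap.baseChange_tmul, LinearMap.add_apply,
    LinearMap.smul_apply, killingForm_one_tmul, h]

end Complexification

section RealForm

variable {L : Type*} [LieRing L] [LieAlgebra ℝ L] [FiniteDimensional ℝ L]
  [IsKilling ℂ (ℂ ⊗[ℝ] L)] {H : LieSubalgebra ℂ (ℂ ⊗[ℝ] L)} [H.IsCartanSubalgebra]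

namespace MatrixUnits

variable {A : MatrixUnits H} {k : LieSubalgebra ℝ L}

/-- Diagonal units are purely imaginary and roots take rational values on them, so conjugation
exchanges the root spaces of α and -α. This is why degrees k and -k together form one real summand.
-/
theorem conjC_mem_subP (hc : ∀ s i, conjC (A.E s i i) = -A.E s i i) {m : ℕ} {u : ℂ ⊗[ℝ] L}
    (hu : u ∈ A.subP m) : conjC u ∈ A.subP m := by
  refine subP_induction (p := fun u => conjC u ∈ A.subP m)
    (by rw [conjC_zero]; exact Submodule.zero_mem _)
    (fun x y hx hy => by rw [conjC_add]; exact Submodule.add_mem _ hx hy)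
    (fun α hα x hx => ?_) hu
  have hneg : A.IsClass m (negRoot α) := by
    rw [IsClass, deg_neg]
    rcases hα with h | h <;> rw [h] <;> simp
  refine mem_subP hneg (weightSpace_le_genWeightSpace _ _ ?_)
  rw [mem_weightSpace]
  have hD (s i) : ⁅A.E s i i, conjC x⁆ = -α.1 (A.D s i) • conjC x := by
    have h1 := congrArg conjC (D_lie_of_mem (A := A) hx s i)
    rw [conjC_lie, hc, conjC_smul] at h1
    have h2 : (starRingEnd ℂ) (α.1 (A.D s i)) = α.1 (A.D s i) := by
      obtain ⟨a, ha⟩ := A.exists_rep α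
      rw [ha s i]
      simp [Complex.conj_ofNat]
    rw [h2, neg_lie] at h1
    rw [neg_smul, ← h1, neg_neg]
  intro h
  obtain ⟨c, rfl⟩ := A.span_D h
  change ⁅((∑ s, ∑ i, c s i • A.D s i : H) : ℂ ⊗[ℝ] L), _⁆ =
    (-α.1 (∑ s, ∑ i, c s i • A.D s i)) • _
  rw [A.root_apply_sum]
  have h3 : ((∑ s, ∑ i, c s i • A.D s i : H) : ℂ ⊗[ℝ] L) = ∑ s, ∑ i, c s i • A.E s i i := by
    simp [D]
  rw [h3]
  simp only [sum_lie, csmul_lie, hD, ← Finset.sum_neg_distrib, Finset.sum_smul, smul_smul, mul_neg]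

theorem conjC_mem_subK (hk : A.subK = Submodule.span ℂ ((fun z : L => (1 : ℂ) ⊗ₜ[ℝ] z) '' k))
    {u : ℂ ⊗[ℝ] L} (hu : u ∈ A.subK) : conjC u ∈ A.subK := by
  rw [hk] at hu ⊢
  induction hu using Submodule.span_induction with
  | mem x hx =>
    obtain ⟨z, hz, rfl⟩ := hx
    have : conjC ((1 : ℂ) ⊗ₜ[ℝ] z) = (1 : ℂ) ⊗ₜ[ℝ] z := by simp [conjC]
    rw [this]
    exact Submodule.subset_span ⟨z, hz, rfl⟩
  | zero => rw [conjC_zero]; exact Submodule.zero_mem _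
  | add x y _ _ hx hy => rw [conjC_add]; exact Submodule.add_mem _ hx hy
  | smul c x _ hx => rw [conjC_smul]; exact Submodule.smul_mem _ _ hx

theorem realPoints_subK (hk : A.subK = Submodule.span ℂ ((fun z : L => (1 : ℂ) ⊗ₜ[ℝ] z) '' k)) :
    realPoints A.subK = k.toSubmodule := by
  refine le_antisymm (fun x hx => ?_) (fun x hx => ?_)
  · have h1 : ∀ u ∈ A.subK, cre u ∈ k ∧ cim u ∈ k := by
      intro u hu
      rw [hk] at hu
      induction hu using Submodule.span_induction with
      | mem x hx =>
        obtain ⟨z, hz, rfl⟩ := hx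
        simp only [cre_tmul, cim_tmul, Complex.one_re, Complex.one_im, one_smul, zero_smul]
        exact ⟨hz, k.zero_mem⟩
      | zero => simp
      | add x y _ _ hx hy =>
        rw [map_add, map_add]
        exact ⟨k.add_mem hx.1 hy.1, k.add_mem hx.2 hy.2⟩
      | smul c x _ hx =>
        rw [cre_smul, cim_smul]
        exact ⟨k.sub_mem (k.smul_mem _ hx.1) (k.smul_mem _ hx.2),
          k.add_mem (k.smul_mem _ hx.2) (k.smul_mem _ hx.1)⟩
    have := (h1 _ hx).1
    simpa using this
  · rw [mem_realPoints, hk]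
    exact Submodule.subset_span ⟨x, hx, rfl⟩

/-- The isotropy decomposition over the reals. -/
theorem sup_realPoints (hE : HasE8Base H) (hc : ∀ s i, conjC (A.E s i i) = -A.E s i i)
    (hk : A.subK = Submodule.span ℂ ((fun z : L => (1 : ℂ) ⊗ₜ[ℝ] z) '' k)) :
    k.toSubmodule ⊔ realPoints (A.subP 1) ⊔ realPoints (A.subP 2) = ⊤ := by
  rw [eq_top_iff]
  intro x _
  have h1 : (1 : ℂ) ⊗ₜ[ℝ] x ∈ A.subK ⊔ A.subP 1 ⊔ A.subP 2 := by
    rw [A.subK_sup_subP hE]; exact Submodule.mem_top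
  obtain ⟨u, hu, w, hw, h2⟩ := Submodule.mem_sup.1 h1
  obtain ⟨v, hv, v', hv', rfl⟩ := Submodule.mem_sup.1 hu
  have h3 : x = cre v + cre v' + cre w := by
    rw [← map_add, ← map_add, h2]; simp
  rw [h3]
  refine Submodule.add_mem_sup (Submodule.add_mem_sup ?_ ?_) ?_
  · rw [← realPoints_subK hk]
    exact cre_mem_of_conjC hv (conjC_mem_subK hk hv)
  · exact cre_mem_of_conjC hv' (conjC_mem_subP hc hv')
  · exact cre_mem_of_conjC hw (conjC_mem_subP hc hw)

/-- A complex linear property of the matrix units needs to be checked only on real elements of `k`.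
-/
theorem E_mem_span (hk : A.subK = Submodule.span ℂ ((fun z : L => (1 : ℂ) ⊗ₜ[ℝ] z) '' k))
    {p : ℂ ⊗[ℝ] L → Prop} (h0 : p 0) (hadd : ∀ x y, p x → p y → p (x + y))
    (hsmul : ∀ (c : ℂ) x, p x → p (c • x)) (h : ∀ z ∈ k, p ((1 : ℂ) ⊗ₜ[ℝ] z))
    (s : Fin 2) (i j : Fin 5) : p (A.E s i j) := by
  have h1 := E_mem_subK (A := A) s i j
  rw [hk] at h1
  exact Submodule.span_induction (p := fun x _ => p x)
    (by rintro _ ⟨z, hz, rfl⟩; exact h z hz) h0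
    (fun x y _ _ => hadd x y) (fun c x _ => hsmul c x) h1

theorem killingForm_realPoints (hk : A.subK = Submodule.span ℂ ((fun z : L => (1 : ℂ) ⊗ₜ[ℝ] z) '' k))
    {m : ℕ} (hm : m = 1 ∨ m = 2) {z x : L} (hz : z ∈ k) (hx : x ∈ realPoints (A.subP m)) :
    killingForm ℝ L z x = 0 := by
  have h1 : (1 : ℂ) ⊗ₜ[ℝ] z ∈ A.subK := by
    rw [hk]; exact Submodule.subset_span ⟨z, hz, rfl⟩
  have h2 : killingForm ℂ (ℂ ⊗[ℝ] L) ((1 : ℂ) ⊗ₜ[ℝ] z) ((1 : ℂ) ⊗ₜ[ℝ] x) = 0 :=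
    subK_induction (p := fun u => killingForm ℂ (ℂ ⊗[ℝ] L) u ((1 : ℂ) ⊗ₜ[ℝ] x) = 0) (by simp)
      (fun x y hx hy => by rw [map_add, LinearMap.add_apply, hx, hy, add_zero])
      (fun c x hx => by rw [map_smul, LinearMap.smul_apply, hx, smul_zero])
      (fun s i j => killingForm_E_subP hm s i j hx) h1
  rw [killingForm_one_tmul] at h2
  exact_mod_cast h2

theorem lie_mem_realPoints (hE : HasE8Base H)
    (hk : A.subK = Submodule.span ℂ ((fun z : L => (1 : ℂ) ⊗ₜ[ℝ] z) '' k))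
    {m : ℕ} (hm : m = 1 ∨ m = 2) {z x : L} (hz : z ∈ k) (hx : x ∈ realPoints (A.subP m)) :
    ⁅z, x⁆ ∈ realPoints (A.subP m) := by
  have h1 : (1 : ℂ) ⊗ₜ[ℝ] z ∈ A.subK := by
    rw [hk]; exact Submodule.subset_span ⟨z, hz, rfl⟩
  rw [mem_realPoints, ← lie_one_tmul]
  exact subK_induction (p := fun u => ⁅u, (1 : ℂ) ⊗ₜ[ℝ] x⁆ ∈ A.subP m)
    (by rw [zero_lie]; exact Submodule.zero_mem _)
    (fun x y hx hy => by rw [add_lie]; exact Submodule.add_mem _ hx hy)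
    (fun c x hx => by rw [csmul_lie]; exact Submodule.smul_mem _ _ hx)
    (fun s i j => lie_E_subP s i j hx hE hm) h1

/-- The Casimir operator of the subalgebra is `1 / 5` on its orthogonal complement. -/
theorem trace_ad_ad_proj (hE : HasE8Base H)
    (hk : A.subK = Submodule.span ℂ ((fun z : L => (1 : ℂ) ⊗ₜ[ℝ] z) '' k))
    (Q : Module.End ℝ L) (hQ : ∀ z ∈ k, Q z = z)
    (hQ' : ∀ m, m = 1 ∨ m = 2 → ∀ x ∈ realPoints (A.subP m), Q x = 0)
    (hc : ∀ s i, conjC (A.E s i i) = -A.E s i i)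
    {m : ℕ} (hm : m = 1 ∨ m = 2) (y : L) {z : L} (hz : z ∈ realPoints (A.subP m)) :
    LinearMap.trace ℝ L (ad ℝ L y ∘ₗ ad ℝ L z ∘ₗ Q) = 1 / 5 * killingForm ℝ L y z := by
  -- The matrix units at (i, j) and (j, i), with factor 1/60, act as dual families and give the
  -- complexified orthogonal projection onto the subalgebra.
  have hQC (x : L) : Q.baseChange ℂ ((1 : ℂ) ⊗ₜ[ℝ] x) = (1 / 60 : ℂ) • ∑ s, ∑ i, ∑ j,
      killingForm ℂ (ℂ ⊗[ℝ] L) ((1 : ℂ) ⊗ₜ[ℝ] x) (A.E s j i) • A.E s i j := by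
    rw [LinearMap.baseChange_tmul]
    have hx : x ∈ k.toSubmodule ⊔ realPoints (A.subP 1) ⊔ realPoints (A.subP 2) := by
      rw [sup_realPoints hE hc hk]; exact Submodule.mem_top
    have hP (m) (hm : m = 1 ∨ m = 2) (x) (hx : x ∈ realPoints (A.subP m)) : (1 / 60 : ℂ) • ∑ s, ∑ i, ∑ j,
        killingForm ℂ (ℂ ⊗[ℝ] L) ((1 : ℂ) ⊗ₜ[ℝ] x) (A.E s j i) • A.E s i j = 0 := by
      rw [Finset.sum_eq_zero, smul_zero]
      intro s _
      refine Finset.sum_eq_zero fun i _ => Finset.sum_eq_zero fun j _ => ?_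
      rw [LieModule.traceForm_comm]
      have := killingForm_E_subP hm s j i hx
      rw [killingForm] at this
      rw [this, zero_smul]
    obtain ⟨u, hu, w, hw, rfl⟩ := Submodule.mem_sup.1 hx
    obtain ⟨v, hv, v', hv', rfl⟩ := Submodule.mem_sup.1 hu
    have h1 := sum_killingForm_smul_E (A := A) hE (x := (1 : ℂ) ⊗ₜ[ℝ] v)
      (by rw [hk]; exact Submodule.subset_span ⟨v, hv, rfl⟩)
    have h2 := hP 1 (Or.inl rfl) v' hv'
    have h3 := hP 2 (Or.inr rfl) w hw
    rw [map_add, map_add, hQ v hv, hQ' 1 (Or.inl rfl) v' hv', hQ' 2 (Or.inr rfl) w hw]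
    simp only [TensorProduct.tmul_add, map_add, LinearMap.add_apply, add_smul,
      Finset.sum_add_distrib, smul_add, TensorProduct.tmul_zero]
    rw [h1, h2, h3, smul_smul]
    norm_num
  -- The operator is thereby a sum of rank one maps, whose traces are evaluations.
  have hbc : (ad ℝ L y ∘ₗ ad ℝ L z ∘ₗ Q).baseChange ℂ = (1 / 60 : ℂ) • ∑ s, ∑ i, ∑ j,
      (killingForm ℂ (ℂ ⊗[ℝ] L) (A.E s j i)).smulRight
        ⁅(1 : ℂ) ⊗ₜ[ℝ] y, ⁅(1 : ℂ) ⊗ₜ[ℝ] z, A.E s i j⁆⁆ := by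
    refine clinear_ext fun x => ?_
    have h1 : (ad ℝ L y ∘ₗ ad ℝ L z ∘ₗ Q).baseChange ℂ ((1 : ℂ) ⊗ₜ[ℝ] x) =
        ⁅(1 : ℂ) ⊗ₜ[ℝ] y, ⁅(1 : ℂ) ⊗ₜ[ℝ] z, Q.baseChange ℂ ((1 : ℂ) ⊗ₜ[ℝ] x)⁆⁆ := by
      simp [lie_one_tmul]
    rw [h1, hQC]
    simp only [clie_smul, clie_sum, LinearMap.smul_apply, LinearMap.sum_apply,
      LinearMap.smulRight_apply]
    refine congrArg _ (Finset.sum_congr rfl fun s _ => Finset.sum_congr rfl fun i _ =>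
      Finset.sum_congr rfl fun j _ => ?_)
    exact congrArg (fun c : ℂ => c • (⁅(1 : ℂ) ⊗ₜ[ℝ] y, ⁅(1 : ℂ) ⊗ₜ[ℝ] z, A.E s i j⁆⁆ : ℂ ⊗[ℝ] L)) (LieModule.traceForm_comm ℂ (ℂ ⊗[ℝ] L) (ℂ ⊗[ℝ] L) _ _)
  have htr := LinearMap.trace_baseChange (ad ℝ L y ∘ₗ ad ℝ L z ∘ₗ Q) ℂ
  rw [hbc] at htr
  simp only [map_smul, map_sum, LinearMap.trace_smulRight] at htr
  -- By invariance of the Killing form the double brackets by y and z turn into the double bracket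
  -- of matrix units acting on z, so the trace becomes the Casimir value 12/60.
  have hterm (s i j) : killingForm ℂ (ℂ ⊗[ℝ] L) (A.E s j i)
      ⁅(1 : ℂ) ⊗ₜ[ℝ] y, ⁅(1 : ℂ) ⊗ₜ[ℝ] z, A.E s i j⁆⁆ =
      killingForm ℂ (ℂ ⊗[ℝ] L) ((1 : ℂ) ⊗ₜ[ℝ] y) ⁅A.E s j i, ⁅A.E s i j, (1 : ℂ) ⊗ₜ[ℝ] z⁆⁆ := by
    rw [killingForm, ← LieModule.traceForm_apply_lie_apply, ← lie_skew,
      map_neg, LinearMap.neg_apply, LieModule.traceForm_apply_lie_apply,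
      ← lie_skew (A.E s i j) ((1 : ℂ) ⊗ₜ[ℝ] z), clie_neg, map_neg]
  simp only [hterm, ← map_sum] at htr
  rw [sum_lie_E_lie_E hE hm hz, map_smul, killingForm_one_tmul] at htr
  have h5 : ((LinearMap.trace ℝ L (ad ℝ L y ∘ₗ ad ℝ L z ∘ₗ Q) : ℝ) : ℂ) =
      ((1 / 5 * killingForm ℝ L y z : ℝ) : ℂ) := by
    rw [Complex.coe_algebraMap] at htr
    rw [← htr]
    push_cast
    simp only [smul_eq_mul]
    ring
  exact_mod_cast h5

/-- Schur's lemma for the isotropy representation over the reals. -/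
theorem exists_scalar_realPoints (hE : HasE8Base H)
    (hk : A.subK = Submodule.span ℂ ((fun z : L => (1 : ℂ) ⊗ₜ[ℝ] z) '' k)) (T : Module.End ℝ L)
    (hT : ∀ z ∈ k, ∀ x, T ⁅z, x⁆ = ⁅z, T x⁆)
    (hsymm : ∀ x y, killingForm ℝ L (T x) y = killingForm ℝ L x (T y)) {m : ℕ}
    (hm : m = 1 ∨ m = 2) : ∃ c : ℝ, ∀ x ∈ realPoints (A.subP m), T x = c • x := by
  obtain ⟨c, hc⟩ := exists_scalar_subP (A := A) hE (T.baseChange ℂ) (fun s i j => by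
    refine E_mem_span hk (p := fun u => ∀ x, T.baseChange ℂ ⁅u, x⁆ = ⁅u, T.baseChange ℂ x⁆)
      (by simp) (fun u v hu hv x => by rw [cadd_lie, map_add, hu, hv, cadd_lie])
      (fun c u hu x => by rw [csmul_lie, map_smul, hu, csmul_lie]) (fun z hz x => ?_) s i j
    rw [eq_cre_add_cim x]
    simp only [clie_add, clie_smul, map_add, map_smul, lie_one_tmul, LinearMap.baseChange_tmul,
      hT z hz]) (killingForm_baseChange_symm T hsymm) hm
  -- On a real vector both x and T x are real, so the real part of the eigenvalue equation suffices.
  refine ⟨c.re, fun x hx => ?_⟩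
  have h1 := congrArg cre (hc _ hx)
  rw [LinearMap.baseChange_tmul, cre_smul] at h1
  simpa using h1

end MatrixUnits

end RealForm

end

/-! ### Extending maps from su(5) to complex matrices -/

section

open LieAlgebra LieAlgebra.IsKilling LieModule Module

section SkewPart

open Matrix

theorem su_lie_coe (x y : su 5) :
    ((⁅x, y⁆ : su 5) : Matrix (Fin 5) (Fin 5) ℂ) = x.1 * y.1 - y.1 * x.1 := rfl

/-- The traceless skew-Hermitian part of a matrix. -/
def skewPart : Matrix (Fin 5) (Fin 5) ℂ →ₗ[ℝ] su 5 where
  toFun X := ⟨(1 / 2 : ℂ) • (X - Xᴴ) - (((1 / 2 : ℂ) • (X - Xᴴ)).trace / 5) • 1, by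
    constructor
    · have hs : ((1 / 2 : ℂ) • (X - Xᴴ))ᴴ = -((1 / 2 : ℂ) • (X - Xᴴ)) := by
        rw [conjTranspose_smul, conjTranspose_sub, conjTranspose_conjTranspose, ← smul_neg, neg_sub]
        simp
      have hc := congrArg trace hs
      rw [trace_conjTranspose, trace_neg] at hc
      rw [conjTranspose_sub, hs, conjTranspose_smul, star_div₀, hc, conjTranspose_one]
      rw [show star (5 : ℂ) = 5 from Complex.conj_ofNat 5, neg_div, neg_smul]
      abel
    · rw [trace_sub, trace_smul (_ / 5), trace_one, Fintype.card_fin, smul_eq_mul]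
      push_cast
      ring⟩
  map_add' X Y := by
    apply Subtype.ext
    change _ = (((1 / 2 : ℂ) • (X - Xᴴ) - (((1 / 2 : ℂ) • (X - Xᴴ)).trace / 5) • 1) +
      ((1 / 2 : ℂ) • (Y - Yᴴ) - (((1 / 2 : ℂ) • (Y - Yᴴ)).trace / 5) • 1) :
      Matrix (Fin 5) (Fin 5) ℂ)
    simp only [conjTranspose_add, trace_smul, trace_add, trace_sub, smul_eq_mul]
    module
  map_smul' c X := by
    apply Subtype.ext
    have h : (c • X)ᴴ = c • Xᴴ := by rw [conjTranspose_smul]; simp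
    change _ = c • ((1 / 2 : ℂ) • (X - Xᴴ) - (((1 / 2 : ℂ) • (X - Xᴴ)).trace / 5) • 1 :
      Matrix (Fin 5) (Fin 5) ℂ)
    simp only [h, trace_smul, trace_sub, smul_eq_mul]
    ext i j
    simp
    ring

theorem skewPart_coe (X : Matrix (Fin 5) (Fin 5) ℂ) : ∃ c : ℂ,
    (skewPart X).1 = (1 / 2 : ℂ) • (X - Xᴴ) - c • 1 := ⟨_, rfl⟩

theorem skewPart_of_isHermitian {X : Matrix (Fin 5) (Fin 5) ℂ} (h : Xᴴ = X) : skewPart X = 0 := by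
  apply Subtype.ext
  simp only [skewPart, LinearMap.coe_mk, AddHom.coe_mk, h, sub_self, smul_zero, trace_zero,
    zero_div, zero_smul]
  rfl

theorem skewPart_coe_self (x : su 5) : skewPart x.1 = x := by
  apply Subtype.ext
  have h1 := x.2.1
  have h2 := x.2.2
  simp only [skewPart, LinearMap.coe_mk, AddHom.coe_mk, h1, trace_smul, trace_sub, trace_neg, h2]
  ext i j
  simp
  ring

theorem skewPart_smul_one (c : ℂ) : skewPart (c • 1) = 0 := by
  apply Subtype.ext
  simp only [skewPart, LinearMap.coe_mk, AddHom.coe_mk, conjTranspose_smul, conjTranspose_one,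
    trace_smul, trace_sub, trace_one, Fintype.card_fin]
  change _ = (0 : Matrix (Fin 5) (Fin 5) ℂ)
  ext i j
  simp
  ring

/-- Modulo scalars X is U + iV with U and V the skew parts of X and -iX. The identity is the real
part of the commutator of two such expressions; the scalars drop out. -/
theorem skewPart_lie (X Y : Matrix (Fin 5) (Fin 5) ℂ) :
    ⁅skewPart X, skewPart Y⁆ - ⁅skewPart (-Complex.I • X), skewPart (-Complex.I • Y)⁆ =
      skewPart (X * Y - Y * X) := by
  apply Subtype.ext
  change (⁅skewPart X, skewPart Y⁆ : su 5).1 -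
    (⁅skewPart (-Complex.I • X), skewPart (-Complex.I • Y)⁆ : su 5).1 = _
  rw [su_lie_coe, su_lie_coe]
  obtain ⟨a, ha⟩ := skewPart_coe X
  obtain ⟨b, hb⟩ := skewPart_coe Y
  obtain ⟨c, hc⟩ := skewPart_coe (-Complex.I • X)
  obtain ⟨d, hd⟩ := skewPart_coe (-Complex.I • Y)
  have he : (skewPart (X * Y - Y * X)).1 = (1 / 2 : ℂ) • (X * Y - Y * X - (X * Y - Y * X)ᴴ) := by
    have : ((1 / 2 : ℂ) • (X * Y - Y * X - (X * Y - Y * X)ᴴ)).trace = 0 := by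
      simp [trace_sub, trace_mul_comm X Y, trace_mul_comm Xᴴ Yᴴ]
    simp only [skewPart, LinearMap.coe_mk, AddHom.coe_mk, this]
    simp
  rw [ha, hb, hc, hd, he]
  have h1 : (-Complex.I • X)ᴴ = Complex.I • Xᴴ := by simp [conjTranspose_smul]
  have h2 : (-Complex.I • Y)ᴴ = Complex.I • Yᴴ := by simp [conjTranspose_smul]
  rw [h1, h2, show -Complex.I • X - Complex.I • Xᴴ = -Complex.I • (X + Xᴴ) by module,
    show -Complex.I • Y - Complex.I • Yᴴ = -Complex.I • (Y + Yᴴ) by module]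
  simp only [conjTranspose_sub, conjTranspose_mul, sub_mul, mul_sub, smul_mul_assoc, mul_smul_comm,
    smul_smul, mul_one, one_mul, add_mul, mul_add, smul_add, smul_sub]
  have h3 : (1 / 2 * (-Complex.I) * (1 / 2 * (-Complex.I)) : ℂ) = -(1 / 4) := by
    linear_combination (1 / 4 : ℂ) * Complex.I_mul_I
  rw [h3]
  module

end SkewPart

section Embedding

variable {L : Type*} [LieRing L] [LieAlgebra ℝ L]

/-- The complex linear extension to all matrices of a Lie algebra map defined on `su(5)`. -/
def extendSu (j : su 5 →ₗ[ℝ] L) (X : Matrix (Fin 5) (Fin 5) ℂ) : ℂ ⊗[ℝ] L :=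
  (1 : ℂ) ⊗ₜ[ℝ] j (skewPart X) + Complex.I • ((1 : ℂ) ⊗ₜ[ℝ] j (skewPart (-Complex.I • X)))

variable (j : su 5 →ₗ[ℝ] L)

@[simp] theorem cre_extendSu (X) : cre (extendSu j X) = j (skewPart X) := by
  simp [extendSu, cre_smul]

@[simp] theorem cim_extendSu (X) : cim (extendSu j X) = j (skewPart (-Complex.I • X)) := by
  simp [extendSu, cim_smul]

theorem extendSu_add (X Y) : extendSu j (X + Y) = extendSu j X + extendSu j Y := by
  apply cext
  · simp only [cre_extendSu, map_add]
  · rw [cim_extendSu, smul_add]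
    simp only [cim_extendSu, map_add]

theorem extendSu_smul (c : ℂ) (X) : extendSu j (c • X) = c • extendSu j X := by
  have hc (Y : Matrix (Fin 5) (Fin 5) ℂ) :
      c • Y = c.re • Y - c.im • (-Complex.I • Y) := by
    ext a b
    simp only [Matrix.smul_apply, Matrix.sub_apply, smul_eq_mul, Complex.real_smul]
    conv_lhs => rw [← Complex.re_add_im c]
    ring
  apply cext
  · rw [cre_smul, cre_extendSu, cre_extendSu, cim_extendSu, hc]
    simp only [map_sub, map_smul]
  · rw [cim_smul, cim_extendSu, cre_extendSu, cim_extendSu, hc, smul_sub, smul_comm _ c.re,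
      smul_comm _ c.im, smul_smul, show -Complex.I * -Complex.I = -1 by simp, neg_one_smul]
    simp only [map_sub, map_smul, map_neg, smul_neg, sub_neg_eq_add, map_add]

theorem extendSu_sub (X Y) : extendSu j (X - Y) = extendSu j X - extendSu j Y := by
  rw [sub_eq_add_neg, extendSu_add, ← neg_one_smul ℂ Y, extendSu_smul, neg_one_smul,
    ← sub_eq_add_neg]

theorem extendSu_zero : extendSu j 0 = 0 := by
  simpa using extendSu_smul j 0 0

theorem extendSu_sum {ι : Type*} (t : Finset ι) (f : ι → Matrix (Fin 5) (Fin 5) ℂ) :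
    extendSu j (∑ i ∈ t, f i) = ∑ i ∈ t, extendSu j (f i) := by
  classical
  induction t using Finset.induction_on with
  | empty => rw [Finset.sum_empty, Finset.sum_empty, extendSu_zero]
  | insert a t ha ih => rw [Finset.sum_insert ha, Finset.sum_insert ha, extendSu_add, ih]

/-- Real parts agree by `skewPart_lie` for X and Y, imaginary parts by `skewPart_lie` for -iX and Y.
-/
theorem extendSu_lie (hj : ∀ x y, j ⁅x, y⁆ = ⁅j x, j y⁆) (X Y) :
    ⁅extendSu j X, extendSu j Y⁆ = extendSu j (X * Y - Y * X) := by
  apply cext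
  · rw [cre_lie, cre_extendSu, cre_extendSu, cim_extendSu, cim_extendSu, cre_extendSu, ← hj, ← hj,
      ← map_sub, skewPart_lie]
  · have h := skewPart_lie (-Complex.I • X) Y
    rw [smul_smul, show -Complex.I * -Complex.I = -1 by simp, neg_one_smul, map_neg, neg_lie,
      sub_neg_eq_add, smul_mul_assoc, mul_smul_comm, ← smul_sub] at h
    rw [cim_lie, cre_extendSu, cre_extendSu, cim_extendSu, cim_extendSu, cim_extendSu, ← h, ← hj,
      ← hj, ← map_add, add_comm]

theorem extendSu_lie_eq_zero {j' : su 5 →ₗ[ℝ] L} (h : ∀ x y, ⁅j x, j' y⁆ = 0) (X Y) :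
    ⁅extendSu j X, extendSu j' Y⁆ = 0 := by
  apply cext
  · rw [cre_lie]; simp [h]
  · rw [cim_lie]; simp [h]

theorem extendSu_one : extendSu j 1 = 0 := by
  have h1 := skewPart_smul_one 1
  rw [one_smul] at h1
  rw [extendSu, skewPart_smul_one, h1]
  simp

theorem extendSu_coe (x : su 5) : extendSu j x.1 = (1 : ℂ) ⊗ₜ[ℝ] j x := by
  have h : skewPart (-Complex.I • x.1) = 0 := by
    refine skewPart_of_isHermitian ?_
    rw [Matrix.conjTranspose_smul, x.2.1]
    simp
  rw [extendSu, skewPart_coe_self, h]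
  simp

/-- Hermitian matrices are i times skew-Hermitian ones, so they go to purely imaginary elements.
Applied to diagonal matrix units this gives the conjugation rule behind the real form. -/
theorem extendSu_of_isHermitian {X : Matrix (Fin 5) (Fin 5) ℂ} (h : X.conjTranspose = X) :
    conjC (extendSu j X) = -extendSu j X := by
  apply cext <;> simp [skewPart_of_isHermitian h]

theorem extendSu_single_ne_zero (hj : Function.Injective j) {a b : Fin 5} (hab : a ≠ b) :
    extendSu j (Matrix.single a b 1) ≠ 0 := by
  intro h
  have h1 := congrArg cre h
  rw [cre_extendSu, map_zero] at h1
  have h2 := congrArg Subtype.val (hj (h1.trans (map_zero j).symm))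
  obtain ⟨c, hc⟩ := skewPart_coe (Matrix.single a b 1)
  rw [hc] at h2
  have h3 := congrFun (congrFun h2 a) b
  simp [Matrix.single, hab, hab.symm] at h3

end Embedding

end

/-! ### Maximal abelian subspaces and the existence of matrix units -/

section

open LieAlgebra LieAlgebra.IsKilling LieModule Module

section Cartan

variable {L : Type*} [LieRing L] [LieAlgebra ℝ L]

/-- An abelian subspace of a Lie algebra. -/
def IsAbelianSubspace (W : Submodule ℝ L) : Prop := ∀ x ∈ W, ∀ y ∈ W, ⁅x, y⁆ = 0

theorem isAbelianSubspace_span {s : Set L} (hs : ∀ x ∈ s, ∀ y ∈ s, ⁅x, y⁆ = 0) :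
    IsAbelianSubspace (Submodule.span ℝ s) := by
  intro x hx y hy
  induction hx using Submodule.span_induction with
  | mem x hx =>
    induction hy using Submodule.span_induction with
    | mem y hy => exact hs x hx y hy
    | zero => exact lie_zero x
    | add y z _ _ h1 h2 => rw [lie_add, h1, h2, add_zero]
    | smul c y _ h => rw [lie_smul, h, smul_zero]
  | zero => exact zero_lie y
  | add y z _ _ h1 h2 => rw [add_lie, h1, h2, add_zero]
  | smul c y _ h => rw [smul_lie, h, smul_zero]

/-- A maximal abelian subspace. -/
structure IsMaxAbelian (W : Submodule ℝ L) : Prop where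
  abelian : IsAbelianSubspace W
  mem : ∀ v, (∀ a ∈ W, ⁅a, v⁆ = 0) → v ∈ W

/-- Take a maximal abelian subspace above `T`: adjoining a vector that centralises it keeps it
abelian, so that vector was already inside. -/
theorem IsAbelianSubspace.exists_le [FiniteDimensional ℝ L] {T : Submodule ℝ L}
    (hT : IsAbelianSubspace T) : ∃ W, T ≤ W ∧ IsMaxAbelian W := by
  obtain ⟨W, ⟨hTW, hW⟩, hmax⟩ := (wellFounded_gt (α := Submodule ℝ L)).has_min
    {W | T ≤ W ∧ IsAbelianSubspace W} ⟨T, le_rfl, hT⟩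
  refine ⟨W, hTW, hW, fun v hv => ?_⟩
  by_contra hvW
  have hab : IsAbelianSubspace (W ⊔ Submodule.span ℝ {v}) := by
    intro x hx y hy
    obtain ⟨a, ha, c, hc, rfl⟩ := Submodule.mem_sup.1 hx
    obtain ⟨b, hb, d, hd, rfl⟩ := Submodule.mem_sup.1 hy
    obtain ⟨r, rfl⟩ := Submodule.mem_span_singleton.1 hc
    obtain ⟨t, rfl⟩ := Submodule.mem_span_singleton.1 hd
    have h1 : ⁅v, b⁆ = 0 := by rw [← lie_skew, hv b hb, neg_zero]
    simp [hW a ha b hb, hv a ha, h1]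
  refine hmax (W ⊔ Submodule.span ℝ {v}) ⟨hTW.trans le_sup_left, hab⟩ ?_
  refine lt_of_le_of_ne le_sup_left fun h => hvW ?_
  rw [h]
  exact Submodule.mem_sup_right (Submodule.mem_span_singleton_self v)

/-- The complexification of a maximal abelian subspace. -/
def IsMaxAbelian.complexify {W : Submodule ℝ L} (hW : IsMaxAbelian W) :
    LieSubalgebra ℂ (ℂ ⊗[ℝ] L) where
  carrier := {u | cre u ∈ W ∧ cim u ∈ W}
  add_mem' {u v} hu hv := by
    change cre (u + v) ∈ W ∧ cim (u + v) ∈ W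
    rw [map_add, map_add]
    exact ⟨W.add_mem hu.1 hv.1, W.add_mem hu.2 hv.2⟩
  zero_mem' := by
    change cre (0 : ℂ ⊗[ℝ] L) ∈ W ∧ cim (0 : ℂ ⊗[ℝ] L) ∈ W
    rw [map_zero, map_zero]
    exact ⟨W.zero_mem, W.zero_mem⟩
  smul_mem' c u hu := by
    change cre (c • u) ∈ W ∧ cim (c • u) ∈ W
    rw [cre_smul, cim_smul]
    exact ⟨W.sub_mem (W.smul_mem _ hu.1) (W.smul_mem _ hu.2),
      W.add_mem (W.smul_mem _ hu.2) (W.smul_mem _ hu.1)⟩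
  lie_mem' {u v} hu hv := by
    change cre ⁅u, v⁆ ∈ W ∧ cim ⁅u, v⁆ ∈ W
    rw [cre_lie, cim_lie, hW.abelian _ hu.1 _ hv.1, hW.abelian _ hu.2 _ hv.2,
      hW.abelian _ hu.1 _ hv.2, hW.abelian _ hu.2 _ hv.1, sub_zero, add_zero]
    exact ⟨W.zero_mem, W.zero_mem⟩

theorem IsMaxAbelian.mem_complexify {W : Submodule ℝ L} (hW : IsMaxAbelian W) {u : ℂ ⊗[ℝ] L} :
    u ∈ hW.complexify ↔ cre u ∈ W ∧ cim u ∈ W := Iff.rfl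

/-- Self-normalising is the point. If [v, W] ⊆ W and a ∈ W, then [a, [a, v]] = 0, so invariance
gives B([a, v], [a, v]) = 0. Definiteness of the Killing form yields [a, v] = 0, and maximality puts
v into W. Real and imaginary parts are treated separately. -/
theorem IsMaxAbelian.isCartanSubalgebra [FiniteDimensional ℝ L] [CompactSemisimple L]
    {W : Submodule ℝ L} (hW : IsMaxAbelian W) : hW.complexify.IsCartanSubalgebra where
  nilpotent := by
    have : IsLieAbelian hW.complexify := ⟨fun u v => by
      apply Subtype.ext
      change ⁅u.1, v.1⁆ = (0 : ℂ ⊗[ℝ] L)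
      apply cext
      · rw [cre_lie, hW.abelian _ u.2.1 _ v.2.1, hW.abelian _ u.2.2 _ v.2.2]; simp
      · rw [cim_lie, hW.abelian _ u.2.1 _ v.2.2, hW.abelian _ u.2.2 _ v.2.1]; simp⟩
    infer_instance
  self_normalizing := by
    refine le_antisymm (fun u hu => ?_) (LieSubalgebra.le_normalizer _)
    rw [LieSubalgebra.mem_normalizer_iff] at hu
    have key : ∀ v : L, (∀ a ∈ W, ⁅v, a⁆ ∈ W) → v ∈ W := by
      intro v hv
      refine hW.mem v fun a ha => ?_
      by_contra hne
      have h1 : ⁅a, ⁅a, v⁆⁆ = 0 := by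
        rw [← lie_skew a v, lie_neg, hW.abelian a ha _ (hv a ha), neg_zero]
      have h2 := LieModule.traceForm_apply_lie_apply ℝ L L a v ⁅a, v⁆
      have h3 := LieModule.traceForm_apply_lie_apply ℝ L L v a ⁅a, v⁆
      rw [h1, map_zero] at h3
      rw [← lie_skew, map_neg, LinearMap.neg_apply] at h3
      exact (CompactSemisimple.neg _ hne).ne (neg_eq_zero.1 h3)
    have hmem (a : L) (ha : a ∈ W) : (1 : ℂ) ⊗ₜ[ℝ] a ∈ hW.complexify := by
      rw [mem_complexify]
      simp [ha]
    rw [mem_complexify]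
    refine ⟨key _ fun a ha => ?_, key _ fun a ha => ?_⟩
    · have := ((hW.mem_complexify).1 (hu _ (hmem a ha))).1
      rw [cre_lie] at this
      simpa using this
    · have := ((hW.mem_complexify).1 (hu _ (hmem a ha))).2
      rw [cim_lie] at this
      simpa using this

end Cartan

section Units

variable {L : Type*} [LieRing L] [LieAlgebra ℝ L] [FiniteDimensional ℝ L]

theorem single_mul_sub (i j k l : Fin 5) :
    Matrix.single i j (1 : ℂ) * Matrix.single k l 1 - Matrix.single k l 1 * Matrix.single i j 1 =
      (if j = k then Matrix.single i l 1 else 0) - (if l = i then Matrix.single k j 1 else 0) := by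
  congr 1
  · split_ifs with h
    · subst h; rw [Matrix.single_mul_single_same, mul_one]
    · rw [Matrix.single_mul_single_of_ne _ _ _ _ h]
  · split_ifs with h
    · subst h; rw [Matrix.single_mul_single_same, mul_one]
    · rw [Matrix.single_mul_single_of_ne _ _ _ _ h]

/-- Eight of the diagonal units are independent, because the bracket with a unit in the last column
isolates one coefficient. In dimension 8 they span. -/
theorem span_of_finrank_eq {H : Submodule ℂ (ℂ ⊗[ℝ] L)} {E : Fin 2 → Fin 5 → Fin 5 → ℂ ⊗[ℝ] L}
    (lie_same : ∀ s i j k l, ⁅E s i j, E s k l⁆ =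
      (if j = k then E s i l else 0) - (if l = i then E s k j else 0))
    (lie_diff : ∀ s t i j k l, s ≠ t → ⁅E s i j, E t k l⁆ = 0)
    (ne_zero : ∀ s i j, i ≠ j → E s i j ≠ 0) (mem : ∀ s i, E s i i ∈ H)
    (hH : finrank ℂ H = 8) (h : ℂ ⊗[ℝ] L) (hh : h ∈ H) :
    ∃ x : Fin 2 → Fin 5 → ℂ, h = ∑ s, ∑ i, x s i • E s i i := by
  -- The last diagonal unit of each block is left out; it receives coefficient 0 below.
  let b : Fin 2 × Fin 4 → H := fun p => ⟨E p.1 p.2.castSucc p.2.castSucc, mem _ _⟩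
  have hli : LinearIndependent ℂ b := by
    rw [Fintype.linearIndependent_iff]
    intro x hx p
    have h1 := congrArg (fun u : H => ⁅(u : ℂ ⊗[ℝ] L), E p.1 p.2.castSucc 4⁆) hx
    simp only [AddSubmonoidClass.coe_finsetSum, Submodule.coe_smul, ZeroMemClass.coe_zero] at h1
    rw [sum_lie] at h1
    simp only [csmul_lie, b] at h1
    rw [Finset.sum_eq_single p] at h1
    · have h4 : (4 : Fin 5) ≠ p.2.castSucc := (Fin.castSucc_lt_last p.2).ne'
      rw [lie_same, if_pos rfl, if_neg h4, sub_zero, zero_lie] at h1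
      exact (smul_eq_zero.1 h1).resolve_right (ne_zero _ _ _ h4.symm)
    · rintro ⟨s, i⟩ - hne
      by_cases hs : s = p.1
      · have hi : i.castSucc ≠ p.2.castSucc := fun h => hne
          (Prod.ext hs (Fin.castSucc_injective _ h))
        have h4 : (4 : Fin 5) ≠ i.castSucc := (Fin.castSucc_lt_last i).ne'
        rw [hs, lie_same, if_neg hi, if_neg h4, sub_zero, smul_zero]
      · rw [lie_diff _ _ _ _ _ _ hs, smul_zero]
    · intro hp
      exact absurd (Finset.mem_univ p) hp
  have hspan := hli.span_eq_top_of_card_eq_finrank' (by simp [hH])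
  have hmem : (⟨h, hh⟩ : H) ∈ Submodule.span ℂ (Set.range b) := by rw [hspan]; trivial
  obtain ⟨c, hc⟩ := (Submodule.mem_span_range_iff_exists_fun ℂ).1 hmem
  refine ⟨fun s i => if hi : i.1 < 4 then c (s, ⟨i, hi⟩) else 0, ?_⟩
  have h1 := congrArg Subtype.val hc
  simp only [AddSubmonoidClass.coe_finsetSum, Submodule.coe_smul, b] at h1
  rw [← h1, Fintype.sum_prod_type]
  refine Finset.sum_congr rfl fun s _ => ?_
  rw [Fin.sum_univ_castSucc (n := 4)]
  simp

/-- A subalgebra `su(5) ⊕ su(5)` of a compact Lie algebra of type `E₈` comes from matrix units. -/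
theorem exists_matrixUnits [CompactSemisimple L] (hL : IsTypeE8 (ℂ ⊗[ℝ] L)) (k : LieSubalgebra ℝ L)
    (hk : Nonempty (k ≃ₗ⁅ℝ⁆ (su 5 × su 5))) :
    ∃ (_ : IsKilling ℂ (ℂ ⊗[ℝ] L)) (H : LieSubalgebra ℂ (ℂ ⊗[ℝ] L)) (_ : H.IsCartanSubalgebra)
      (A : MatrixUnits H), HasE8Base H ∧ (∀ s i, conjC (A.E s i i) = -A.E s i i) ∧
        A.subK = Submodule.span ℂ ((fun z : L => (1 : ℂ) ⊗ₜ[ℝ] z) '' k) := by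
  obtain ⟨φ⟩ := hk
  obtain ⟨hKill, hH⟩ := hL
  let ι : su 5 × su 5 →ₗ[ℝ] L := k.toSubmodule.subtype ∘ₗ φ.symm.toLinearEquiv.toLinearMap
  have hι : Function.Injective ι := Subtype.val_injective.comp φ.symm.injective
  have hιlie (x y) : ι ⁅x, y⁆ = ⁅ι x, ι y⁆ := congrArg Subtype.val (φ.symm.map_lie x y)
  have hιmem (x) : ι x ∈ k := (φ.symm x).2
  let j : Fin 2 → su 5 →ₗ[ℝ] L := ![ι ∘ₗ LinearMap.inl ℝ _ _, ι ∘ₗ LinearMap.inr ℝ _ _]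
  have hjinj (s) : Function.Injective (j s) := by
    fin_cases s
    · exact hι.comp LinearMap.inl_injective
    · exact hι.comp LinearMap.inr_injective
  have hjlie (s) (x y : su 5) : j s ⁅x, y⁆ = ⁅j s x, j s y⁆ := by
    fin_cases s
    · refine Eq.trans (congrArg ι ?_) (hιlie (x, 0) (y, 0))
      exact Prod.ext rfl (lie_self (0 : su 5)).symm
    · refine Eq.trans (congrArg ι ?_) (hιlie (0, x) (0, y))
      exact Prod.ext (lie_self (0 : su 5)).symm rfl
  have hjdiff (s t) (hst : s ≠ t) (x y : su 5) : ⁅j s x, j t y⁆ = 0 := by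
    have h0 (x y : su 5) : ⁅ι (x, 0), ι (0, y)⁆ = 0 := by
      rw [← hιlie]
      refine Eq.trans (congrArg ι ?_) (map_zero ι)
      exact Prod.ext (lie_zero x) (zero_lie y)
    fin_cases s <;> fin_cases t
    · exact absurd rfl hst
    · exact h0 x y
    · rw [← lie_skew]
      exact neg_eq_zero.2 (h0 y x)
    · exact absurd rfl hst
  let E : Fin 2 → Fin 5 → Fin 5 → ℂ ⊗[ℝ] L := fun s a b => extendSu (j s) (Matrix.single a b 1)
  have hE_sum (s) (X : Matrix (Fin 5) (Fin 5) ℂ) :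
      extendSu (j s) X = ∑ a, ∑ b, X a b • E s a b := by
    conv_lhs => rw [Matrix.matrix_eq_sum_single X]
    simp only [extendSu_sum]
    refine Finset.sum_congr rfl fun a _ => Finset.sum_congr rfl fun b _ => ?_
    rw [← extendSu_smul, Matrix.smul_single, smul_eq_mul, mul_one]
  have lie_same : ∀ s a b c d, ⁅E s a b, E s c d⁆ =
      (if b = c then E s a d else 0) - (if d = a then E s c b else 0) := by
    intro s a b c d
    rw [extendSu_lie _ (hjlie s), single_mul_sub, extendSu_sub]
    congr 1 <;> split_ifs <;> first | rfl | exact extendSu_zero _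
  have lie_diff : ∀ s t a b c d, s ≠ t → ⁅E s a b, E t c d⁆ = 0 := fun s t a b c d hst =>
    extendSu_lie_eq_zero _ (hjdiff s t hst) _ _
  have ne_zero : ∀ s a b, a ≠ b → E s a b ≠ 0 := fun s a b hab =>
    extendSu_single_ne_zero _ (hjinj s) hab
  have sum_diag : ∀ s, ∑ a, E s a a = 0 := by
    intro s
    rw [← extendSu_sum, ← extendSu_one (j s)]
    congr 1
    ext a b
    rw [Matrix.sum_apply, Matrix.one_apply]
    simp only [Matrix.single_apply]
    by_cases h : a = b
    · subst h; simp
    · rw [if_neg h]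
      exact Finset.sum_eq_zero fun c _ => if_neg fun hc => h (hc.1.symm.trans hc.2)
  have hconj : ∀ s a, conjC (E s a a) = -E s a a := fun s a =>
    extendSu_of_isHermitian _ (by simp [Matrix.conjTranspose_single])
  have hcre (s a) : cre (E s a a) = 0 := by
    have := congrArg cre (hconj s a)
    rw [cre_conjC, map_neg] at this
    have h2 : (2 : ℝ) • cre (E s a a) = 0 := by
      rw [two_smul]
      nth_rewrite 1 [this]
      exact neg_add_cancel _
    exact (smul_eq_zero.1 h2).resolve_left two_ne_zero
  have hcomm (s a t b) : ⁅cim (E s a a), cim (E t b b)⁆ = 0 := by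
    have h1 : ⁅E s a a, E t b b⁆ = 0 := by
      by_cases hst : s = t
      · subst hst
        rw [lie_same]
        by_cases hab : a = b
        · subst hab; simp
        · rw [if_neg hab, if_neg (Ne.symm hab), sub_zero]
      · exact lie_diff _ _ _ _ _ _ hst
    have h2 := congrArg cre h1
    rw [cre_lie, hcre, zero_lie, zero_sub, map_zero, neg_eq_zero] at h2
    exact h2
  -- The imaginary parts of the diagonal units commute. A maximal abelian subspace containing them
  -- complexifies to a Cartan subalgebra, of dimension 8 by the type of `L`, so the diagonal units
  -- exhaust it.
  obtain ⟨W, hTW, hW⟩ := (isAbelianSubspace_span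
    (s := Set.range fun p : Fin 2 × Fin 5 => cim (E p.1 p.2 p.2)) (by
      rintro _ ⟨p, rfl⟩ _ ⟨q, rfl⟩
      exact hcomm _ _ _ _)).exists_le
  have hcart := hW.isCartanSubalgebra
  have hbase : HasE8Base hW.complexify := hH hW.complexify
  have mem : ∀ s a, E s a a ∈ hW.complexify := fun s a => by
    rw [hW.mem_complexify, hcre]
    exact ⟨W.zero_mem, hTW (Submodule.subset_span ⟨(s, a), rfl⟩)⟩
  let A : MatrixUnits hW.complexify :=
    { E := E
      lie_same := lie_same
      lie_diff := lie_diff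
      sum_diag := sum_diag
      ne_zero := ne_zero
      mem := mem
      span := span_of_finrank_eq (H := hW.complexify.toSubmodule) lie_same lie_diff ne_zero mem
        hbase.finrank }
  refine ⟨hKill, hW.complexify, hcart, A, hbase, hconj, le_antisymm ?_ ?_⟩
  · have hmem (s X) : extendSu (j s) X ∈
        Submodule.span ℂ ((fun z : L => (1 : ℂ) ⊗ₜ[ℝ] z) '' k) := by
      have hjk (x) : j s x ∈ k := by fin_cases s <;> exact hιmem _
      exact Submodule.add_mem _ (Submodule.subset_span ⟨_, hjk _, rfl⟩)
        (Submodule.smul_mem _ _ (Submodule.subset_span ⟨_, hjk _, rfl⟩))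
    refine Submodule.span_le.2 ?_
    rintro _ ⟨p, rfl⟩
    exact hmem _ _
  · refine Submodule.span_le.2 ?_
    rintro _ ⟨z, hz, rfl⟩
    have h1 : z = j 0 (φ ⟨z, hz⟩).1 + j 1 (φ ⟨z, hz⟩).2 := by
      change z = ι ((φ ⟨z, hz⟩).1, 0) + ι (0, (φ ⟨z, hz⟩).2)
      rw [← map_add, Prod.mk_add_mk, add_zero, zero_add]
      exact (congrArg Subtype.val (φ.symm_apply_apply ⟨z, hz⟩)).symm
    have h2 (s) (x : su 5) : (1 : ℂ) ⊗ₜ[ℝ] j s x ∈ A.subK := by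
      rw [← extendSu_coe, hE_sum]
      exact Submodule.sum_mem _ fun a _ => Submodule.sum_mem _ fun b _ =>
        Submodule.smul_mem _ _ (A.E_mem_subK s a b)
    change (1 : ℂ) ⊗ₜ[ℝ] z ∈ A.subK
    rw [h1, TensorProduct.tmul_add]
    exact Submodule.add_mem _ (h2 0 _) (h2 1 _)

end Units

end

/-! ### One-parameter subgroups exp(t ad Z) -/

section

open Module

section Exponential

attribute [local instance] LieRing.ofAssociativeRing

/-- The exponential of a derivation preserves the bilinear product. The derivative at 0 is what
later passes from invariance under K to invariance under its Lie algebra. -/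
theorem exists_exp_of_normed {E : Type*} [NormedAddCommGroup E] [NormedSpace ℝ E]
    [FiniteDimensional ℝ E] (b : E →ₗ[ℝ] E →ₗ[ℝ] E) (D : E →ₗ[ℝ] E)
    (hD : ∀ x y, D (b x y) = b (D x) y + b x (D y)) :
    ∃ Φ : ℝ → (E ≃ₗ[ℝ] E), (∀ t x y, Φ t (b x y) = b (Φ t x) (Φ t y)) ∧
      (∀ t (f : Dual ℝ E) x,
        HasSum (fun n : ℕ => (n.factorial : ℝ)⁻¹ * f (((t • D : E →ₗ[ℝ] E))^[n] x)) (f (Φ t x))) ∧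
      ∀ (f : Dual ℝ E) x, HasDerivAt (fun t => f (Φ t x)) (f (D x)) 0 := by
  have hcomp : CompleteSpace E := FiniteDimensional.complete ℝ E
  let _ : NormedAlgebra ℚ (E →L[ℝ] E) := NormedAlgebra.restrictScalars ℚ ℝ _
  let Dc : E →L[ℝ] E := LinearMap.toContinuousLinearMap D
  let bc : E →L[ℝ] E →L[ℝ] E := LinearMap.toContinuousLinearMap
    ((LinearMap.toContinuousLinearMap : (E →ₗ[ℝ] E) ≃ₗ[ℝ] (E →L[ℝ] E)).toLinearMap ∘ₗ b)
  let e : ℝ → (E →L[ℝ] E) := fun t => NormedSpace.exp (t • Dc)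
  have he (t : ℝ) : HasDerivAt e (Dc * e t) t := hasDerivAt_exp_smul_const' Dc t
  have hinv (t : ℝ) : e t * e (-t) = 1 := by
    change NormedSpace.exp (t • Dc) * NormedSpace.exp ((-t) • Dc) = 1
    rw [← NormedSpace.exp_add_of_commute, ← add_smul, add_neg_cancel, zero_smul,
      NormedSpace.exp_zero]
    exact ((Commute.refl Dc).smul_left t).smul_right (-t)
  have hinv' (t : ℝ) : e (-t) * e t = 1 := by simpa using hinv (-t)
  have hex (x : E) (t : ℝ) : HasDerivAt (fun t => e t x) (Dc (e t x)) t := by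
    simpa using (he t).clm_apply (hasDerivAt_const t x)
  refine ⟨fun t => LinearEquiv.ofLinearMap (e t).toLinearMap (e (-t)).toLinearMap
    (by ext x; exact congrArg (fun T : E →L[ℝ] E => T x) (hinv t))
    (by ext x; exact congrArg (fun T : E →L[ℝ] E => T x) (hinv' t)), ?_, ?_, ?_⟩
  · intro t x y
    change e t (bc x y) = bc (e t x) (e t y)
    have hcomm (s : ℝ) (u : E) : e s (Dc u) = Dc (e s u) := by
      have h : Commute (e s) Dc := ((Commute.refl Dc).smul_left s).exp_left
      exact congrArg (fun T : E →L[ℝ] E => T u) h.eq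
    -- Undoing the flow on the product of two flowed vectors gives a curve whose derivative cancels
    -- by the Leibniz rule; the curve is therefore equal to its value at time 0.
    have hder (s : ℝ) : HasDerivAt (fun s => e (-s) (bc (e s x) (e s y))) 0 s := by
      have h1 : HasDerivAt (fun s => e (-s)) (-(Dc * e (-s))) s := by
        have := (he (-s)).scomp s (hasDerivAt_neg s)
        rwa [neg_one_smul] at this
      have h2 : HasDerivAt (fun s => bc (e s x)) (bc (Dc (e s x))) s :=
        bc.hasFDerivAt.comp_hasDerivAt s (hex x s)
      have h3 := h1.clm_apply (h2.clm_apply (hex y s))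
      convert h3 using 1
      have h4 : Dc (bc (e s x) (e s y)) = bc (Dc (e s x)) (e s y) + bc (e s x) (Dc (e s y)) :=
        hD _ _
      rw [← h4, hcomm]
      simp
    have hconst := is_const_of_deriv_eq_zero (fun s => (hder s).differentiableAt)
      (fun s => (hder s).deriv) t 0
    have h0 : e 0 = 1 := by
      change NormedSpace.exp ((0 : ℝ) • Dc) = 1
      rw [zero_smul, NormedSpace.exp_zero]
    simp only [neg_zero, h0, one_apply_eq_self] at hconst
    rw [← hconst]
    exact congrArg (fun T : E →L[ℝ] E => T _) (hinv t)
  · intro t f x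
    change HasSum _ (f (e t x))
    have h1 := NormedSpace.exp_series_hasSum_exp' (𝕂 := ℝ) (t • Dc)
    have h2 := h1.mapL ((LinearMap.toContinuousLinearMap f).comp
      (ContinuousLinearMap.apply ℝ E x))
    have hpow (n : ℕ) : ((t • Dc) ^ n) x = (t • D : E →ₗ[ℝ] E)^[n] x := by
      induction n with
      | zero => rfl
      | succ n ih =>
        rw [pow_succ', Function.iterate_succ_apply', ← ih]
        rfl
    simpa [hpow] using h2
  · intro f x
    change HasDerivAt (fun t => f (e t x)) _ _
    have h1 := (LinearMap.toContinuousLinearMap f).hasFDerivAt.comp_hasDerivAt 0 (hex x 0)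
    have h0 : e 0 = 1 := by
      change NormedSpace.exp ((0 : ℝ) • Dc) = 1
      rw [zero_smul, NormedSpace.exp_zero]
    rw [h0] at h1
    exact h1

theorem exists_exp {E : Type*} [AddCommGroup E] [Module ℝ E]
    [FiniteDimensional ℝ E] (b : E →ₗ[ℝ] E →ₗ[ℝ] E) (D : E →ₗ[ℝ] E)
    (hD : ∀ x y, D (b x y) = b (D x) y + b x (D y)) :
    ∃ Φ : ℝ → (E ≃ₗ[ℝ] E), (∀ t x y, Φ t (b x y) = b (Φ t x) (Φ t y)) ∧
      (∀ t (f : Dual ℝ E) x,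
        HasSum (fun n : ℕ => (n.factorial : ℝ)⁻¹ * f ((t • D : E →ₗ[ℝ] E)^[n] x)) (f (Φ t x))) ∧
      ∀ (f : Dual ℝ E) x, HasDerivAt (fun t => f (Φ t x)) (f (D x)) 0 := by
  let e : E ≃ₗ[ℝ] (Fin (finrank ℝ E) → ℝ) := (finBasis ℝ E).equivFun
  -- The conclusion mentions no topology on `E`, so any auxiliary norm will do; here it comes from
  -- coordinates.
  let _ : NormedAddCommGroup E := NormedAddCommGroup.induced E (Fin (finrank ℝ E) → ℝ) e e.injective
  let _ : NormedSpace ℝ E := NormedSpace.induced ℝ E (Fin (finrank ℝ E) → ℝ) e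
  exact exists_exp_of_normed b D hD

variable {L : Type*} [LieRing L] [LieAlgebra ℝ L] [FiniteDimensional ℝ L]

/-- The one-parameter subgroups of the connected subgroup with Lie algebra `k`. -/
theorem exists_groupK_curve {k : LieSubalgebra ℝ L} {Z : L} (hZ : Z ∈ k) :
    ∃ Φ : ℝ → groupK k, ∀ (f : Dual ℝ L) x, HasDerivAt (fun t => f ((Φ t).1.1 x)) (f ⁅Z, x⁆) 0 := by
  obtain ⟨Φ, h1, h2, h3⟩ := exists_exp (LieModule.toEnd ℝ L L : L →ₗ[ℝ] End ℝ L) (LieAlgebra.ad ℝ L Z)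
    (fun x y => leibniz_lie Z x y)
  refine ⟨fun t => ⟨⟨Φ t, h1 t⟩, Subgroup.subset_closure ⟨t • Z, k.smul_mem t hZ, ?_⟩⟩, h3⟩
  intro f x
  rw [map_smul]
  exact h2 t f x

/-- A functional vanishing on `W` kills every term of the exponential series, so generators of K map
`W` into itself, and onto it by dimension. -/
theorem groupK_map_mem_of_lie_mem {k : LieSubalgebra ℝ L} {W : Submodule ℝ L}
    (hW : ∀ z ∈ k, ∀ x ∈ W, ⁅z, x⁆ ∈ W) {φ : autGroup L} (hφ : φ ∈ groupK k) :
    ∀ x, φ.1 x ∈ W ↔ x ∈ W := by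
  induction hφ using Subgroup.closure_induction with
  | mem φ h =>
    obtain ⟨Z, hZ, h⟩ := h
    have hmem : ∀ x ∈ W, φ.1 x ∈ W := by
      intro x hx
      by_contra hn
      obtain ⟨f, hf, hfk⟩ := Submodule.exists_le_ker_of_notMem hn
      have hpow : ∀ n : ℕ, (LieAlgebra.ad ℝ L Z)^[n] x ∈ W := by
        intro n
        induction n with
        | zero => exact hx
        | succ n ih =>
          rw [Function.iterate_succ_apply']
          exact hW Z hZ _ ih
      have h0 : (fun n : ℕ => (n.factorial : ℝ)⁻¹ * f ((LieAlgebra.ad ℝ L Z)^[n] x)) =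
          fun _ => 0 := by
        funext n
        rw [show f ((LieAlgebra.ad ℝ L Z)^[n] x) = 0 from hfk (hpow n), mul_zero]
      have h1 := h f x
      rw [h0] at h1
      exact hf (h1.unique hasSum_zero)
    have heq : W.map φ.1.toLinearMap = W := by
      refine Submodule.eq_of_le_of_finrank_eq ?_ (LinearEquiv.finrank_map_eq φ.1 _)
      rintro _ ⟨x, hx, rfl⟩
      exact hmem x hx
    intro x
    refine ⟨fun hx => ?_, hmem x⟩
    have : φ.1 x ∈ W.map φ.1.toLinearMap := by rw [heq]; exact hx
    obtain ⟨y, hy, hyx⟩ := this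
    rwa [← φ.1.injective hyx]
  | one => intro x; exact Iff.rfl
  | mul a b _ _ ha hb => intro x; exact (ha (b.1 x)).trans (hb x)
  | inv a _ ha =>
    intro x
    rw [← ha (a⁻¹.1 x)]
    exact iff_of_eq (congrArg (· ∈ W) (a.1.apply_symm_apply x))

end Exponential

end

/-! ### Orthonormal bases and the operators ad on 𝔭 -/

section

open Module

section OrthonormalBasis

variable {V : Type*} [AddCommGroup V] [Module ℝ V]

theorem InnerProd.ext_form (g : InnerProd V) {x y : V} (h : ∀ z, g.form x z = g.form y z) :
    x = y := by
  by_contra hne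
  have h1 := g.pos (x - y) (sub_ne_zero.2 hne)
  simp [h] at h1

variable {ι : Type*} [Fintype ι] [DecidableEq ι]

theorem InnerProd.sum_form_smul (g : InnerProd V) (b : Basis ι ℝ V)
    (hb : ∀ i j, g.form (b i) (b j) = if i = j then 1 else 0) (x : V) :
    ∑ i, g.form x (b i) • b i = x := by
  have h (i : ι) : g.form x (b i) = b.repr x i := by
    conv_lhs => rw [← b.sum_repr x]
    simp only [map_sum, map_smul, LinearMap.sum_apply, LinearMap.smul_apply, hb]
    simp
  simp only [h, b.sum_repr]

theorem InnerProd.sum_form_mul_form (g : InnerProd V) (b : Basis ι ℝ V)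
    (hb : ∀ i j, g.form (b i) (b j) = if i = j then 1 else 0) (x y : V) :
    ∑ i, g.form x (b i) * g.form (b i) y = g.form x y := by
  conv_rhs => rw [← g.sum_form_smul b hb x]
  simp

theorem InnerProd.sum_form_apply_eq_trace (g : InnerProd V) (b : Basis ι ℝ V)
    (hb : ∀ i j, g.form (b i) (b j) = if i = j then 1 else 0) (T : End ℝ V) :
    ∑ i, g.form (T (b i)) (b i) = LinearMap.trace ℝ V T := by
  rw [LinearMap.trace_eq_matrix_trace ℝ b, Matrix.trace]
  refine Finset.sum_congr rfl fun i _ => ?_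
  rw [Matrix.diag_apply, LinearMap.toMatrix_apply]
  conv_lhs => rw [← b.sum_repr (T (b i))]
  simp only [map_sum, map_smul, LinearMap.sum_apply, LinearMap.smul_apply, hb]
  simp

theorem InnerProd.sum_basis [FiniteDimensional ℝ V] (g : InnerProd V) (T : End ℝ V) :
    ∑ i, g.form (T (g.basis i)) (g.basis i) = LinearMap.trace ℝ V T :=
  g.sum_form_apply_eq_trace g.basis g.basis_orthonormal T

/-- A bilinear form is represented by an operator with respect to an inner product. -/
theorem InnerProd.exists_operator [FiniteDimensional ℝ V] (g : InnerProd V)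
    (φ : LinearMap.BilinForm ℝ V) : ∃ T : End ℝ V, ∀ x y, g.form (T x) y = φ x y := by
  refine ⟨∑ i, (φ.flip (g.basis i)).smulRight (g.basis i), fun x y => ?_⟩
  conv_rhs => rw [← g.sum_form_smul g.basis g.basis_orthonormal y]
  simp [g.symm y, mul_comm]

/-- The trace of a bilinear form over a subspace, computed in an orthonormal basis. -/
theorem InnerProd.sum_restrict_basis [FiniteDimensional ℝ V] (g : InnerProd V)
    {W : Submodule ℝ V} {P : End ℝ V} (hP : ∀ x, P x ∈ W) (hPW : ∀ x ∈ W, P x = x)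
    (hsymm : ∀ x y, g.form (P x) y = g.form x (P y)) (φ : LinearMap.BilinForm ℝ V) :
    ∑ a, φ ((g.restrict W).basis a : V) ((g.restrict W).basis a : V) =
      ∑ i, φ (P (g.basis i)) (P (g.basis i)) := by
  set e := (g.restrict W).basis with he
  have h1 (x : V) : P x = ∑ a, g.form x (e a : V) • (e a : V) := by
    have h := (g.restrict W).sum_form_smul e (g.restrict W).basis_orthonormal ⟨P x, hP x⟩
    have h2 := congrArg Subtype.val h
    rw [AddSubmonoidClass.coe_finsetSum] at h2
    refine h2.symm.trans ?_
    refine Finset.sum_congr rfl fun a _ => ?_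
    change g.form (P x) (e a : V) • (e a : V) = _
    rw [hsymm, hPW _ (e a).2]
  have h2 (a b) : ∑ i, g.form (g.basis i) (e a : V) * g.form (g.basis i) (e b : V) =
      if a = b then 1 else 0 := by
    rw [← (g.restrict W).basis_orthonormal a b]
    change _ = g.form (e a : V) (e b : V)
    rw [← g.sum_form_mul_form g.basis g.basis_orthonormal]
    exact Finset.sum_congr rfl fun i _ => by rw [g.symm (g.basis i) (e a : V)]
  symm
  calc ∑ i, φ (P (g.basis i)) (P (g.basis i))
      = ∑ i, ∑ a, ∑ b, g.form (g.basis i) (e a : V) * g.form (g.basis i) (e b : V) *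
          φ (e a : V) (e b : V) := by
        refine Finset.sum_congr rfl fun i _ => ?_
        rw [h1]
        simp only [map_sum, map_smul, LinearMap.sum_apply, LinearMap.smul_apply, smul_eq_mul,
          Finset.mul_sum, mul_assoc]
        rw [Finset.sum_comm]
        exact Finset.sum_congr rfl fun a _ => Finset.sum_congr rfl fun b _ => by ring
    _ = ∑ a, ∑ b, ∑ i, g.form (g.basis i) (e a : V) * g.form (g.basis i) (e b : V) *
          φ (e a : V) (e b : V) := by
        rw [Finset.sum_comm]
        exact Finset.sum_congr rfl fun a _ => Finset.sum_comm
    _ = _ := by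
        simp only [← Finset.sum_mul, h2]
        simp

end OrthonormalBasis

section Projection

variable {L : Type*} [LieRing L] [LieAlgebra ℝ L] [FiniteDimensional ℝ L] [CompactSemisimple L]
  {k : LieSubalgebra ℝ L}

theorem projP_coe (x : tangent k) : projP k (x : L) = x :=
  Submodule.projectionOnto_apply_left _ x

theorem projP_of_mem {z : L} (hz : z ∈ k) : projP k z = 0 :=
  (Submodule.projectionOnto_apply_eq_zero_iff _).2 hz

theorem sub_projP_mem (u : L) : u - (projP k u : L) ∈ k := by
  have h : projP k (u - (projP k u : L)) = 0 := by rw [map_sub, projP_coe, sub_self]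
  exact (Submodule.projectionOnto_apply_eq_zero_iff (isCompl_tangent k).symm).1 h

theorem form_standardMetric (x y : tangent k) :
    (standardMetric k).form x y = -killingForm ℝ L (x : L) (y : L) := rfl

theorem killingForm_comm' (x y : L) : killingForm ℝ L x y = killingForm ℝ L y x :=
  LieModule.traceForm_comm ℝ L L x y

theorem form_projP_left (u : L) (y : tangent k) :
    (standardMetric k).form (projP k u) y = -killingForm ℝ L u (y : L) := by
  have h := y.2 _ (sub_projP_mem (k := k) u)
  change killingForm ℝ L (u - (projP k u : L)) (y : L) = 0 at h
  rw [map_sub, LinearMap.sub_apply, sub_eq_zero] at h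
  rw [form_standardMetric, h]

theorem lie_mem_tangent {z x : L} (hz : z ∈ k) (hx : x ∈ tangent k) : ⁅z, x⁆ ∈ tangent k := by
  intro w hw
  have h := hx _ (k.lie_mem hw hz)
  change killingForm ℝ L ⁅w, z⁆ x = 0 at h
  rwa [LieModule.traceForm_apply_lie_apply] at h

/-- The operator `x ↦ [u, x]_p` on `p`. -/
def adP (k : LieSubalgebra ℝ L) : L →ₗ[ℝ] End ℝ (tangent k) where
  toFun u := projP k ∘ₗ LieAlgebra.ad ℝ L u ∘ₗ (tangent k).subtype
  map_add' u v := by ext x; simp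
  map_smul' c u := by ext x; simp

theorem adP_apply (u : L) (x : tangent k) : adP k u x = projP k ⁅u, (x : L)⁆ := rfl

theorem bracketP_eq (x y : tangent k) : bracketP x y = adP k (x : L) y := rfl

theorem coe_adP {z : L} (hz : z ∈ k) (x : tangent k) : (adP k z x : L) = ⁅z, (x : L)⁆ := by
  have h := projP_coe (k := k) ⟨_, lie_mem_tangent hz x.2⟩
  exact congrArg Subtype.val h

theorem adP_skew (x y : tangent k) : adP k (x : L) y = -adP k (y : L) x := by
  rw [adP_apply, adP_apply, ← map_neg, lie_skew]

theorem form_adP (u : L) (x y : tangent k) :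
    (standardMetric k).form (adP k u x) y = -(standardMetric k).form x (adP k u y) := by
  rw [(standardMetric k).symm x, adP_apply, adP_apply, form_projP_left, form_projP_left, neg_neg,
    killingForm_comm' ⁅u, (y : L)⁆]
  have h := LieModule.traceForm_apply_lie_apply ℝ L L (x : L) u (y : L)
  rw [← lie_skew, map_neg, LinearMap.neg_apply] at h
  exact h

/-- The 𝔨-component of [u, x] is lost under projection, but its bracket with z stays in 𝔨 and would
be projected away anyway. This fails for general z. -/
theorem adP_lie {z : L} (hz : z ∈ k) (u : L) : adP k ⁅z, u⁆ = adP k z * adP k u - adP k u * adP k z := by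
  ext x : 1
  have h1 : adP k z (adP k u x) = projP k ⁅z, ⁅u, (x : L)⁆⁆ := by
    have h2 : projP k ⁅z, ⁅u, (x : L)⁆ - (projP k ⁅u, (x : L)⁆ : L)⁆ = 0 :=
      projP_of_mem (k.lie_mem hz (sub_projP_mem ⁅u, (x : L)⁆))
    rw [lie_sub, map_sub, sub_eq_zero] at h2
    exact h2.symm
  rw [LinearMap.sub_apply, Module.End.mul_apply, Module.End.mul_apply, h1, adP_apply, adP_apply,
    coe_adP hz, ← map_sub, lie_lie]

/-- The projection onto `k`. -/
def projK (k : LieSubalgebra ℝ L) : End ℝ L := LinearMap.id - (tangent k).subtype ∘ₗ projP k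

theorem projK_apply (u : L) : projK k u = u - (projP k u : L) := rfl

theorem trace_tangent (f : tangent k →ₗ[ℝ] L) :
    LinearMap.trace ℝ (tangent k) (projP k ∘ₗ f) = LinearMap.trace ℝ L (f ∘ₗ projP k) :=
  LinearMap.trace_comp_comm' f (projP k)

/-- A symmetric operator times a skew one has trace zero. -/
theorem trace_adP (D : End ℝ (tangent k)) (hD : ∀ x y, (standardMetric k).form (D x) y =
    (standardMetric k).form x (D y)) (u : L) : LinearMap.trace ℝ _ (D * adP k u) = 0 := by
  have h := (standardMetric k).sum_basis (D * adP k u)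
  have h' := (standardMetric k).sum_basis (adP k u * D)
  rw [LinearMap.trace_mul_comm] at h'
  have h2 : ∑ i, (standardMetric k).form ((D * adP k u) ((standardMetric k).basis i))
      ((standardMetric k).basis i) = -∑ i, (standardMetric k).form
        ((adP k u * D) ((standardMetric k).basis i)) ((standardMetric k).basis i) := by
    rw [← Finset.sum_neg_distrib]
    refine Finset.sum_congr rfl fun i _ => ?_
    rw [Module.End.mul_apply, Module.End.mul_apply, hD, (standardMetric k).symm,
      form_adP u (D _), neg_neg]
  rw [h, h'] at h2
  linarith

end Projection

end

/-! ### Isotropy splittings and trace forms -/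

section

open Module

variable {L : Type*} [LieRing L] [LieAlgebra ℝ L] [FiniteDimensional ℝ L] [CompactSemisimple L]
  {k : LieSubalgebra ℝ L}

/-- The projections onto two summands of the isotropy representation, with the properties of the
space `E₈ / SU(5) × SU(5)` on which its curvature depends. -/
structure IsotropySplitting (k : LieSubalgebra ℝ L) where
  P : End ℝ (tangent k)
  Q : End ℝ (tangent k)
  add : ∀ x, P x + Q x = x
  PQ : ∀ x, P (Q x) = 0
  QP : ∀ x, Q (P x) = 0
  symm : ∀ x y, (standardMetric k).form (P x) y = (standardMetric k).form x (P y)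
  comm : ∀ z ∈ k, ∀ x, P (adP k z x) = adP k z (P x)
  bracket_P : ∀ x y z, (standardMetric k).form (bracketP (P x) (P y)) (P z) = 0
  bracket_Q : ∀ x y z, (standardMetric k).form (bracketP (Q x) (Q y)) (Q z) = 0
  casimir : ∀ y z : tangent k, LinearMap.trace ℝ L
    (LieAlgebra.ad ℝ L (y : L) ∘ₗ LieAlgebra.ad ℝ L (z : L) ∘ₗ projK k) =
      1 / 5 * killingForm ℝ L (y : L) (z : L)
  schur : ∀ T : End ℝ (tangent k),
    (∀ x y, (standardMetric k).form (T x) y = (standardMetric k).form x (T y)) →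
    (∀ z ∈ k, ∀ x, T (adP k z x) = adP k z (T x)) → ∃ a b : ℝ, ∀ x, T x = a • P x + b • Q x
  trace_P : LinearMap.trace ℝ _ P = 100
  trace_Q : LinearMap.trace ℝ _ Q = 100

namespace IsotropySplitting

variable (S : IsotropySplitting k)

theorem PP (x : tangent k) : S.P (S.P x) = S.P x := by
  conv_rhs => rw [← S.add x, map_add, S.PQ, add_zero]

theorem QQ (x : tangent k) : S.Q (S.Q x) = S.Q x := by
  conv_rhs => rw [← S.add x, map_add, S.QP, zero_add]

theorem Q_apply (x : tangent k) : S.Q x = x - S.P x := eq_sub_of_add_eq' (S.add x)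

theorem symm_Q (x y : tangent k) :
    (standardMetric k).form (S.Q x) y = (standardMetric k).form x (S.Q y) := by
  rw [S.Q_apply, S.Q_apply, map_sub, map_sub, LinearMap.sub_apply, S.symm]

theorem comm_Q {z : L} (hz : z ∈ k) (x : tangent k) : S.Q (adP k z x) = adP k z (S.Q x) := by
  rw [S.Q_apply, S.Q_apply, map_sub, S.comm z hz]

/-- Exchange of the two summands. -/
def swap : IsotropySplitting k where
  P := S.Q
  Q := S.P
  add x := by rw [add_comm, S.add]
  PQ := S.QP
  QP := S.PQ
  symm := S.symm_Q
  comm _ hz := S.comm_Q hz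
  bracket_P := S.bracket_Q
  bracket_Q := S.bracket_P
  casimir := S.casimir
  schur T h h' := by
    obtain ⟨a, b, h⟩ := S.schur T h h'
    exact ⟨b, a, fun x => by rw [h, add_comm]⟩
  trace_P := S.trace_Q
  trace_Q := S.trace_P

theorem exists_P_ne_zero : ∃ x, S.P x ≠ 0 := by
  by_contra! h
  have h0 : S.P = 0 := LinearMap.ext h
  have := S.trace_P
  rw [h0, map_zero] at this
  norm_num at this

theorem form_P_Q (x y : tangent k) : (standardMetric k).form (S.P x) (S.Q y) = 0 := by
  rw [S.symm, S.PQ, map_zero]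

theorem form_Q_P (x y : tangent k) : (standardMetric k).form (S.Q x) (S.P y) = 0 :=
  S.swap.form_P_Q x y

/-- Schur's lemma for invariant symmetric forms. -/
theorem schur_form (φ : LinearMap.BilinForm ℝ (tangent k)) (hφ : ∀ x y, φ x y = φ y x)
    (h : ∀ z ∈ k, ∀ x y, φ (adP k z x) y = -φ x (adP k z y)) : ∃ a b : ℝ, ∀ x y,
      φ x y = a * (standardMetric k).form (S.P x) y + b * (standardMetric k).form (S.Q x) y := by
  obtain ⟨T, hT⟩ := (standardMetric k).exists_operator φ
  obtain ⟨a, b, hab⟩ := S.schur T (fun x y => by rw [hT, hφ, ← hT, (standardMetric k).symm])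
    (fun z hz x => (standardMetric k).ext_form fun y => by
      rw [hT, h z hz, form_adP, hT])
  refine ⟨a, b, fun x y => ?_⟩
  rw [← hT, hab]
  simp

end IsotropySplitting

/-- The form `tr (D ad(u) D' ad(v))` on `p`. -/
def traceForm₂ (D D' : End ℝ (tangent k)) : LinearMap.BilinForm ℝ (tangent k) :=
  LinearMap.mk₂ ℝ (fun u v => LinearMap.trace ℝ _ (D * adP k (u : L) * D' * adP k (v : L)))
    (fun u u' v => by simp [mul_add, add_mul]) (fun c u v => by simp)
    (fun u v v' => by simp [mul_add]) (fun c u v => by simp)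

theorem traceForm₂_apply (D D' : End ℝ (tangent k)) (u v : tangent k) :
    traceForm₂ D D' u v = LinearMap.trace ℝ _ (D * adP k (u : L) * D' * adP k (v : L)) := rfl

theorem traceForm₂_comm (D D' : End ℝ (tangent k)) (u v : tangent k) :
    traceForm₂ D D' u v = traceForm₂ D' D v u := by
  rw [traceForm₂_apply, traceForm₂_apply, mul_assoc, LinearMap.trace_mul_comm, ← mul_assoc]

theorem trace_eq_of_adjoint {S T : End ℝ (tangent k)}
    (h : ∀ x y, (standardMetric k).form (S x) y = (standardMetric k).form x (T y)) :
    LinearMap.trace ℝ _ S = LinearMap.trace ℝ _ T := by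
  rw [← (standardMetric k).sum_basis, ← (standardMetric k).sum_basis]
  exact Finset.sum_congr rfl fun i _ => by rw [h, (standardMetric k).symm]

/-- Passing to the adjoint reverses the product; the two signs from the skew factors cancel. -/
theorem traceForm₂_symm {D D' : End ℝ (tangent k)}
    (hD : ∀ x y, (standardMetric k).form (D x) y = (standardMetric k).form x (D y))
    (hD' : ∀ x y, (standardMetric k).form (D' x) y = (standardMetric k).form x (D' y))
    (u v : tangent k) : traceForm₂ D D' u v = traceForm₂ D D' v u := by
  rw [traceForm₂_apply, trace_eq_of_adjoint (T := adP k (v : L) * D' * adP k (u : L) * D),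
    LinearMap.trace_mul_comm, traceForm₂_apply, mul_assoc, mul_assoc, mul_assoc]
  · intro x y
    simp only [Module.End.mul_apply, hD, form_adP, hD', neg_neg, map_neg]

/-- The two traces together form the trace of a commutator with ad z, because z commutes with both
inserted operators. -/
theorem traceForm₂_invariant {D D' : End ℝ (tangent k)}
    (hD : ∀ z ∈ k, ∀ x, D (adP k z x) = adP k z (D x))
    (hD' : ∀ z ∈ k, ∀ x, D' (adP k z x) = adP k z (D' x)) {z : L} (hz : z ∈ k)
    (u v : tangent k) : traceForm₂ D D' (adP k z u) v = -traceForm₂ D D' u (adP k z v) := by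
  rw [eq_neg_iff_add_eq_zero, traceForm₂_apply, traceForm₂_apply, coe_adP hz, coe_adP hz,
    adP_lie hz, adP_lie hz, ← map_add]
  have h1 : D * adP k z = adP k z * D := LinearMap.ext (hD z hz)
  have h2 : D' * adP k z = adP k z * D' := LinearMap.ext (hD' z hz)
  have h3 : D * (adP k z * adP k (u : L) - adP k (u : L) * adP k z) * D' * adP k (v : L) +
      D * adP k (u : L) * D' * (adP k z * adP k (v : L) - adP k (v : L) * adP k z) =
      adP k z * (D * adP k (u : L) * D' * adP k (v : L)) -
        (D * adP k (u : L) * D' * adP k (v : L)) * adP k z := by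
    simp only [mul_sub, sub_mul, ← mul_assoc]
    rw [← h1, mul_assoc (D * adP k (u : L)) (adP k z) D', ← h2, ← mul_assoc]
    abel
  rw [h3, map_sub, LinearMap.trace_mul_comm, sub_self]

/-- Turns the sums of squares that define structural constants into traces: the adjoint of Y ad(u) X
is -X ad(u) Y. -/
theorem sum_form_sq_eq_trace {X Y : End ℝ (tangent k)}
    (hX : ∀ x y, (standardMetric k).form (X x) y = (standardMetric k).form x (X y))
    (hY : ∀ x y, (standardMetric k).form (Y x) y = (standardMetric k).form x (Y y))
    (hXX : ∀ x, X (X x) = X x) (hYY : ∀ x, Y (Y x) = Y x) (u : tangent k) :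
    ∑ i, (standardMetric k).form (Y (adP k (u : L) (X ((standardMetric k).basis i))))
      (Y (adP k (u : L) (X ((standardMetric k).basis i)))) = -traceForm₂ X Y u u := by
  have h1 : traceForm₂ X Y u u =
      LinearMap.trace ℝ _ (X * adP k (u : L) * Y * adP k (u : L) * X) := by
    have h2 : X * X = X := LinearMap.ext hXX
    conv_rhs => rw [LinearMap.trace_mul_comm]
    simp only [← mul_assoc]
    rw [h2]
    rfl
  rw [h1, ← (standardMetric k).sum_basis, ← Finset.sum_neg_distrib]
  refine Finset.sum_congr rfl fun i _ => ?_
  simp only [Module.End.mul_apply]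
  rw [hX, form_adP, neg_neg, hY, hYY, hY]

theorem projP_lie_bracketK (x y z : tangent k) : projP k ⁅bracketK x y, (z : L)⁆ =
    projP k ⁅(z : L), projK k ⁅(y : L), (x : L)⁆⁆ := by
  have h : bracketK x y = -projK k ⁅(y : L), (x : L)⁆ := by
    rw [← map_neg, lie_skew]
    rfl
  rw [h, neg_lie, lie_skew]

theorem projK_mem (u : L) : projK k u ∈ k := sub_projP_mem u

theorem projK_of_mem_tangent {u : L} (hu : u ∈ tangent k) : projK k u = 0 := by
  rw [projK_apply]
  exact sub_eq_zero.2 (congrArg Subtype.val (projP_coe (k := k) ⟨u, hu⟩)).symm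

theorem lie_projK_mem_tangent (z : tangent k) (u : L) : ⁅(z : L), projK k u⁆ ∈ tangent k := by
  rw [← lie_skew]
  exact (tangent k).neg_mem (lie_mem_tangent (projK_mem u) z.2)

namespace IsotropySplitting

/-- The curvature of the isotropy representation, traced against an invariant operator. -/
theorem trace_bracketK (S : IsotropySplitting k) {D : End ℝ (tangent k)} (hD : ∀ z ∈ k, ∀ x, D (adP k z x) = adP k z (D x))
    (y z : tangent k) (T : End ℝ (tangent k))
    (hT : ∀ x, T x = projP k ⁅bracketK x y, (z : L)⁆) :
    LinearMap.trace ℝ _ (D * T) = -(1 / 5) * (standardMetric k).form y (D z) := by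
  -- An invariant D commutes with the action of the 𝔨-component, so it can be absorbed into z.
  -- Cyclicity then brings the trace into the form of the `casimir` field.
  have h1 : D * T = projP k ∘ₗ (LieAlgebra.ad ℝ L (D z : L) ∘ₗ projK k ∘ₗ
      LieAlgebra.ad ℝ L (y : L) ∘ₗ (tangent k).subtype) := by
    ext x : 1
    have h2 := hD _ (projK_mem (k := k) ⁅(y : L), (x : L)⁆) z
    rw [adP_apply, adP_apply, ← lie_skew, map_neg, map_neg, ← lie_skew (projK k _) (D z : L),
      map_neg, neg_inj] at h2
    rw [Module.End.mul_apply, hT, projP_lie_bracketK, h2]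
    rfl
  rw [h1, trace_tangent]
  have h3 : (LieAlgebra.ad ℝ L (D z : L) ∘ₗ projK k ∘ₗ
      LieAlgebra.ad ℝ L (y : L) ∘ₗ (tangent k).subtype) ∘ₗ projP k =
      (LieAlgebra.ad ℝ L (D z : L) ∘ₗ projK k) ∘ₗ
      (LieAlgebra.ad ℝ L (y : L) ∘ₗ (tangent k).subtype ∘ₗ projP k) := rfl
  rw [h3, LinearMap.trace_comp_comm']
  have h4 : (LieAlgebra.ad ℝ L (y : L) ∘ₗ (tangent k).subtype ∘ₗ projP k) ∘ₗ
      (LieAlgebra.ad ℝ L (D z : L) ∘ₗ projK k) =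
      LieAlgebra.ad ℝ L (y : L) ∘ₗ LieAlgebra.ad ℝ L (D z : L) ∘ₗ projK k := by
    ext u
    simp only [LinearMap.comp_apply, LieAlgebra.ad_apply, Submodule.subtype_apply]
    have h5 := projP_coe (k := k) ⟨_, lie_projK_mem_tangent (D z) u⟩
    rw [show (projP k ⁅(D z : L), projK k u⁆ : L) = ⁅(D z : L), projK k u⁆ from
      congrArg Subtype.val h5]
  rw [h4, S.casimir, form_standardMetric]
  ring

/-- Replace each projection to 𝔭 by the identity minus the projection to 𝔨. The full trace is the
Killing form, each term with one projection is a Casimir term 1/5, and the term with two vanishes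
because [𝔭, 𝔨] ⊆ 𝔭. This leaves 1 - 2/5 = 3/5 of the Killing form. -/
theorem traceForm₂_one (S : IsotropySplitting k) (y z : tangent k) :
    traceForm₂ 1 1 y z = -(3 / 5) * (standardMetric k).form y z := by
  have h1 : (1 : End ℝ (tangent k)) * adP k (y : L) * 1 * adP k (z : L) =
      projP k ∘ₗ (LieAlgebra.ad ℝ L (y : L) ∘ₗ (tangent k).subtype ∘ₗ projP k ∘ₗ
        LieAlgebra.ad ℝ L (z : L) ∘ₗ (tangent k).subtype) := rfl
  have hπ : (tangent k).subtype ∘ₗ projP k = LinearMap.id - projK k := by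
    rw [projK, sub_sub_cancel]
  have hκ : projK k ∘ₗ LieAlgebra.ad ℝ L (z : L) ∘ₗ projK k = 0 := by
    ext u
    exact projK_of_mem_tangent (lie_projK_mem_tangent z u)
  rw [traceForm₂_apply, h1, trace_tangent]
  have h2 : (LieAlgebra.ad ℝ L (y : L) ∘ₗ (tangent k).subtype ∘ₗ projP k ∘ₗ
        LieAlgebra.ad ℝ L (z : L) ∘ₗ (tangent k).subtype) ∘ₗ projP k =
      LieAlgebra.ad ℝ L (y : L) ∘ₗ ((tangent k).subtype ∘ₗ projP k) ∘ₗ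
        LieAlgebra.ad ℝ L (z : L) ∘ₗ ((tangent k).subtype ∘ₗ projP k) := rfl
  have h3 : (LieAlgebra.ad ℝ L (y : L) ∘ₗ ((tangent k).subtype ∘ₗ projP k) ∘ₗ
        LieAlgebra.ad ℝ L (z : L) ∘ₗ ((tangent k).subtype ∘ₗ projP k)) =
      LieAlgebra.ad ℝ L (y : L) ∘ₗ LieAlgebra.ad ℝ L (z : L) -
      (LieAlgebra.ad ℝ L (y : L) ∘ₗ projK k) ∘ₗ LieAlgebra.ad ℝ L (z : L) -
      LieAlgebra.ad ℝ L (y : L) ∘ₗ LieAlgebra.ad ℝ L (z : L) ∘ₗ projK k +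
      LieAlgebra.ad ℝ L (y : L) ∘ₗ (projK k ∘ₗ LieAlgebra.ad ℝ L (z : L) ∘ₗ projK k) := by
    rw [hπ]
    ext u
    simp
    abel
  have h5 := LinearMap.trace_comp_comm' (LieAlgebra.ad ℝ L (z : L))
    (LieAlgebra.ad ℝ L (y : L) ∘ₗ projK k)
  rw [h2, h3, hκ, LinearMap.comp_zero, add_zero, map_sub, map_sub, S.casimir,
    h5, S.casimir,
    form_standardMetric, killingForm_comm' (z : L)]
  have h4 : LinearMap.trace ℝ L (LieAlgebra.ad ℝ L (y : L) ∘ₗ LieAlgebra.ad ℝ L (z : L)) =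
      killingForm ℝ L (y : L) (z : L) := (LieModule.traceForm_apply_apply ℝ L L _ _).symm
  rw [h4]
  ring

end IsotropySplitting

end

/-! ### Values of the trace forms -/

section

open Module

variable {L : Type*} [LieRing L] [LieAlgebra ℝ L] [FiniteDimensional ℝ L] [CompactSemisimple L]
  {k : LieSubalgebra ℝ L}

namespace IsotropySplitting

variable (S : IsotropySplitting k)

theorem P_adP_P (u : tangent k) : S.P * adP k (S.P u : L) * S.P = 0 := by
  ext x : 1
  refine (standardMetric k).ext_form fun y => ?_
  rw [Module.End.mul_apply, Module.End.mul_apply, S.symm, ← bracketP_eq, S.bracket_P]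
  simp

theorem traceForm₂_P_P_apply (u v : tangent k) : traceForm₂ S.P S.P (S.P u) v = 0 := by
  rw [traceForm₂_apply, S.P_adP_P, zero_mul, map_zero]

theorem sum_form_P : ∑ i, (standardMetric k).form (S.P ((standardMetric k).basis i))
    (S.P ((standardMetric k).basis i)) = 100 := by
  rw [← S.trace_P, ← (standardMetric k).sum_basis]
  exact Finset.sum_congr rfl fun i _ => by rw [← S.symm, S.PP]

theorem form_P_pos {x : tangent k} (hx : S.P x ≠ 0) : (standardMetric k).form (S.P x) (S.P x) ≠ 0 :=
  ((standardMetric k).pos _ hx).ne'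

/-- The symmetry of the structural constants, `[112] = [211]`. -/
theorem sum_traceForm₂_eq : ∑ i, traceForm₂ S.P S.Q (S.P ((standardMetric k).basis i))
      (S.P ((standardMetric k).basis i)) =
    ∑ i, traceForm₂ S.P S.P (S.Q ((standardMetric k).basis i))
      (S.Q ((standardMetric k).basis i)) := by
  have h1 (u) := sum_form_sq_eq_trace S.symm_Q S.symm S.QQ S.PP u
  have h2 (u) := sum_form_sq_eq_trace S.symm S.symm S.PP S.PP u
  rw [← neg_inj, ← Finset.sum_neg_distrib, ← Finset.sum_neg_distrib]
  simp only [fun u : tangent k => traceForm₂_comm S.P S.Q u u, ← h1, ← h2]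
  rw [Finset.sum_comm]
  refine Finset.sum_congr rfl fun i _ => Finset.sum_congr rfl fun j _ => ?_
  rw [adP_skew (S.Q _) (S.P _)]
  simp

/-- Schur's lemma allows two coefficients; the first vanishes because the bracket of the first
summand with itself has no component in that summand. -/
theorem exists_P_P : ∃ b : ℝ, ∀ u v, traceForm₂ S.P S.P u v =
    b * (standardMetric k).form (S.Q u) v := by
  obtain ⟨a, b, h⟩ := S.schur_form (traceForm₂ S.P S.P) (traceForm₂_symm S.symm S.symm)
    (fun z hz => traceForm₂_invariant S.comm S.comm hz)
  obtain ⟨x, hx⟩ := S.exists_P_ne_zero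
  have h1 := h (S.P x) (S.P x)
  rw [S.traceForm₂_P_P_apply, S.PP, S.QP, map_zero, LinearMap.zero_apply, mul_zero, add_zero,
    zero_eq_mul] at h1
  have ha := h1.resolve_right (S.form_P_pos hx)
  exact ⟨b, fun u v => by rw [h, ha, zero_mul, zero_add]⟩

theorem exists_P_Q : ∃ a b : ℝ, ∀ u v, traceForm₂ S.P S.Q u v =
    a * (standardMetric k).form (S.P u) v + b * (standardMetric k).form (S.Q u) v :=
  S.schur_form (traceForm₂ S.P S.Q) (traceForm₂_symm S.symm S.symm_Q)
    (fun _ hz => traceForm₂_invariant S.comm (fun _ hz => S.comm_Q hz) hz)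

theorem one_eq : (1 : End ℝ (tangent k)) = S.P + S.Q := LinearMap.ext fun x => (S.add x).symm

theorem traceForm₂_one_eq (u v : tangent k) : traceForm₂ 1 1 u v =
    traceForm₂ S.P S.P u v + 2 * traceForm₂ S.P S.Q u v + traceForm₂ S.Q S.Q u v := by
  have h : traceForm₂ S.Q S.P u v = traceForm₂ S.P S.Q u v := by
    rw [traceForm₂_comm, traceForm₂_symm S.symm S.symm_Q]
  have h1 : (1 : End ℝ (tangent k)) * adP k (u : L) * 1 * adP k (v : L) =
      S.P * adP k (u : L) * S.P * adP k (v : L) + S.P * adP k (u : L) * S.Q * adP k (v : L) +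
      (S.Q * adP k (u : L) * S.P * adP k (v : L) + S.Q * adP k (u : L) * S.Q * adP k (v : L)) := by
    rw [S.one_eq]
    simp only [add_mul, mul_add]
    abel
  rw [traceForm₂_apply, h1, map_add, map_add, map_add]
  simp only [← traceForm₂_apply]
  rw [h]
  ring

/-- Four Schur coefficients remain: b and a for the pure forms, c and d for the mixed one. Symmetry
of the structural constants and equal dimensions give c = b and d = a; the total trace gives 2c + a
= 2d + b = -3/5. Hence all equal -1/5. -/
theorem traceForm₂_values (u v : tangent k) :
    traceForm₂ S.P S.P u v = -(1 / 5) * (standardMetric k).form (S.Q u) v ∧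
    traceForm₂ S.P S.Q u v = -(1 / 5) * (standardMetric k).form u v ∧
    traceForm₂ S.Q S.Q u v = -(1 / 5) * (standardMetric k).form (S.P u) v := by
  obtain ⟨b, hb⟩ := S.exists_P_P
  obtain ⟨c, d, hcd⟩ := S.exists_P_Q
  obtain ⟨a, ha⟩ := S.swap.exists_P_P
  change ∀ u v, traceForm₂ S.Q S.Q u v = a * (standardMetric k).form (S.P u) v at ha
  have e1 := S.sum_traceForm₂_eq
  have e2 := S.swap.sum_traceForm₂_eq
  change ∑ i, traceForm₂ S.Q S.P (S.Q ((standardMetric k).basis i))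
      (S.Q ((standardMetric k).basis i)) =
    ∑ i, traceForm₂ S.Q S.Q (S.P ((standardMetric k).basis i))
      (S.P ((standardMetric k).basis i)) at e2
  simp only [traceForm₂_comm S.Q S.P, hcd, hb, ha, S.PP, S.QP, S.PQ, S.QQ, map_zero,
    LinearMap.zero_apply, mul_zero, add_zero, zero_add, ← Finset.mul_sum] at e1 e2
  have hQ := S.swap.sum_form_P
  change ∑ i, (standardMetric k).form (S.Q ((standardMetric k).basis i))
    (S.Q ((standardMetric k).basis i)) = 100 at hQ
  rw [S.sum_form_P, hQ] at e1 e2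
  have e3 : 2 * c + a = -(3 / 5) := by
    obtain ⟨x, hx⟩ := S.exists_P_ne_zero
    have h1 := S.traceForm₂_one_eq (S.P x) (S.P x)
    rw [S.traceForm₂_one, hb, hcd, ha, S.PP, S.QP, map_zero, LinearMap.zero_apply] at h1
    have h2 := S.form_P_pos hx
    apply mul_right_cancel₀ h2
    linarith
  have e4 : 2 * d + b = -(3 / 5) := by
    obtain ⟨x, hx⟩ := S.swap.exists_P_ne_zero
    change S.Q x ≠ 0 at hx
    have h1 := S.traceForm₂_one_eq (S.Q x) (S.Q x)
    rw [S.traceForm₂_one, hb, hcd, ha, S.QQ, S.PQ, map_zero, LinearMap.zero_apply] at h1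
    have h2 := S.swap.form_P_pos hx
    change (standardMetric k).form (S.Q x) (S.Q x) ≠ 0 at h2
    apply mul_right_cancel₀ h2
    linarith
  have hb' : b = -(1 / 5) := by linarith
  have hc' : c = -(1 / 5) := by linarith
  have hd' : d = -(1 / 5) := by linarith
  have ha' : a = -(1 / 5) := by linarith
  refine ⟨by rw [hb, hb'], ?_, by rw [ha, ha']⟩
  rw [hcd, hc', hd', ← mul_add, ← LinearMap.add_apply, ← map_add, S.add]

/-- The invariant operator with eigenvalues `a` and `b` on the two summands. -/
def diag (a b : ℝ) : End ℝ (tangent k) := a • S.P + b • S.Q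

theorem diag_apply (a b : ℝ) (x) : S.diag a b x = a • S.P x + b • S.Q x := rfl

theorem diag_mul (a b c d : ℝ) : S.diag a b * S.diag c d = S.diag (a * c) (b * d) := by
  ext x : 1
  simp only [Module.End.mul_apply, diag_apply, map_add, map_smul, S.PP, S.QP, S.PQ, S.QQ, smul_zero,
    add_zero, zero_add, smul_smul, mul_comm c, mul_comm d]

theorem diag_diag (a b c d : ℝ) (x) : S.diag a b (S.diag c d x) = S.diag (a * c) (b * d) x := by
  rw [← diag_mul]; rfl

theorem diag_one : S.diag 1 1 = 1 := by
  rw [diag, one_smul, one_smul, ← S.one_eq]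

theorem diag_symm (a b : ℝ) (x y) :
    (standardMetric k).form (S.diag a b x) y = (standardMetric k).form x (S.diag a b y) := by
  simp [diag_apply, S.symm, S.symm_Q]

theorem diag_comm (a b : ℝ) {z : L} (hz : z ∈ k) (x) :
    S.diag a b (adP k z x) = adP k z (S.diag a b x) := by
  simp [diag_apply, S.comm z hz, S.comm_Q hz]

theorem trace_diag (a b : ℝ) : LinearMap.trace ℝ _ (S.diag a b) = 100 * (a + b) := by
  rw [diag, map_add, map_smul, map_smul, S.trace_P, S.trace_Q]
  simp only [smul_eq_mul]
  ring

/-- The quadratic trace form with invariant operators inserted. -/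
theorem trace_diag_adP (a b c d : ℝ) (u v : tangent k) :
    LinearMap.trace ℝ _ (S.diag a b * adP k (u : L) * S.diag c d * adP k (v : L)) =
      -(1 / 5) * ((a * d + b * c + b * d) * (standardMetric k).form (S.P u) v +
        (a * c + a * d + b * c) * (standardMetric k).form (S.Q u) v) := by
  have h : traceForm₂ S.Q S.P u v = traceForm₂ S.P S.Q u v := by
    rw [traceForm₂_comm, traceForm₂_symm S.symm S.symm_Q]
  have h1 : S.diag a b * adP k (u : L) * S.diag c d * adP k (v : L) =
      (a * c) • (S.P * adP k (u : L) * S.P * adP k (v : L)) +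
      (a * d) • (S.P * adP k (u : L) * S.Q * adP k (v : L)) +
      ((b * c) • (S.Q * adP k (u : L) * S.P * adP k (v : L)) +
      (b * d) • (S.Q * adP k (u : L) * S.Q * adP k (v : L))) := by
    simp only [diag, add_mul, mul_add, smul_mul_assoc, mul_smul_comm, smul_smul, smul_add]
    simp only [mul_comm c a, mul_comm d a, mul_comm c b, mul_comm d b]
    abel
  have hF : (standardMetric k).form u v =
      (standardMetric k).form (S.P u) v + (standardMetric k).form (S.Q u) v := by
    rw [← LinearMap.add_apply, ← map_add, S.add]
  rw [h1, map_add, map_add, map_add]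
  simp only [map_smul, ← traceForm₂_apply, smul_eq_mul]
  obtain ⟨e1, e2, e3⟩ := S.traceForm₂_values u v
  rw [h, e1, e2, e3, hF]
  ring

end IsotropySplitting

end

/-! ### Curvature of the invariant metrics -/

section

open Module

variable {L : Type*} [LieRing L] [LieAlgebra ℝ L] [FiniteDimensional ℝ L] [CompactSemisimple L]
  {k : LieSubalgebra ℝ L}

/-- The operator `x ↦ [[x, y]_k, z]_p`. -/
def isotropyCurvature (y z : tangent k) : End ℝ (tangent k) :=
  projP k ∘ₗ LieAlgebra.ad ℝ L (z : L) ∘ₗ projK k ∘ₗ LieAlgebra.ad ℝ L (y : L) ∘ₗ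
    (tangent k).subtype

theorem isotropyCurvature_apply (y z x : tangent k) :
    isotropyCurvature y z x = projP k ⁅bracketK x y, (z : L)⁆ :=
  (projP_lie_bracketK x y z).symm

namespace IsotropySplitting

variable (S : IsotropySplitting k)

/-- The operators `D ad(u) D'` with `D`, `D'` invariant. -/
def diagAd (a b : ℝ) (u : tangent k) (c d : ℝ) : End ℝ (tangent k) :=
  S.diag a b * adP k (u : L) * S.diag c d

theorem diagAd_apply (a b : ℝ) (u : tangent k) (c d : ℝ) (x) :
    S.diagAd a b u c d x = S.diag a b (adP k (u : L) (S.diag c d x)) := rfl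

/-- Cyclicity merges the invariant factors into one symmetric operator multiplying a skew one. -/
theorem trace_diagAd (a b : ℝ) (u : tangent k) (c d : ℝ) :
    LinearMap.trace ℝ _ (S.diagAd a b u c d) = 0 := by
  rw [diagAd, LinearMap.trace_mul_comm, ← mul_assoc, diag_mul]
  exact trace_adP _ (S.diag_symm _ _) _

theorem trace_diagAd_mul (a b : ℝ) (u : tangent k) (c d a' b' : ℝ) (v : tangent k) (c' d' : ℝ) :
    LinearMap.trace ℝ _ (S.diagAd a b u c d * S.diagAd a' b' v c' d') =
      -(1 / 5) * ((c' * a * (d * b') + d' * b * (c * a') + d' * b * (d * b')) *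
          (standardMetric k).form (S.P u) v +
        (c' * a * (c * a') + c' * a * (d * b') + d' * b * (c * a')) *
          (standardMetric k).form (S.Q u) v) := by
  rw [← trace_diag_adP, ← diag_mul, ← diag_mul]
  simp only [diagAd, mul_assoc]
  conv_rhs => rw [LinearMap.trace_mul_comm]
  simp only [mul_assoc]

variable {g : InvMetric k} {p q : ℝ}

/-- Skewness of ad for the standard metric solves the defining equation of U explicitly; the inverse
eigenvalues convert the standard metric back to `g`. -/
theorem nomizu_eq (hp : p ≠ 0) (hq : q ≠ 0)
    (hg : ∀ x y, g.form x y = (standardMetric k).form (S.diag p q x) y) (x y : tangent k) :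
    g.nomizu x y = (1 / 2 : ℝ) • (adP k (x : L) y +
      S.diag p⁻¹ q⁻¹ (adP k (x : L) (S.diag p q y) - adP k (S.diag p q x : L) y)) := by
  have h1 (w : tangent k) : (1 / 2 : ℝ) * (g.form (bracketP w x) y + g.form x (bracketP w y)) =
      g.form ((1 / 2 : ℝ) • S.diag p⁻¹ q⁻¹
        (adP k (x : L) (S.diag p q y) - adP k (S.diag p q x : L) y)) w := by
    have e1 : g.form (bracketP w x) y = (standardMetric k).form (adP k (x : L) (S.diag p q y)) w := by
      rw [hg, S.diag_symm, bracketP_eq, adP_skew, map_neg, LinearMap.neg_apply, form_adP, neg_neg,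
        (standardMetric k).symm]
    have e2 : g.form x (bracketP w y) = -(standardMetric k).form (adP k (S.diag p q x : L) y) w := by
      rw [hg, bracketP_eq, adP_skew, map_neg, (standardMetric k).symm, form_adP,
        ← (standardMetric k).symm, adP_skew, map_neg, LinearMap.neg_apply, neg_neg]
    rw [e1, e2, hg, map_smul, S.diag_diag, mul_inv_cancel₀ hp, mul_inv_cancel₀ hq, S.diag_one,
      Module.End.one_apply, map_smul, LinearMap.smul_apply, map_sub, LinearMap.sub_apply,
      smul_eq_mul, sub_eq_add_neg]
  rw [InvMetric.nomizu]
  simp only [h1]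
  rw [g.sum_form_smul g.basis g.basis_orthonormal, smul_add, bracketP_eq]

/-- The operator `y ↦ Λ(x) y`. -/
theorem nomizu_eq_left (hp : p ≠ 0) (hq : q ≠ 0)
    (hg : ∀ x y, g.form x y = (standardMetric k).form (S.diag p q x) y) (x y : tangent k) :
    g.nomizu x y = ((1 / 2 : ℝ) • (S.diagAd 1 1 x 1 1 + S.diagAd p⁻¹ q⁻¹ x p q -
      S.diagAd p⁻¹ q⁻¹ (S.diag p q x) 1 1)) y := by
  rw [S.nomizu_eq hp hq hg]
  simp only [LinearMap.smul_apply, LinearMap.add_apply, LinearMap.sub_apply, diagAd_apply, diag_one,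
    Module.End.one_apply, map_sub]
  rw [add_sub_assoc]

/-- The operator `x ↦ Λ(x) y`. -/
theorem nomizu_eq_right (hp : p ≠ 0) (hq : q ≠ 0)
    (hg : ∀ x y, g.form x y = (standardMetric k).form (S.diag p q x) y) (x y : tangent k) :
    g.nomizu x y = ((1 / 2 : ℝ) • (S.diagAd p⁻¹ q⁻¹ y p q - S.diagAd 1 1 y 1 1 -
      S.diagAd p⁻¹ q⁻¹ (S.diag p q y) 1 1)) x := by
  rw [S.nomizu_eq hp hq hg, adP_skew x y, adP_skew x (S.diag p q y), adP_skew (S.diag p q x) y]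
  simp only [LinearMap.smul_apply, LinearMap.add_apply, LinearMap.sub_apply, diagAd_apply, diag_one,
    Module.End.one_apply, map_sub, map_neg]
  congr 1
  abel

/-- Expresses x ↦ R(x, y)z as an operator, ready for taking traces. The vector w is Λ(y)z; its
explicit value is irrelevant because it enters linearly in ad, hence with zero trace. -/
theorem curvature_eq (hp : p ≠ 0) (hq : q ≠ 0)
    (hg : ∀ x y, g.form x y = (standardMetric k).form (S.diag p q x) y) (y z : tangent k) :
    ∃ w : tangent k, ∀ x, g.curvature x y z =
      (((1 / 2 : ℝ) • (S.diagAd p⁻¹ q⁻¹ w p q - S.diagAd 1 1 w 1 1 -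
        S.diagAd p⁻¹ q⁻¹ (S.diag p q w) 1 1)) -
      ((1 / 2 : ℝ) • (S.diagAd 1 1 y 1 1 + S.diagAd p⁻¹ q⁻¹ y p q -
        S.diagAd p⁻¹ q⁻¹ (S.diag p q y) 1 1)) *
      ((1 / 2 : ℝ) • (S.diagAd p⁻¹ q⁻¹ z p q - S.diagAd 1 1 z 1 1 -
        S.diagAd p⁻¹ q⁻¹ (S.diag p q z) 1 1)) +
      ((1 / 2 : ℝ) • (S.diagAd p⁻¹ q⁻¹ z p q - S.diagAd 1 1 z 1 1 -
        S.diagAd p⁻¹ q⁻¹ (S.diag p q z) 1 1)) * S.diagAd 1 1 y 1 1 -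
      isotropyCurvature y z) x := by
  refine ⟨g.nomizu y z, fun x => ?_⟩
  have h1 : g.nomizu (bracketP x y) z = -((1 / 2 : ℝ) • (S.diagAd p⁻¹ q⁻¹ z p q -
      S.diagAd 1 1 z 1 1 - S.diagAd p⁻¹ q⁻¹ (S.diag p q z) 1 1)) (S.diagAd 1 1 y 1 1 x) := by
    rw [S.nomizu_eq_right hp hq hg, bracketP_eq, adP_skew, map_neg]
    simp only [diagAd_apply _ 1 1 y, diag_one, Module.End.one_apply]
  rw [LinearMap.sub_apply, LinearMap.add_apply, LinearMap.sub_apply, Module.End.mul_apply,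
    Module.End.mul_apply, isotropyCurvature_apply, ← S.nomizu_eq_right hp hq hg,
    ← S.nomizu_eq_right hp hq hg, ← S.nomizu_eq_left hp hq hg, ← neg_neg (((1 / 2 : ℝ) • (S.diagAd p⁻¹ q⁻¹ z p q -
      S.diagAd 1 1 z 1 1 - S.diagAd p⁻¹ q⁻¹ (S.diag p q z) 1 1)) (S.diagAd 1 1 y 1 1 x)), ← h1,
    ← sub_eq_add_neg]
  rfl

/-- In the trace of the curvature operator the terms linear in ad vanish, the quadratic ones are
given by `trace_diagAd_mul`, and the isotropy term contributes the Casimir value 1/5. -/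
theorem ricci_eq (hp : p ≠ 0) (hq : q ≠ 0)
    (hg : ∀ x y, g.form x y = (standardMetric k).form (S.diag p q x) y) (y z : tangent k) :
    g.ricci y z =
      1 / 5 * (2 - 1 / 2 * (q / p) + 1 / 4 * (p / q) ^ 2) * (standardMetric k).form (S.P y) z +
      1 / 5 * (2 - 1 / 2 * (p / q) + 1 / 4 * (q / p) ^ 2) * (standardMetric k).form (S.Q y) z := by
  obtain ⟨w, hw⟩ := S.curvature_eq hp hq hg y z
  have hF : (standardMetric k).form y z =
      (standardMetric k).form (S.P y) z + (standardMetric k).form (S.Q y) z := by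
    rw [← LinearMap.add_apply, ← map_add, S.add]
  have hK := S.trace_bracketK (D := 1) (fun _ _ _ => rfl) y z (isotropyCurvature y z)
    (isotropyCurvature_apply y z)
  rw [one_mul, Module.End.one_apply, hF] at hK
  rw [InvMetric.ricci]
  simp only [hw]
  rw [g.sum_basis]
  simp only [map_sub, map_add, map_smul, smul_mul_assoc, mul_smul_comm, add_mul, mul_sub, sub_mul,
    trace_diagAd, trace_diagAd_mul, hK, smul_eq_mul, S.diag_apply, S.PP, S.QQ, S.PQ, S.QP,
    LinearMap.add_apply, LinearMap.smul_apply, smul_zero, add_zero, zero_add, S.form_P_Q,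
    S.form_Q_P, mul_zero, sub_zero]
  have hsP (u v : tangent k) : (standardMetric k).form (S.P u) (S.P v) =
      (standardMetric k).form (S.P u) v := by rw [← S.symm, S.PP]
  have hsQ (u v : tangent k) : (standardMetric k).form (S.Q u) (S.Q v) =
      (standardMetric k).form (S.Q u) v := by rw [← S.symm_Q, S.QQ]
  have hPs : (standardMetric k).form (S.P z) y = (standardMetric k).form (S.P y) z := by
    rw [S.symm, (standardMetric k).symm]
  have hQs : (standardMetric k).form (S.Q z) y = (standardMetric k).form (S.Q y) z := by
    rw [S.symm_Q, (standardMetric k).symm]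
  simp only [hsP, hsQ, hPs, hQs]
  field_simp
  ring

end IsotropySplitting

end

/-! ### Invariant metrics, Einstein equation and scalar curvature -/

section

open Module

variable {L : Type*} [LieRing L] [LieAlgebra ℝ L] [FiniteDimensional ℝ L] [CompactSemisimple L]
  {k : LieSubalgebra ℝ L}

theorem isotropy_coe (φ : groupK k) (x : tangent k) : (isotropy k φ x : L) = φ.1.1 (x : L) := rfl

theorem isotropy_inv_apply (φ : groupK k) (x : tangent k) :
    isotropy k φ (isotropy k φ⁻¹ x) = x :=
  Subtype.ext (φ.1.1.apply_symm_apply (x : L))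

theorem isotropy_hasDerivAt {z : L} (hz : z ∈ k) : ∃ Φ : ℝ → groupK k,
    ∀ (f : Dual ℝ (tangent k)) x,
      HasDerivAt (fun t => f (isotropy k (Φ t) x)) (f (adP k z x)) 0 := by
  obtain ⟨Φ, hΦ⟩ := exists_groupK_curve hz
  refine ⟨Φ, fun f x => ?_⟩
  have h := hΦ (f ∘ₗ projP k) (x : L)
  convert h using 2 with t
  · rw [LinearMap.comp_apply, ← isotropy_coe, projP_coe]
  · rfl

/-- An operator commuting with `Ad(K)` commutes with `ad(k)`. -/
theorem commute_adP_of_isotropy {T : End ℝ (tangent k)}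
    (hT : ∀ φ x, T (isotropy k φ x) = isotropy k φ (T x)) {z : L} (hz : z ∈ k) (x : tangent k) :
    T (adP k z x) = adP k z (T x) := by
  obtain ⟨Φ, hΦ⟩ := isotropy_hasDerivAt hz
  refine (standardMetric k).ext_form fun y => ?_
  have h1 := hΦ (((standardMetric k).form.flip y) ∘ₗ T) x
  have h2 := hΦ ((standardMetric k).form.flip y) (T x)
  simp only [LinearMap.comp_apply, hT] at h1
  exact h1.unique h2

/-- A functional vanishing on `q` is zero along every orbit curve that starts in `q`; its derivative
at time 0 is its value at ad z x. -/
theorem IsAdInvariant.adP_mem {q : Submodule ℝ (tangent k)} (hq : IsAdInvariant q) {z : L}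
    (hz : z ∈ k) {x : tangent k} (hx : x ∈ q) : adP k z x ∈ q := by
  obtain ⟨Φ, hΦ⟩ := isotropy_hasDerivAt hz
  by_contra hn
  obtain ⟨f, hf, hfq⟩ := Submodule.exists_le_ker_of_notMem hn
  have h1 := hΦ f x
  have h0 (t : ℝ) : f (isotropy k (Φ t) x) = 0 := hfq (hq _ x hx)
  simp only [h0] at h1
  exact hf (h1.unique (hasDerivAt_const 0 0))

theorem isAdInvariant_of_adP_mem {q : Submodule ℝ (tangent k)}
    (hq : ∀ z ∈ k, ∀ x ∈ q, adP k z x ∈ q) : IsAdInvariant q := by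
  intro φ x hx
  have h1 : ∀ z ∈ k, ∀ x ∈ q.map (tangent k).subtype, ⁅z, x⁆ ∈ q.map (tangent k).subtype := by
    rintro z hz _ ⟨y, hy, rfl⟩
    exact ⟨adP k z y, hq z hz y hy, coe_adP hz y⟩
  obtain ⟨y, hy, hyx⟩ := (groupK_map_mem_of_lie_mem h1 φ.2 (x : L)).2 ⟨x, hx, rfl⟩
  have : y = isotropy k φ x := Subtype.ext hyx
  rwa [← this]

namespace IsotropySplitting

variable (S : IsotropySplitting k)

theorem P_mem_range_iff {x : tangent k} : x ∈ LinearMap.range S.P ↔ S.P x = x :=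
  ⟨by rintro ⟨y, rfl⟩; exact S.PP y, fun h => ⟨x, h⟩⟩

theorem isAdInvariant_range : IsAdInvariant (LinearMap.range S.P) :=
  isAdInvariant_of_adP_mem fun z hz x hx => by
    rw [S.P_mem_range_iff] at hx ⊢
    rw [S.comm z hz, hx]

theorem P_isotropy (φ : groupK k) (x : tangent k) :
    S.P (isotropy k φ x) = isotropy k φ (S.P x) := by
  have h1 := S.isAdInvariant_range φ (S.P x) ⟨x, rfl⟩
  have h2 := S.swap.isAdInvariant_range φ (S.Q x) ⟨x, rfl⟩
  obtain ⟨y, hy⟩ := h2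
  change S.Q y = _ at hy
  rw [S.P_mem_range_iff] at h1
  conv_lhs => rw [← S.add x, map_add, map_add, h1, ← hy, S.PQ, add_zero]

theorem diag_isotropy (a b : ℝ) (φ : groupK k) (x : tangent k) :
    S.diag a b (isotropy k φ x) = isotropy k φ (S.diag a b x) := by
  have h := S.swap.P_isotropy φ x
  change S.Q _ = isotropy k φ (S.Q x) at h
  rw [diag_apply, diag_apply, S.P_isotropy, h, map_add, map_smul, map_smul]

/-- Invariant metrics are given by two positive numbers. -/
theorem exists_metric (g : InvMetric k) : ∃ p q : ℝ, 0 < p ∧ 0 < q ∧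
    ∀ x y, g.form x y = (standardMetric k).form (S.diag p q x) y := by
  obtain ⟨T, hT⟩ := (standardMetric k).exists_operator g.form
  have hcomm : ∀ φ x, T (isotropy k φ x) = isotropy k φ (T x) := fun φ x => by
    refine (standardMetric k).ext_form fun y => ?_
    conv_lhs => rw [← isotropy_inv_apply φ y, hT, g.invariant, ← hT,
      ← (standardMetric k).invariant φ, isotropy_inv_apply]
  obtain ⟨p, q, hpq⟩ := S.schur T
    (fun x y => by rw [hT, g.symm, ← hT, (standardMetric k).symm])
    (fun z hz x => commute_adP_of_isotropy hcomm hz x)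
  have hg (x y) : g.form x y = (standardMetric k).form (S.diag p q x) y := by
    rw [← hT, hpq]; rfl
  refine ⟨p, q, ?_, ?_, hg⟩
  · obtain ⟨x, hx⟩ := S.exists_P_ne_zero
    have h1 := g.pos _ hx
    rw [hg, diag_apply, S.PP, S.QP, smul_zero, add_zero, map_smul, LinearMap.smul_apply,
      smul_eq_mul] at h1
    exact pos_of_mul_pos_left h1 ((standardMetric k).pos _ hx).le
  · obtain ⟨x, hx⟩ := S.swap.exists_P_ne_zero
    change S.Q x ≠ 0 at hx
    have h1 := g.pos _ hx
    rw [hg, diag_apply, S.PQ, S.QQ, smul_zero, zero_add, map_smul, LinearMap.smul_apply,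
      smul_eq_mul] at h1
    exact pos_of_mul_pos_left h1 ((standardMetric k).pos _ hx).le

theorem standardMetric_eq (x y : tangent k) :
    (standardMetric k).form x y = (standardMetric k).form (S.diag 1 1 x) y := by
  rw [S.diag_one, Module.End.one_apply]

theorem form_eq_add (x y : tangent k) : (standardMetric k).form x y =
    (standardMetric k).form (S.P x) y + (standardMetric k).form (S.Q x) y := by
  rw [← LinearMap.add_apply, ← map_add, S.add]

theorem isEinsteinWith (S : IsotropySplitting k) : (standardMetric k).IsEinsteinWith (7 / 20) := by
  intro x y
  rw [S.ricci_eq one_ne_zero one_ne_zero S.standardMetric_eq, S.form_eq_add x y]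
  ring

/-- Compare the two Ricci eigenvalues relative to the metric. Their difference is divisible by p -
q, and the cofactor has no positive zeros. -/
theorem eq_smul_of_isEinsteinWith (S : IsotropySplitting k) (g : InvMetric k) (ρ : ℝ)
    (h : g.IsEinsteinWith ρ) :
    ∃ c : ℝ, 0 < c ∧ ∀ x y, g.form x y = c * (standardMetric k).form x y := by
  obtain ⟨p, q, hp, hq, hg⟩ := S.exists_metric g
  have h1 : 1 / 5 * (2 - 1 / 2 * (q / p) + 1 / 4 * (p / q) ^ 2) = ρ * p := by
    obtain ⟨x, hx⟩ := S.exists_P_ne_zero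
    have h1 := h (S.P x) (S.P x)
    rw [S.ricci_eq hp.ne' hq.ne' hg, hg, diag_apply, S.PP, S.QP, smul_zero, add_zero, map_smul,
      LinearMap.smul_apply, smul_eq_mul, map_zero, LinearMap.zero_apply, mul_zero, add_zero,
      ← mul_assoc] at h1
    exact mul_right_cancel₀ (S.form_P_pos hx) h1
  have h2 : 1 / 5 * (2 - 1 / 2 * (p / q) + 1 / 4 * (q / p) ^ 2) = ρ * q := by
    obtain ⟨x, hx⟩ := S.swap.exists_P_ne_zero
    change S.Q x ≠ 0 at hx
    have h1 := h (S.Q x) (S.Q x)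
    rw [S.ricci_eq hp.ne' hq.ne' hg, hg, diag_apply, S.PQ, S.QQ, smul_zero, zero_add, map_smul,
      LinearMap.smul_apply, smul_eq_mul, map_zero, LinearMap.zero_apply, mul_zero, zero_add,
      ← mul_assoc] at h1
    exact mul_right_cancel₀ (S.swap.form_P_pos hx) h1
  have h3 : (p - q) * (p * q * (3 * p ^ 2 - 5 * (p * q) + 3 * q ^ 2)) = 0 := by
    have h4 : (1 / 5 * (2 - 1 / 2 * (q / p) + 1 / 4 * (p / q) ^ 2)) * q =
        (1 / 5 * (2 - 1 / 2 * (p / q) + 1 / 4 * (q / p) ^ 2)) * p := by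
      rw [h1, h2]; ring
    field_simp at h4
    linear_combination (p * q / 2) * h4
  have h5 : p * q * (3 * p ^ 2 - 5 * (p * q) + 3 * q ^ 2) ≠ 0 := by
    -- The form is definite: its discriminant is 25 - 36 < 0.
    have h6 : 0 < 3 * p ^ 2 - 5 * (p * q) + 3 * q ^ 2 := by
      nlinarith [sq_nonneg (p - q), mul_pos hp hq]
    positivity
  have h6 : p = q := sub_eq_zero.1 ((mul_eq_zero.1 h3).resolve_right h5)
  refine ⟨p, hp, fun x y => ?_⟩
  rw [hg, ← h6, diag_apply, ← smul_add, S.add, map_smul, LinearMap.smul_apply, smul_eq_mul]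

theorem scal_eq (S : IsotropySplitting k) {g : InvMetric k} {p q : ℝ} (hp : p ≠ 0) (hq : q ≠ 0)
    (hg : ∀ x y, g.form x y = (standardMetric k).form (S.diag p q x) y) :
    g.scal = 40 * (1 / p + 1 / q) - 5 * (q / p ^ 2 + p / q ^ 2) := by
  have h1 (x) : g.ricci x x = g.form
      (S.diag (1 / 5 * (2 - 1 / 2 * (q / p) + 1 / 4 * (p / q) ^ 2) / p)
        (1 / 5 * (2 - 1 / 2 * (p / q) + 1 / 4 * (q / p) ^ 2) / q) x) x := by
    rw [S.ricci_eq hp hq hg, hg, diag_diag, mul_div_cancel₀ _ hp, mul_div_cancel₀ _ hq, diag_apply]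
    simp
  rw [InvMetric.scal]
  simp only [h1]
  rw [g.sum_basis, S.trace_diag]
  field_simp
  ring

end IsotropySplitting

end

/-! ### Volume, global maximum, irreducibility and inequivalence -/

section

open Module

variable {L : Type*} [LieRing L] [LieAlgebra ℝ L] [FiniteDimensional ℝ L] [CompactSemisimple L]
  {k : LieSubalgebra ℝ L}

namespace IsotropySplitting

variable (S : IsotropySplitting k)

theorem isCompl_range : IsCompl (LinearMap.range S.P) (LinearMap.range S.Q) := by
  rw [isCompl_iff]
  constructor
  · rw [Submodule.disjoint_def]
    rintro _ ⟨x, rfl⟩ ⟨y, hy⟩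
    rw [← S.PP, ← hy, S.PQ]
  · rw [codisjoint_iff, eq_top_iff]
    intro x _
    rw [← S.add x]
    exact Submodule.add_mem_sup ⟨x, rfl⟩ ⟨x, rfl⟩

theorem finrank_range : finrank ℝ (LinearMap.range S.P) = 100 := by
  have h : LinearMap.IsProj (LinearMap.range S.P) S.P :=
    ⟨fun x => ⟨x, rfl⟩, fun x hx => S.P_mem_range_iff.1 hx⟩
  have h1 := h.trace
  rw [S.trace_P] at h1
  exact_mod_cast h1.symm

theorem det_diag (a b : ℝ) : LinearMap.det (S.diag a b) = (a * b) ^ 100 := by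
  let e := Submodule.prodEquivOfIsCompl _ _ S.isCompl_range
  have h : S.diag a b = e.toLinearMap ∘ₗ
      ((a • LinearMap.id).prodMap (b • LinearMap.id)) ∘ₗ e.symm.toLinearMap := by
    rw [← LinearMap.comp_assoc, ← LinearEquiv.comp_toLinearMap_symm_eq]
    refine LinearMap.ext fun x => ?_
    obtain ⟨⟨_, u, rfl⟩, ⟨_, v, rfl⟩⟩ := x
    simp [e, diag_apply, S.PP, S.QQ, S.PQ, S.QP]
  have hQ : finrank ℝ (LinearMap.range S.Q) = 100 := S.swap.finrank_range
  rw [h, LinearMap.det_conj, LinearMap.det_prodMap, LinearMap.det_smul, LinearMap.det_smul,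
    LinearMap.det_id, LinearMap.det_id, S.finrank_range, hQ, mul_pow]
  ring

theorem relVolume_eq {g : InvMetric k} {p q : ℝ}
    (hg : ∀ x y, g.form x y = (standardMetric k).form (S.diag p q x) y) :
    g.relVolume = √((p * q) ^ 100) := by
  rw [InvMetric.relVolume, ← S.det_diag, ← LinearMap.det_toMatrix (standardMetric k).basis,
    ← Matrix.det_transpose]
  congr 2
  ext i j
  rw [Matrix.transpose_apply, Matrix.of_apply, LinearMap.toMatrix_apply, hg]
  conv_lhs => rw [← (standardMetric k).basis.sum_repr (S.diag p q _)]
  simp only [map_sum, map_smul, LinearMap.sum_apply, LinearMap.smul_apply,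
    (standardMetric k).basis_orthonormal]
  simp

/-- Equal volume means pq = 1. With t = p + q the scalar curvature is 55t - 5t³, and its value 70 at
t = 2 exceeds it by 5(t - 2)(t² + 2t - 7), which is nonnegative for t ≥ 2. -/
theorem isGlobalMax (S : IsotropySplitting k) : (standardMetric k).IsGlobalMax := by
  intro g hg
  obtain ⟨p, q, hp, hq, h⟩ := S.exists_metric g
  change g.relVolume = (standardMetric k).relVolume at hg
  change g.scal ≤ (standardMetric k).scal
  rw [S.relVolume_eq h, S.relVolume_eq S.standardMetric_eq, mul_one, one_pow, Real.sqrt_one,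
    Real.sqrt_eq_one] at hg
  have hpq : p * q = 1 := (pow_eq_one_iff_of_nonneg (mul_pos hp hq).le (by norm_num)).1 hg
  rw [S.scal_eq hp.ne' hq.ne' h, S.scal_eq one_ne_zero one_ne_zero S.standardMetric_eq]
  have h1 : 1 / p = q := by rw [div_eq_iff hp.ne', mul_comm, hpq]
  have h2 : 1 / q = p := by rw [div_eq_iff hq.ne', hpq]
  have h3 : q / p ^ 2 = q ^ 3 := by
    rw [div_eq_iff (by positivity)]
    linear_combination (-q - q ^ 2 * p) * hpq
  have h4 : p / q ^ 2 = p ^ 3 := by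
    rw [div_eq_iff (by positivity)]
    linear_combination (-p - p ^ 2 * q) * hpq
  rw [h1, h2, h3, h4]
  have h5 : 2 ≤ p + q := by nlinarith [sq_nonneg (p - q)]
  have h6 : 0 ≤ (p + q - 2) * ((p + q) ^ 2 + 2 * (p + q) - 7) :=
    mul_nonneg (by linarith) (by nlinarith)
  have h7 : q ^ 3 + p ^ 3 = (p + q) ^ 3 - 3 * (p + q) := by
    linear_combination (-3 * (p + q)) * hpq
  rw [h7]
  nlinarith

/-- The orthogonal projection onto an invariant subspace is `ad(k)`-equivariant. -/
theorem exists_orthogonal_projection {q : Submodule ℝ (tangent k)} (hq : IsAdInvariant q) :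
    ∃ T : End ℝ (tangent k), (∀ x, T x ∈ q) ∧ (∀ x ∈ q, T x = x) ∧
      (∀ x y, (standardMetric k).form (T x) y = (standardMetric k).form x (T y)) ∧
      ∀ z ∈ k, ∀ x, T (adP k z x) = adP k z (T x) := by
  set e := ((standardMetric k).restrict q).basis with he
  let T : End ℝ (tangent k) :=
    ∑ a, ((standardMetric k).form.flip (e a : tangent k)).smulRight (e a : tangent k)
  have hT (x) : T x = ∑ a, (standardMetric k).form x (e a : tangent k) • (e a : tangent k) := by
    simp [T]
  have h1 : ∀ x, T x ∈ q := fun x => by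
    rw [hT]
    exact Submodule.sum_mem _ fun a _ => q.smul_mem _ (e a).2
  have h2 : ∀ x ∈ q, T x = x := fun x hx => by
    have h := ((standardMetric k).restrict q).sum_form_smul e
      ((standardMetric k).restrict q).basis_orthonormal ⟨x, hx⟩
    have h' := congrArg Subtype.val h
    rw [AddSubmonoidClass.coe_finsetSum] at h'
    rw [hT]
    exact h'
  have h3 : ∀ x y, (standardMetric k).form (T x) y = (standardMetric k).form x (T y) :=
    fun x y => by
      rw [hT, hT]
      simp [(standardMetric k).symm y, mul_comm]
  refine ⟨T, h1, h2, h3, fun z hz x => ?_⟩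
  -- The orthogonal complement of an invariant subspace is invariant, since ad z is skew.
  have h4 : T (adP k z (x - T x)) = 0 := by
    refine (standardMetric k).ext_form fun y => ?_
    rw [h3, form_adP, map_sub, LinearMap.sub_apply, h3, h2 _ (hq.adP_mem hz (h1 y)), sub_self,
      neg_zero, map_zero, LinearMap.zero_apply]
  rw [map_sub, map_sub, sub_eq_zero] at h4
  rw [h4, h2 _ (hq.adP_mem hz (h1 x))]

/-- The orthogonal projection onto an invariant subspace is a symmetric invariant operator, so by
Schur it is a scalar on the summand; on a nonzero subspace that scalar is 1. -/
theorem isAdIrreducible_range : IsAdIrreducible (LinearMap.range S.P) := by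
  refine ⟨S.isAdInvariant_range, fun h => ?_, fun q hq hinv => ?_⟩
  · obtain ⟨x, hx⟩ := S.exists_P_ne_zero
    have : S.P x ∈ (⊥ : Submodule ℝ (tangent k)) := h ▸ ⟨x, rfl⟩
    exact hx this
  · obtain ⟨T, h1, h2, h3, h4⟩ := exists_orthogonal_projection hinv
    obtain ⟨a, b, hab⟩ := S.schur T h3 h4
    by_cases hbot : q = ⊥
    · exact Or.inl hbot
    · refine Or.inr (le_antisymm hq ?_)
      obtain ⟨w, hw, hw0⟩ := q.ne_bot_iff.1 hbot
      have hwP := S.P_mem_range_iff.1 (hq hw)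
      have ha : a = 1 := by
        have h5 := hab w
        rw [h2 w hw, ← hwP, S.PP, S.QP, smul_zero, add_zero, hwP] at h5
        have h6 : (a - 1) • w = 0 := by rw [sub_smul, one_smul, ← h5, sub_self]
        exact sub_eq_zero.1 ((smul_eq_zero.1 h6).resolve_right hw0)
      rintro _ ⟨x, rfl⟩
      have h5 := hab (S.P x)
      rw [S.PP, S.QP, smul_zero, add_zero, ha, one_smul] at h5
      rw [← h5]
      exact h1 _

/-- Extend an equivalence by zero to an operator N on 𝔭. The sum of N and its adjoint M is symmetric
and invariant, hence preserves both summands by Schur. But on the first summand it is N plus a term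
that pairs to zero with the image of N, so N has to vanish there. -/
theorem not_adEquivalent : ¬ AdEquivalent (LinearMap.range S.P) (LinearMap.range S.Q) := by
  rintro ⟨e, he⟩
  let N : End ℝ (tangent k) :=
    (LinearMap.range S.Q).subtype ∘ₗ e.toLinearMap ∘ₗ S.P.rangeRestrict
  have hN (x) : N x = e ⟨S.P x, x, rfl⟩ := rfl
  have hcomm : ∀ z ∈ k, ∀ x, N (adP k z x) = adP k z (N x) := fun z hz x =>
    commute_adP_of_isotropy (fun φ x => by
      rw [hN, hN]
      exact he φ _ _ (S.P_isotropy φ x)) hz x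
  obtain ⟨M, hM⟩ := (standardMetric k).exists_operator
    ((standardMetric k).form.compl₁₂ LinearMap.id N)
  simp only [LinearMap.compl₁₂_apply, LinearMap.id_apply] at hM
  obtain ⟨a, b, hab⟩ := S.schur (N + M) (fun x y => by
    rw [LinearMap.add_apply, LinearMap.add_apply, map_add, map_add, LinearMap.add_apply, hM,
      (standardMetric k).symm x (M y), hM, (standardMetric k).symm y, add_comm]) (fun z hz x => by
    rw [LinearMap.add_apply, LinearMap.add_apply, map_add, hcomm z hz]
    congr 1
    refine (standardMetric k).ext_form fun y => ?_
    rw [hM, form_adP, form_adP, hM, hcomm z hz])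
  obtain ⟨x, hx⟩ := S.exists_P_ne_zero
  have h1 := congrArg (fun u => (standardMetric k).form u (N x)) (hab (S.P x))
  have hQN : S.Q (N x) = N x := S.swap.P_mem_range_iff.1 (e _).2
  have hNP : N (S.P x) = N x := by
    rw [hN, hN]
    congr 2
    exact Subtype.ext (S.PP x)
  have hNN : N (N x) = 0 := by
    have h0 : (⟨S.P (N x), N x, rfl⟩ : LinearMap.range S.P) = 0 := by
      apply Subtype.ext
      change S.P (N x) = 0
      rw [← hQN, S.PQ]
    rw [hN, h0, map_zero]
    rfl
  simp only [LinearMap.add_apply, map_add, hM, hNN, hNP, S.PP, S.QP, smul_zero, add_zero, map_smul,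
    LinearMap.smul_apply, map_zero] at h1
  rw [← hQN, S.form_P_Q, smul_zero] at h1
  by_cases h2 : N x = 0
  · rw [hN] at h2
    have h3 : e ⟨S.P x, x, rfl⟩ = 0 := Subtype.ext h2
    rw [LinearEquiv.map_eq_zero_iff] at h3
    exact hx (congrArg Subtype.val h3)
  · rw [hQN] at h1
    exact ((standardMetric k).pos _ h2).ne' h1

end IsotropySplitting

end

/-! ### The Lichnerowicz Laplacian and the structural constants -/

section

open Module

variable {L : Type*} [LieRing L] [LieAlgebra ℝ L] [FiniteDimensional ℝ L] [CompactSemisimple L]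
  {k : LieSubalgebra ℝ L}

namespace IsotropySplitting

variable (S : IsotropySplitting k)

theorem nomizu_standardMetric (S : IsotropySplitting k) (x y : tangent k) :
    (standardMetric k).nomizu x y = (1 / 2 : ℝ) • adP k (x : L) y := by
  rw [S.nomizu_eq one_ne_zero one_ne_zero S.standardMetric_eq, inv_one, S.diag_one]
  simp

/-- Schur's lemma makes A diagonal, and vanishing trace with equal dimensions makes the eigenvalues
opposite. The divergence condition is automatic: tested on w, it is the trace of a symmetric
operator times the skew ad w. -/
theorem isTT_iff (A : End ℝ (tangent k)) :
    (standardMetric k).IsTT A ↔ ∃ a : ℝ, A = S.diag a (-a) := by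
  constructor
  · rintro ⟨⟨h1, h2⟩, h3, -⟩
    obtain ⟨a, b, hab⟩ := S.schur A h1 (fun z hz x => commute_adP_of_isotropy h2 hz x)
    have hA : A = S.diag a b := LinearMap.ext hab
    rw [hA, S.trace_diag] at h3
    exact ⟨a, by rw [hA, show b = -a by linarith]⟩
  · rintro ⟨a, rfl⟩
    refine ⟨⟨S.diag_symm _ _, S.diag_isotropy _ _⟩, by rw [S.trace_diag]; ring, ?_⟩
    refine (standardMetric k).ext_form fun w => ?_
    have h1 (x : tangent k) : (standardMetric k).form
        ((standardMetric k).covDeriv (S.diag a (-a)) x x) w = (1 / 2 : ℝ) *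
          (standardMetric k).form ((S.diag a (-a) * adP k (w : L)) x) x := by
      have h0 : adP k (x : L) x = 0 := by rw [adP_apply, lie_self, map_zero]
      rw [InvMetric.covDeriv, S.nomizu_standardMetric, S.nomizu_standardMetric, h0, smul_zero,
        map_zero, sub_zero, map_smul, LinearMap.smul_apply, smul_eq_mul, form_adP, adP_skew x w,
        map_neg, neg_neg, Module.End.mul_apply, S.diag_symm _ _ (adP k (w : L) x),
        (standardMetric k).symm (S.diag a (-a) x)]
    rw [InvMetric.divergence, map_sum, LinearMap.sum_apply]
    simp only [h1]
    rw [← Finset.mul_sum, (standardMetric k).sum_basis, trace_adP _ (S.diag_symm _ _), mul_zero,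
      map_zero, LinearMap.zero_apply]

theorem sum_form_adP_adP (a b : ℝ) (x y : tangent k) :
    ∑ i, (standardMetric k).form (adP k ((standardMetric k).basis i : L)
      (S.diag a b (adP k ((standardMetric k).basis i : L) x))) y =
      -(1 / 5) * ((a + b + b) * (standardMetric k).form (S.P x) y +
        (a + a + b) * (standardMetric k).form (S.Q x) y) := by
  have h := S.trace_diag_adP 1 1 a b y x
  rw [← (standardMetric k).sum_basis] at h
  have hP : (standardMetric k).form (S.P y) x = (standardMetric k).form (S.P x) y := by
    rw [S.symm, (standardMetric k).symm]
  have hQ : (standardMetric k).form (S.Q y) x = (standardMetric k).form (S.Q x) y := by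
    rw [S.symm_Q, (standardMetric k).symm]
  rw [hP, hQ] at h
  refine Eq.trans (Finset.sum_congr rfl fun i _ => ?_) (h.trans (by ring))
  simp only [S.diag_one, Module.End.mul_apply, Module.End.one_apply]
  rw [form_adP, form_adP, adP_skew ((standardMetric k).basis i) x,
    adP_skew ((standardMetric k).basis i) y]
  simp

/-- With Λ(x) = ½ ad x and Λ(e)e = 0, the second derivative is ¼ of the double commutator of ad e
with A. The two outer terms contribute -3/20 each and the middle one -1/10. -/
theorem sum_covDeriv₂ (a : ℝ) (x y : tangent k) :
    ∑ i, (standardMetric k).form ((standardMetric k).covDeriv₂ (S.diag a (-a))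
      ((standardMetric k).basis i) ((standardMetric k).basis i) x) y =
      -(2 / 5) * (standardMetric k).form (S.diag a (-a) x) y := by
  have h1 (e : tangent k) : (standardMetric k).form
      ((standardMetric k).covDeriv₂ (S.diag a (-a)) e e x) y = (1 / 4 : ℝ) *
        (standardMetric k).form (adP k (e : L) (S.diag 1 1 (adP k (e : L) (S.diag a (-a) x)))) y -
      (1 / 2 : ℝ) * (standardMetric k).form (adP k (e : L) (S.diag a (-a) (adP k (e : L) x))) y +
      (1 / 4 : ℝ) * (standardMetric k).form (adP k (e : L) (S.diag 1 1 (adP k (e : L) x)))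
        (S.diag a (-a) y) := by
    have h0 : adP k (e : L) e = 0 := by rw [adP_apply, lie_self, map_zero]
    simp only [InvMetric.covDeriv₂, InvMetric.covDeriv, S.nomizu_standardMetric, h0, smul_zero,
      ZeroMemClass.coe_zero, map_zero, LinearMap.zero_apply, sub_zero, S.diag_one,
      Module.End.one_apply, ← S.diag_symm]
    simp only [map_sub, map_smul, LinearMap.sub_apply, LinearMap.smul_apply, smul_eq_mul, smul_sub]
    ring
  simp only [h1, Finset.sum_add_distrib, Finset.sum_sub_distrib, ← Finset.mul_sum,
    S.sum_form_adP_adP]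
  simp only [S.diag_apply, map_add, map_smul, LinearMap.add_apply,
    LinearMap.smul_apply, smul_eq_mul, ← S.symm, ← S.symm_Q, S.PP, S.PQ, S.QP, S.QQ, map_zero, LinearMap.zero_apply]
  ring

theorem diag_mul_diagAd (a b a' b' : ℝ) (u : tangent k) (c d : ℝ) :
    S.diag a b * S.diagAd a' b' u c d = S.diagAd (a * a') (b * b') u c d := by
  rw [diagAd, ← mul_assoc, ← mul_assoc, diag_mul, diagAd]

/-- Up to terms linear in ad, the curvature operator is ¼ ad x ad y - ½ ad y ad x minus the isotropy
term. Traced against A, each of the two products gives A/5 and the isotropy term gives -A/5, so the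
total is (1/4 - 1/2 + 1)/5 = 3/20. -/
theorem trace_curvature_standardMetric (a : ℝ) (x y : tangent k) :
    ∑ i, (standardMetric k).form (S.diag a (-a) ((standardMetric k).curvature
      ((standardMetric k).basis i) x y)) ((standardMetric k).basis i) =
      3 / 20 * (standardMetric k).form (S.diag a (-a) x) y := by
  obtain ⟨w, hw⟩ := S.curvature_eq one_ne_zero one_ne_zero S.standardMetric_eq x y
  have hK := S.trace_bracketK (D := S.diag a (-a)) (fun _ hz => S.diag_comm _ _ hz) x y
    (isotropyCurvature x y) (isotropyCurvature_apply x y)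
  simp only [hw, ← Module.End.mul_apply]
  rw [(standardMetric k).sum_basis]
  simp only [S.diag_one, Module.End.one_apply, inv_one, mul_sub, mul_add, sub_mul, add_mul,
    smul_mul_assoc, mul_smul_comm, ← mul_assoc, diag_mul_diagAd, map_sub, map_add, map_smul,
    trace_diagAd, trace_diagAd_mul, hK, smul_eq_mul]
  have hP : (standardMetric k).form (S.P y) x = (standardMetric k).form (S.P x) y := by
    rw [S.symm, (standardMetric k).symm]
  have hQ : (standardMetric k).form (S.Q y) x = (standardMetric k).form (S.Q x) y := by
    rw [S.symm_Q, (standardMetric k).symm]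
  simp only [S.diag_apply, map_add, map_smul, LinearMap.add_apply,
    LinearMap.smul_apply, smul_eq_mul, ← S.symm, ← S.symm_Q, hP, hQ]
  ring

/-- Rough Laplacian, two Ricci terms and the curvature term add up to 2/5 + 7/20 + 7/20 - 2·3/20 =
4/5. -/
theorem lichnerowicz_eq (a : ℝ) (x y : tangent k) :
    (standardMetric k).lichnerowicz (S.diag a (-a)) x y =
      4 / 5 * (standardMetric k).form (S.diag a (-a) x) y := by
  have h1 : ∑ i, (standardMetric k).ricci x ((standardMetric k).basis i) *
      (standardMetric k).form (S.diag a (-a) ((standardMetric k).basis i)) y =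
      7 / 20 * (standardMetric k).form (S.diag a (-a) x) y := by
    rw [S.diag_symm, ← (standardMetric k).sum_form_mul_form _ (standardMetric k).basis_orthonormal,
      Finset.mul_sum]
    exact Finset.sum_congr rfl fun i _ => by rw [S.isEinsteinWith, S.diag_symm, mul_assoc]
  have h2 : ∑ i, (standardMetric k).ricci y ((standardMetric k).basis i) *
      (standardMetric k).form (S.diag a (-a) x) ((standardMetric k).basis i) =
      7 / 20 * (standardMetric k).form (S.diag a (-a) x) y := by
    rw [← (standardMetric k).sum_form_mul_form _ (standardMetric k).basis_orthonormal _ y,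
      Finset.mul_sum]
    exact Finset.sum_congr rfl fun i _ => by
      rw [S.isEinsteinWith, (standardMetric k).symm y, mul_assoc, mul_comm ((standardMetric k).form _ y)]
  rw [InvMetric.lichnerowicz, S.sum_covDeriv₂, h1, h2, S.trace_curvature_standardMetric]
  ring

theorem diag_ne_zero {a : ℝ} (ha : a ≠ 0) : S.diag a (-a) ≠ 0 := by
  intro h
  obtain ⟨x, hx⟩ := S.exists_P_ne_zero
  have h1 := LinearMap.congr_fun h (S.P x)
  rw [S.diag_apply, S.PP, S.QP, smul_zero, add_zero, LinearMap.zero_apply] at h1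
  exact (smul_ne_zero ha hx) h1

theorem isLeast_lichnerowiczSpectrum (S : IsotropySplitting k) :
    IsLeast (standardMetric k).lichnerowiczSpectrum (4 / 5) := by
  constructor
  · exact ⟨S.diag 1 (-1), (S.isTT_iff _).2 ⟨1, rfl⟩, S.diag_ne_zero one_ne_zero,
      S.lichnerowicz_eq 1⟩
  · rintro lam ⟨A, hA, hA0, h⟩
    obtain ⟨a, rfl⟩ := (S.isTT_iff A).1 hA
    obtain ⟨x, hx⟩ : ∃ x, S.diag a (-a) x ≠ 0 := by
      by_contra! h0
      exact hA0 (LinearMap.ext h0)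
    have h1 := h x (S.diag a (-a) x)
    rw [S.lichnerowicz_eq] at h1
    exact (mul_right_cancel₀ ((standardMetric k).pos _ hx).ne' h1).le

theorem isGStable (S : IsotropySplitting k) : (standardMetric k).IsGStable := by
  refine ⟨7 / 20, S.isEinsteinWith, fun A hA hA0 => ?_⟩
  obtain ⟨a, rfl⟩ := (S.isTT_iff A).1 hA
  have ha : a ≠ 0 := by
    rintro rfl
    apply hA0
    rw [diag, neg_zero, zero_smul, zero_smul, add_zero]
  -- The factor is 2ρ - 4/5 = -1/10.
  have h1 (x : tangent k) : 2 * (7 / 20) * (standardMetric k).form (S.diag a (-a) x)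
      (S.diag a (-a) x) - (standardMetric k).lichnerowicz (S.diag a (-a)) x (S.diag a (-a) x) =
      -(1 / 10) * (standardMetric k).form (S.diag (a * a) (-a * -a) x) x := by
    rw [S.lichnerowicz_eq, ← S.diag_diag, S.diag_symm _ _ (S.diag a (-a) x)]
    ring
  rw [InvMetric.secondVariation]
  simp only [h1]
  rw [← Finset.mul_sum, (standardMetric k).sum_basis, S.trace_diag]
  have := mul_self_pos.2 ha
  nlinarith

/-- The structural constants as traces. -/
theorem structConst_eq {X Y Z : End ℝ (tangent k)}
    (hX : ∀ x y, (standardMetric k).form (X x) y = (standardMetric k).form x (X y))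
    (hY : ∀ x y, (standardMetric k).form (Y x) y = (standardMetric k).form x (Y y))
    (hZ : ∀ x y, (standardMetric k).form (Z x) y = (standardMetric k).form x (Z y))
    (hXX : ∀ x, X (X x) = X x) (hYY : ∀ x, Y (Y x) = Y x) (hZZ : ∀ x, Z (Z x) = Z x) :
    structConst (LinearMap.range X) (LinearMap.range Y) (LinearMap.range Z) =
      -∑ i, traceForm₂ Y Z (X ((standardMetric k).basis i)) (X ((standardMetric k).basis i)) := by
  have hr {X : End ℝ (tangent k)} (hXX : ∀ x, X (X x) = X x) :
      ∀ x ∈ LinearMap.range X, X x = x := by rintro _ ⟨x, rfl⟩; exact hXX x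
  have h1 (w : tangent k) : ∑ c, (standardMetric k).form w
      (((standardMetric k).restrict (LinearMap.range Z)).basis c : tangent k) ^ 2 =
      (standardMetric k).form (Z w) (Z w) := by
    have h := (standardMetric k).sum_restrict_basis (LinearMap.mem_range_self Z) (hr hZZ) hZ
      (LinearMap.mk₂ ℝ (fun x y => (standardMetric k).form w x * (standardMetric k).form w y)
        (by intros; simp [add_mul]) (by intros; simp [mul_assoc]) (by intros; simp [mul_add])
        (by intros; simp; ring))
    simp only [LinearMap.mk₂_apply, ← sq] at h
    rw [h, ← (standardMetric k).sum_form_mul_form _ (standardMetric k).basis_orthonormal]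
    refine Finset.sum_congr rfl fun i _ => ?_
    rw [← hZ, (standardMetric k).symm _ (Z w), sq]
  have h2 (u : tangent k) : ∑ b, (standardMetric k).form
      (Z (adP k (u : L) (((standardMetric k).restrict (LinearMap.range Y)).basis b : tangent k)))
      (Z (adP k (u : L) (((standardMetric k).restrict (LinearMap.range Y)).basis b : tangent k))) =
      -traceForm₂ Y Z u u := by
    rw [← sum_form_sq_eq_trace hY hZ hYY hZZ]
    exact (standardMetric k).sum_restrict_basis (LinearMap.mem_range_self Y) (hr hYY) hY
      ((standardMetric k).form.compl₁₂ (Z ∘ₗ adP k (u : L)) (Z ∘ₗ adP k (u : L)))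
  rw [structConst]
  simp only [h1, bracketP_eq, h2]
  rw [Finset.sum_neg_distrib, (standardMetric k).sum_restrict_basis 
    (LinearMap.mem_range_self X) (hr hXX) hX]

theorem structConst_PPP : structConst (LinearMap.range S.P) (LinearMap.range S.P)
    (LinearMap.range S.P) = 0 := by
  rw [structConst_eq S.symm S.symm S.symm S.PP S.PP S.PP]
  simp [S.traceForm₂_P_P_apply]

theorem structConst_PPQ : structConst (LinearMap.range S.P) (LinearMap.range S.P)
    (LinearMap.range S.Q) = 20 := by
  rw [structConst_eq S.symm S.symm S.symm_Q S.PP S.PP S.QQ]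
  simp only [(S.traceForm₂_values _ _).2.1]
  rw [← Finset.mul_sum, S.sum_form_P]
  norm_num

theorem structConst_PQQ : structConst (LinearMap.range S.P) (LinearMap.range S.Q)
    (LinearMap.range S.Q) = 20 := by
  rw [structConst_eq S.symm S.symm_Q S.symm_Q S.PP S.QQ S.QQ]
  simp only [(S.traceForm₂_values _ _).2.2, S.PP]
  rw [← Finset.mul_sum, S.sum_form_P]
  norm_num

end IsotropySplitting

end

/-! ### From the root decomposition to the isotropy splitting -/

section

open Module

variable {L : Type*} [LieRing L] [LieAlgebra ℝ L] [FiniteDimensional ℝ L] [CompactSemisimple L]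
  {k : LieSubalgebra ℝ L}

theorem projP_lie {z : L} (hz : z ∈ k) (u : L) : projP k ⁅z, u⁆ = adP k z (projP k u) := by
  have h : projP k ⁅z, u - (projP k u : L)⁆ = 0 := projP_of_mem (k.lie_mem hz (sub_projP_mem u))
  rw [lie_sub, map_sub, sub_eq_zero] at h
  exact h

/-- The data of an isotropy splitting from two subspaces of the Lie algebra. -/
theorem nonempty_isotropySplitting (R : Fin 2 → Submodule ℝ L)
    (hk : ∀ m, ∀ z ∈ k, ∀ x ∈ R m, killingForm ℝ L z x = 0)
    (hsup : k.toSubmodule ⊔ R 0 ⊔ R 1 = ⊤)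
    (horth : ∀ x ∈ R 0, ∀ y ∈ R 1, killingForm ℝ L x y = 0)
    (hlie : ∀ m, ∀ z ∈ k, ∀ x ∈ R m, ⁅z, x⁆ ∈ R m)
    (hbr : ∀ m, ∀ x ∈ R m, ∀ y ∈ R m, ∀ z ∈ R m, killingForm ℝ L ⁅x, y⁆ z = 0)
    (htr : ∀ m, ∀ y : L, ∀ z ∈ R m, LinearMap.trace ℝ L
      (LieAlgebra.ad ℝ L y ∘ₗ LieAlgebra.ad ℝ L z ∘ₗ projK k) = 1 / 5 * killingForm ℝ L y z)
    (hrank : ∀ m, finrank ℝ (R m) = 100)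
    (hschur : ∀ T : End ℝ L, (∀ z ∈ k, ∀ x, T ⁅z, x⁆ = ⁅z, T x⁆) →
      (∀ x y, killingForm ℝ L (T x) y = killingForm ℝ L x (T y)) →
      ∀ m, ∃ c : ℝ, ∀ x ∈ R m, T x = c • x) : Nonempty (IsotropySplitting k) := by
  have hle (m) : R m ≤ tangent k := fun x hx z hz => hk m z hz x hx
  let p : Fin 2 → Submodule ℝ (tangent k) := fun m => (R m).comap (tangent k).subtype
  have hpR (m) {x : tangent k} (hx : x ∈ p m) : (x : L) ∈ R m := hx
  have hcompl : IsCompl (p 0) (p 1) := by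
    rw [isCompl_iff]
    constructor
    · rw [Submodule.disjoint_def]
      intro x hx hx'
      by_contra h
      have h1 := (standardMetric k).pos x h
      rw [form_standardMetric, horth _ (hpR 0 hx) _ (hpR 1 hx'), neg_zero] at h1
      exact lt_irrefl _ h1
    · rw [codisjoint_iff, eq_top_iff]
      intro x _
      have h1 : (x : L) ∈ k.toSubmodule ⊔ R 0 ⊔ R 1 := by rw [hsup]; exact Submodule.mem_top
      obtain ⟨u, hu, c, hc, h2⟩ := Submodule.mem_sup.1 h1
      obtain ⟨a, ha, b, hb, rfl⟩ := Submodule.mem_sup.1 hu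
      have h3 : x = ⟨b, hle 0 hb⟩ + ⟨c, hle 1 hc⟩ := by
        have h4 := congrArg (projP k) h2
        rw [map_add, map_add, projP_of_mem ha, zero_add, projP_coe] at h4
        rw [← h4]
        congr 1
        · exact projP_coe ⟨b, hle 0 hb⟩
        · exact projP_coe ⟨c, hle 1 hc⟩
      rw [h3]
      exact Submodule.add_mem_sup hb hc
  let P : End ℝ (tangent k) := (p 0).projection (p 1) hcompl
  let Q : End ℝ (tangent k) := (p 1).projection (p 0) hcompl.symm
  have hP (x) : P x ∈ p 0 := Submodule.projection_apply_mem hcompl x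
  have hQ (x) : Q x ∈ p 1 := Submodule.projection_apply_mem hcompl.symm x
  have hPid (x) (hx : x ∈ p 0) : P x = x := Submodule.projection_apply_of_mem_left hcompl hx
  have hQid (x) (hx : x ∈ p 1) : Q x = x := Submodule.projection_apply_of_mem_left hcompl.symm hx
  have hPzero (x) (hx : x ∈ p 1) : P x = 0 := (Submodule.projection_apply_eq_zero_iff hcompl).2 hx
  have hQzero (x) (hx : x ∈ p 0) : Q x = 0 :=
    (Submodule.projection_apply_eq_zero_iff hcompl.symm).2 hx
  have hadd (x) : P x + Q x = x := Submodule.projection_add_projection_eq_self hcompl x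
  have hPQ (x y) : (standardMetric k).form (P x) (Q y) = 0 := by
    rw [form_standardMetric, horth _ (hpR 0 (hP x)) _ (hpR 1 (hQ y)), neg_zero]
  have hadP (m) {z : L} (hz : z ∈ k) {x} (hx : x ∈ p m) : adP k z x ∈ p m := by
    change (adP k z x : L) ∈ R m
    rw [coe_adP hz]
    exact hlie m z hz _ hx
  have htrace (m) {D : End ℝ (tangent k)} (h1 : ∀ x, D x ∈ p m) (h2 : ∀ x ∈ p m, D x = x) :
      LinearMap.trace ℝ _ D = 100 := by
    have h3 : LinearMap.IsProj (p m) D := ⟨h1, h2⟩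
    rw [h3.trace, (Submodule.comapSubtypeEquivOfLe (hle m)).finrank_eq, hrank]
    norm_num
  refine ⟨{
    P := P
    Q := Q
    add := hadd
    PQ := fun x => hPzero _ (hQ x)
    QP := fun x => hQzero _ (hP x)
    symm := fun x y => ?_
    comm := fun z hz x => ?_
    bracket_P := fun x y z => ?_
    bracket_Q := fun x y z => ?_
    casimir := fun y z => ?_
    schur := fun T h1 h2 => ?_
    trace_P := htrace 0 hP hPid
    trace_Q := htrace 1 hQ hQid }⟩
  · conv_lhs => rw [← hadd y, map_add, hPQ, add_zero]
    conv_rhs => rw [← hadd x, map_add, LinearMap.add_apply, (standardMetric k).symm (Q x), hPQ,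
      add_zero]
  · conv_lhs => rw [← hadd x, map_add, map_add, hPzero _ (hadP 1 hz (hQ x)), add_zero,
      hPid _ (hadP 0 hz (hP x))]
  · rw [bracketP, form_projP_left, hbr 0 _ (hpR 0 (hP x)) _ (hpR 0 (hP y)) _ (hpR 0 (hP z)), neg_zero]
  · rw [bracketP, form_projP_left, hbr 1 _ (hpR 1 (hQ x)) _ (hpR 1 (hQ y)) _ (hpR 1 (hQ z)), neg_zero]
  · have h : (z : L) = (P z : L) + (Q z : L) := congrArg Subtype.val (hadd z).symm
    rw [h, map_add, LinearMap.add_comp, LinearMap.comp_add, map_add, htr 0 _ _ (hpR 0 (hP z)),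
      htr 1 _ _ (hpR 1 (hQ z)), map_add, mul_add]
  -- Schur's lemma is available for operators on all of `L`, so extend T by zero on 𝔨; the extension
  -- is still symmetric and 𝔨-equivariant.
  · let TL : End ℝ L := (tangent k).subtype ∘ₗ T ∘ₗ projP k
    have e1 : ∀ z ∈ k, ∀ x, TL ⁅z, x⁆ = ⁅z, TL x⁆ := fun z hz x => by
      change (T (projP k ⁅z, x⁆) : L) = ⁅z, (T (projP k x) : L)⁆
      rw [projP_lie hz, h2 z hz, coe_adP hz]
    have e2 : ∀ x y, killingForm ℝ L (TL x) y = killingForm ℝ L x (TL y) := fun x y => by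
      have e3 := form_projP_left y (T (projP k x))
      have e4 := form_projP_left x (T (projP k y))
      rw [(standardMetric k).symm, h1, e4, neg_inj] at e3
      change killingForm ℝ L (T (projP k x) : L) y = _
      rw [killingForm_comm', ← e3]
      rfl
    obtain ⟨a, ha⟩ := hschur TL e1 e2 0
    obtain ⟨b, hb⟩ := hschur TL e1 e2 1
    have hTL (x : tangent k) : TL (x : L) = (T x : L) := by
      change (T (projP k (x : L)) : L) = _
      rw [projP_coe]
    refine ⟨a, b, fun x => ?_⟩
    apply Subtype.ext
    rw [← hTL]
    conv_lhs => rw [← hadd x, Submodule.coe_add, map_add, ha _ (hpR 0 (hP x)), hb _ (hpR 1 (hQ x))]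
    rfl

theorem exists_isotropySplitting (hL : IsTypeE8 (ℂ ⊗[ℝ] L))
    (hk : Nonempty (k ≃ₗ⁅ℝ⁆ (su 5 × su 5))) : Nonempty (IsotropySplitting k) := by
  obtain ⟨_, H, _, A, hE, hc, hA⟩ := exists_matrixUnits hL k hk
  -- The two summands are the real points of the parts of degree ±1 and ±2.
  let d : Fin 2 → ℕ := ![1, 2]
  have hd (m) : d m = 1 ∨ d m = 2 := by fin_cases m <;> simp [d]
  refine nonempty_isotropySplitting (fun m => realPoints (A.subP (d m))) ?_ ?_ ?_ ?_ ?_ ?_ ?_ ?_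
  · exact fun m z hz x hx => MatrixUnits.killingForm_realPoints hA (hd m) hz hx
  · exact MatrixUnits.sup_realPoints hE hc hA
  · intro x hx y hy
    have h := A.killingForm_subP_subP (x := (1 : ℂ) ⊗ₜ[ℝ] x) (y := (1 : ℂ) ⊗ₜ[ℝ] y) hx hy
    rw [killingForm_one_tmul] at h
    exact_mod_cast h
  · exact fun m z hz x hx => MatrixUnits.lie_mem_realPoints hE hA (hd m) hz hx
  · intro m x hx y hy z hz
    have h := MatrixUnits.killingForm_lie_subP (A := A) (hd m) (x := (1 : ℂ) ⊗ₜ[ℝ] x)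
      (y := (1 : ℂ) ⊗ₜ[ℝ] y) (z := (1 : ℂ) ⊗ₜ[ℝ] z) hx hy hz
    rw [lie_one_tmul, killingForm_one_tmul] at h
    exact_mod_cast h
  · intro m y z hz
    refine MatrixUnits.trace_ad_ad_proj (A := A) hE hA (projK k) (fun z hz => ?_)
      (fun n hn x hx => ?_) hc (hd m) y hz
    · rw [projK_apply, projP_of_mem hz]
      exact sub_zero z
    · exact projK_of_mem_tangent fun z hz => MatrixUnits.killingForm_realPoints hA hn hz hx
  · intro m
    rw [finrank_realPoints _ fun u hu => MatrixUnits.conjC_mem_subP hc hu]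
    exact MatrixUnits.finrank_subP hE A (hd m)
  · exact fun T h1 h2 m => MatrixUnits.exists_scalar_realPoints hE hA T h1 h2 (hd m)

end

end HomEinstein

end

open HomEinstein in
theorem mainTheorem9 {L : Type*} [LieRing L] [LieAlgebra ℝ L] [FiniteDimensional ℝ L]
    [CompactSemisimple L] (hL : IsTypeE8 (ℂ ⊗[ℝ] L))
    (k : LieSubalgebra ℝ L) (hk : Nonempty (k ≃ₗ⁅ℝ⁆ (su 5 × su 5))) :
    -- the isotropy representation and the structural constants
    (∃ p₁ p₂ : Submodule ℝ (tangent k),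
      IsCompl p₁ p₂ ∧ (∀ x ∈ p₁, ∀ y ∈ p₂, (standardMetric k).form x y = 0) ∧
      IsAdIrreducible p₁ ∧ IsAdIrreducible p₂ ∧ ¬ AdEquivalent p₁ p₂ ∧
      Module.finrank ℝ p₁ = 100 ∧ Module.finrank ℝ p₂ = 100 ∧
      structConst p₁ p₁ p₁ = 0 ∧ structConst p₂ p₂ p₂ = 0 ∧
      structConst p₁ p₁ p₂ = 20 ∧ structConst p₁ p₂ p₂ = 20) ∧
    -- the Einstein constant
    (standardMetric k).IsEinsteinWith (7 / 20) ∧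
    -- the smallest eigenvalue of the Lichnerowicz Laplacian on invariant TT-tensors
    IsLeast (standardMetric k).lichnerowiczSpectrum (4 / 5) ∧ (4 / 5 : ℝ) > 2 * (7 / 20) ∧
    (standardMetric k).IsGStable ∧
    -- uniqueness among invariant Einstein metrics, up to scaling
    (∀ (g : InvMetric k) (ρ : ℝ), g.IsEinsteinWith ρ →
      ∃ c : ℝ, 0 < c ∧ ∀ x y, g.form x y = c * (standardMetric k).form x y) ∧
    (standardMetric k).IsGlobalMax := by
  obtain ⟨S⟩ := exists_isotropySplitting hL hk
  refine ⟨⟨LinearMap.range S.P, LinearMap.range S.Q, S.isCompl_range, ?_,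
    S.isAdIrreducible_range, S.swap.isAdIrreducible_range, S.not_adEquivalent, S.finrank_range,
    S.swap.finrank_range, S.structConst_PPP, S.swap.structConst_PPP, S.structConst_PPQ,
    S.structConst_PQQ⟩, S.isEinsteinWith, S.isLeast_lichnerowiczSpectrum, by norm_num,
    S.isGStable, S.eq_smul_of_isEinsteinWith, S.isGlobalMax⟩
  rintro _ ⟨x, rfl⟩ _ ⟨y, rfl⟩
  exact S.form_P_Q x y
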